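/- Let $\mathcal U,\mathcal U_o\subset\mathbb R^{M}$ be linear subspaces of dimensions $r\ge 2$ and $r_o\ge 2$ with $\mathcal U\not\subseteq\mathcal U_o$ and $\mathcal U_o\not\subseteq\mathcal U$, and let $\mathbf U,\mathbf U_o,\mathbf U^{\perp}$ be matrices whose columns are orthonormal bases of $\mathcal U$, $\mathcal U_o$ and the orthogonal complement of $\mathcal U$. Let $\mathbf b_1,\dots,\mathbf b_{n_o}$ ($n_o\ge1$, the outliers) be uniformly distributed on the unit sphere of $\mathcal U_o$ and $\mathbf a_1,\dots,\mathbf a_{n_i}$ (the inliers) uniformly distributed on the unit sphere of $\mathcal U$, all of these vectors being independent. Let $\mathbf D=[\mathbf B\ \mathbf A]$ be the matrix with columns $\mathbf d_1=\mathbf b_1,\dots,\mathbf d_{n_o}=\mathbf b_{n_o},\ \mathbf d_{n_o+1}=\mathbf a_1,\dots,\mathbf d_{n_o+n_i}=\mathbf a_{n_i}$. For each $k$ let $\mathbf c_k^*$ be an optimal point of $\min_{\mathbf c}\|\mathbf D^T\mathbf c\|_1$ subject to $\mathbf c^T\mathbf d_k=1$; the Innovation Value of $\mathbf d_k$ is $1/\|\mathbf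 D^T\mathbf c_k^*\|_1$. Let $\|\cdot\|$ be the spectral norm of a matrix, let $0<\delta<1$, and put $$\chi=\max_{j\le n_o}\|\mathbf c_j^*\|_2,\qquad n_z'=\max_{j\le n_o}\bigl|\{k\in[n_o]:\mathbf b_k^T\mathbf c_j^*=0\}\bigr|,\qquad \xi=\frac{\min_{j\le n_o}\|\mathbf b_j^T\mathbf U^\perp\|_2}{\|\mathbf U_o^T\mathbf U^\perp\|},$$ $$\mathcal A=\sqrt{\tfrac2\pi}\,\frac{n_i}{\sqrt r}-2\sqrt{n_i}-\sqrt{\frac{2n_i\log\frac1\delta}{r-1}},\qquad \eta_\delta'=\max\left(\tfrac43\log\frac{2r_o}{\delta},\ \sqrt{4\,\frac{n_o}{r_o}\log\frac{2r_o}{\delta}}\right).$$ Consider the three inequalities $$\mathcal A>2n_z'\|\mathbf U^T\mathbf U_o\|+2\|\mathbf U^T\mathbf U_o\|\sqrt{n_o\log\tfrac{n_o}{\delta}},$$ $$\mathcal A>\frac{2\|\mathbf U^T\mathbf U_o\|}{\xi}\left(\frac{n_o}{\sqrt{r_o}}+2\sqrt{n_o}+\sqrt{\frac{2n_o\log\frac1\delta}{r_o-1}}+2\sqrt{\Bigl(\frac{n_o}{r_o}+\eta_\delta'\Bigr)\log\frac{n_o}{\delta}}+n_z'\right),$$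 $$\mathcal A>\left(\frac{\chi n_o}{\sqrt{r_o}}+2\sqrt{\chi n_o}+\sqrt{\chi\,\frac{2n_o\log\frac1\delta}{r_o-1}}\right)\|\mathbf U_o^T\mathbf U^\perp\|.$$ Then there is an event of probability at least $1-5\delta$ on which, for every choice of the optimal points $\mathbf c_k^*$ for which these three inequalities hold, every inlier has a strictly smaller Innovation Value than every outlier, and $\mathcal U$ is recovered exactly: collecting columns of $\mathbf D$ with the smallest Innovation Values until they span an $r$-dimensional subspace is possible, and the resulting span always equals $\mathcal U$. -/

import Mathlib

open MeasureTheory ProbabilityTheory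
open scoped ENNReal RealInnerProductSpace

noncomputable section

namespace ISearch

/-- The ambient space `ℝ^M` with the Euclidean norm. -/
abbrev Vec (M : ℕ) : Type := EuclideanSpace ℝ (Fin M)

/-- The uniform probability measure on the unit sphere of the subspace `V`, as a measure on the
ambient space: the surface measure of the unit sphere of `V`, normalized to mass one. -/
def uniformSphere {M : ℕ} (V : Submodule ℝ (Vec M)) : Measure (Vec M) :=
  (((volume : Measure V).toSphere Set.univ)⁻¹ • (volume : Measure V).toSphere).map
    (fun x : Metric.sphere (0 : V) 1 => ((x : V) : Vec M))

/-- `‖Vᵀ W‖` (spectral norm) for orthonormal basis matrices of `V` and `W`, written without bases: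
the operator norm of the orthogonal projection onto `V` restricted to `W`. -/
def crossNorm {M : ℕ} (V W : Submodule ℝ (Vec M)) : ℝ :=
  ‖V.starProjection ∘L W.subtypeL‖

section Algorithm

variable {M : ℕ} {ι : Type*} [Fintype ι]

/-- `‖Dᵀ c‖₁`, where `D i` are the columns of the data matrix. -/
def l1 (D : ι → Vec M) (c : Vec M) : ℝ := ∑ i, |⟪D i, c⟫|

/-- `c` is an optimal point of: minimize `‖Dᵀ c‖₁` subject to `cᵀ d = 1`. -/
def IsOptimalDirection (D : ι → Vec M) (d c : Vec M) : Prop :=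
  ⟪d, c⟫ = 1 ∧ ∀ c' : Vec M, ⟪d, c'⟫ = 1 → l1 D c ≤ l1 D c'

/-- The Innovation Value `1 / ‖Dᵀ c‖₁` given by an optimal direction `c`. -/
def innovationValue (D : ι → Vec M) (c : Vec M) : ℝ := 1 / l1 D c

/-- `W` is a possible output of the algorithm with target dimension `r` on the data `D`, given the
optimal directions `c`: the span of columns with the smallest Innovation Values, so many of them
that this span is `r`-dimensional (ties are broken arbitrarily). -/
def IsOutput (D : ι → Vec M) (c : ι → Vec M) (r : ℕ) (W : Submodule ℝ (Vec M)) : Prop :=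
  ∃ S : Set ι,
    (∀ i ∈ S, ∀ j ∉ S, innovationValue D (c i) ≤ innovationValue D (c j)) ∧
    W = Submodule.span ℝ (D '' S) ∧ Module.finrank ℝ W = r

/-- `U` is recovered exactly: the algorithm has an output, and all its outputs are `U`. -/
def RecoversExactly (D : ι → Vec M) (c : ι → Vec M) (r : ℕ) (U : Submodule ℝ (Vec M)) : Prop :=
  (∃ W, IsOutput D c r W) ∧ ∀ W, IsOutput D c r W → W = U

end Algorithm

section Quantities

variable {M no ni : ℕ}

/-- `χ`: the largest norm of the optimal directions of the outliers. -/
def chi (c : Fin no ⊕ Fin ni → Vec M) : ℝ := ⨆ j : Fin no, ‖c (Sum.inl j)‖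

/-- `n_z'`: the largest number of outliers that are orthogonal to the optimal direction of one
outlier. -/
def nz (D c : Fin no ⊕ Fin ni → Vec M) : ℕ :=
  ⨆ j : Fin no, Set.ncard {k : Fin no | ⟪D (Sum.inl k), c (Sum.inl j)⟫ = 0}

/-- `ξ`: the smallest norm of the projections of the outliers onto `Uᗮ`, divided by
`‖U_oᵀ U^⊥‖`. -/
def xi (U Uo : Submodule ℝ (Vec M)) (D : Fin no ⊕ Fin ni → Vec M) : ℝ :=
  (⨅ j : Fin no, ‖Uᗮ.starProjection (D (Sum.inl j))‖) / crossNorm Uo Uᗮ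

/-- `𝒜 = √(2/π) n_i / √r - 2 √n_i - √(2 n_i log(1/δ) / (r - 1))`. -/
def calA (ni r : ℕ) (δ : ℝ) : ℝ :=
  √(2 / Real.pi) * (ni / √(r : ℝ)) - 2 * √(ni : ℝ)
    - √(2 * ni * Real.log (1 / δ) / ((r : ℝ) - 1))

/-- `η'_δ = max (4/3 log(2 r_o/δ)) √(4 (n_o/r_o) log(2 r_o/δ))`. -/
def etaPrime (no ro : ℕ) (δ : ℝ) : ℝ :=
  max (4 / 3 * Real.log (2 * ro / δ)) √(4 * (no / ro) * Real.log (2 * ro / δ))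

/-- The three sufficient inequalities, for the data `D` (outliers `D (Sum.inl j)`, inliers
`D (Sum.inr i)`) and the optimal directions `c`. -/
def Conditions (r ro : ℕ) (U Uo : Submodule ℝ (Vec M)) (δ : ℝ)
    (D c : Fin no ⊕ Fin ni → Vec M) : Prop :=
  calA ni r δ > 2 * nz D c * crossNorm U Uo
      + 2 * crossNorm U Uo * √(no * Real.log (no / δ)) ∧
  calA ni r δ > 2 * crossNorm U Uo / xi U Uo D *
      (no / √(ro : ℝ) + 2 * √(no : ℝ) + √(2 * no * Real.log (1 / δ) / ((ro : ℝ) - 1))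
        + 2 * √(((no : ℝ) / ro + etaPrime no ro δ) * Real.log (no / δ)) + nz D c) ∧
  calA ni r δ > (chi c * no / √(ro : ℝ) + 2 * √(chi c * no)
        + √(chi c * (2 * no * Real.log (1 / δ) / ((ro : ℝ) - 1)))) * crossNorm Uo Uᗮ

end Quantities

end ISearch

end

/-! Write κ = ‖UᵀU_o‖, κ' = ‖U_oᵀU^⊥‖, and x for the reciprocal of the smallest ‖b_jᵀU^⊥‖. Two
concentration bounds suffice: 𝒜‖u‖ ≤ ∑|⟨a_i,u⟩| for all u ∈ U, and ∑|⟨b_k,w⟩| ≤ s‖w‖ for all w ∈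
U_o, where s = (n_o√(2/π) + √(n_o r_o) + √(2 n_o log(1/δ)))/m and m is the mean norm of a standard
Gaussian vector in dimension r_o. Each fails with probability at most δ, and almost surely no
outlier lies in U, so the total failure 2δ is within the allowed 5δ.

On these events the argument is deterministic. A feasible direction for an inlier has a projection
onto U of norm at least 1, so it costs at least 𝒜. For an outlier, the rescaled projection of b_j
onto U^⊥ is feasible, is invisible to the inliers and costs at most xκ's. Hence everything reduces
to xκ's < 𝒜; the strict separation of costs then forces exact recovery (`recoversExactly_of_lt`).
The third inequality is nearly this bound, but it has χ for x and √χ in the lower-order terms. The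
second inequality makes the inliers so dominant that the optimal directions of outliers are
orthogonal to U (`mem_orthogonal_of_isOptimalDirection`), whence x ≤ χ. Replacing √x by x is paid
for as follows: x²(1 - κ²) ≤ 1 keeps x near 1 unless κ is large, and when κ is not small the first
or second inequality contributes. `outlier_bound_of_conditions` balances the three, using the slack
in 2/π < 1 and in m² ≥ r_o - 1/2.

The concentration bounds come from a Gordon-type comparison. For Gaussian z_i, g and a fixed unit
vector v₀, the family ∑ψ(⟨u,z_i⟩) + √n⟨v₀,g⟩ is compared with ∑ψ(⟨v₀,z_i⟩) + √n⟨u,g⟩, in which u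
meets only one Gaussian vector. Since |ψ'| ≤ 1, rotating the first family into the second can only
decrease the expected resolvent of its exponential sum (`integral_inv_add_expSum_le`). Resolvents
integrate to moments of order ν < 1, and ν → 0 removes the cardinality of the family and the
smoothing of |·|. Jensen's inequality in the radii passes from Gaussian vectors to the sphere, and
Chernoff's bound finishes. -/

namespace ISearch

/-! ### Density of the standard Gaussian measure and integration by parts. -/

section StdGaussian

variable {E : Type*} [NormedAddCommGroup E] [InnerProductSpace ℝ E] [FiniteDimensional ℝ E]
  [MeasurableSpace E] [BorelSpace E]

/-- The density of the standard Gaussian measure of a Euclidean space. -/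
noncomputable def gaussDensity (x : E) : ℝ :=
  (2 * Real.pi) ^ (-(Module.finrank ℝ E : ℝ) / 2) * Real.exp (-‖x‖ ^ 2 / 2)

lemma gaussDensity_pos (x : E) : 0 < gaussDensity x := by
  unfold gaussDensity; positivity

lemma continuous_gaussDensity : Continuous (gaussDensity : E → ℝ) := by
  unfold gaussDensity; fun_prop

lemma integrable_exp_neg_mul_sq_norm {b : ℝ} (hb : 0 < b) :
    Integrable (fun x : E => Real.exp (-b * ‖x‖ ^ 2)) := by
  have h := GaussianFourier.integrable_cexp_neg_mul_sq_norm_add (V := E) (b := (b : ℂ))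
    (by simpa using hb) 0 0
  convert h.norm using 2 with x
  simp [Complex.norm_exp, ← Complex.ofReal_pow]

lemma integrable_gaussDensity : Integrable (gaussDensity : E → ℝ) := by
  unfold gaussDensity
  refine Integrable.const_mul ?_ _
  convert integrable_exp_neg_mul_sq_norm (E := E) (b := 1 / 2) (by norm_num) using 3
  ring

lemma integral_gaussDensity : ∫ x : E, gaussDensity x = 1 := by
  have h := GaussianFourier.integral_rexp_neg_mul_sq_norm (V := E) (b := 1 / 2) (by norm_num)
  unfold gaussDensity
  rw [integral_const_mul]
  have : ∀ x : E, Real.exp (-‖x‖ ^ 2 / 2) = Real.exp (-(1 / 2) * ‖x‖ ^ 2) := by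
    intro x; congr 1; ring
  simp_rw [this, h]
  rw [show Real.pi / (1 / 2) = 2 * Real.pi by ring, ← Real.rpow_add (by positivity)]
  rw [show -(Module.finrank ℝ E : ℝ) / 2 + (Module.finrank ℝ E : ℝ) / 2 = 0 by ring, Real.rpow_zero]

/-- Both sides have characteristic function exp(-‖t‖²/2). -/
lemma stdGaussian_eq_withDensity :
    stdGaussian E = volume.withDensity (fun x => ENNReal.ofReal (gaussDensity x)) := by
  have hfin : IsFiniteMeasure ((volume : Measure E).withDensity
      (fun x => ENNReal.ofReal (gaussDensity x))) := by
    apply isFiniteMeasure_withDensity_ofReal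
    exact integrable_gaussDensity.2
  apply Measure.ext_of_charFun
  ext t
  rw [charFun_stdGaussian, charFun_apply, integral_withDensity_eq_integral_toReal_smul
    (by have := continuous_gaussDensity (E := E); fun_prop) (by simp)]
  have h := GaussianFourier.integral_cexp_neg_mul_sq_norm_add (V := E) (b := (1 / 2 : ℂ))
    (by norm_num) Complex.I t
  have h2 : ∀ x : E, (ENNReal.ofReal (gaussDensity x)).toReal • Complex.exp (⟪x, t⟫ * Complex.I)
      = (((2 * Real.pi) ^ (-(Module.finrank ℝ E : ℝ) / 2) : ℝ) : ℂ) *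
        Complex.exp (-(1 / 2) * ‖x‖ ^ 2 + Complex.I * ⟪t, x⟫) := by
    intro x
    rw [ENNReal.toReal_ofReal (gaussDensity_pos x).le, gaussDensity, Complex.real_smul,
      Complex.ofReal_mul, mul_assoc, Complex.ofReal_exp, ← Complex.exp_add, real_inner_comm]
    congr 2
    push_cast; ring
  simp_rw [h2]
  rw [integral_const_mul, h, ← mul_assoc]
  have h3 : (((2 * Real.pi) ^ (-(Module.finrank ℝ E : ℝ) / 2) : ℝ) : ℂ) *
      (Real.pi / (1 / 2)) ^ (Module.finrank ℝ E / 2 : ℂ) = 1 := by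
    rw [show (Real.pi / (1 / 2) : ℂ) = ((2 * Real.pi : ℝ) : ℂ) by push_cast; ring,
      show (Module.finrank ℝ E / 2 : ℂ) = ((Module.finrank ℝ E / 2 : ℝ) : ℂ) by push_cast; ring,
      ← Complex.ofReal_cpow (by positivity), ← Complex.ofReal_mul, ← Real.rpow_add (by positivity)]
    rw [show -(Module.finrank ℝ E : ℝ) / 2 + (Module.finrank ℝ E : ℝ) / 2 = 0 by ring,
      Real.rpow_zero]
    simp
  rw [h3, one_mul]
  congr 1
  rw [Complex.I_sq]; ring

lemma integral_stdGaussian (f : E → ℝ) :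
    ∫ x, f x ∂(stdGaussian E) = ∫ x, gaussDensity x * f x := by
  rw [stdGaussian_eq_withDensity, integral_withDensity_eq_integral_toReal_smul
    (by have := continuous_gaussDensity (E := E); fun_prop) (by simp)]
  simp [ENNReal.toReal_ofReal (gaussDensity_pos _).le]

lemma integrable_stdGaussian_iff (f : E → ℝ) :
    Integrable f (stdGaussian E) ↔ Integrable (fun x => gaussDensity x * f x) := by
  rw [stdGaussian_eq_withDensity, integrable_withDensity_iff_integrable_smul'
    (by have := continuous_gaussDensity (E := E); fun_prop) (by simp)]
  simp [ENNReal.toReal_ofReal (gaussDensity_pos _).le]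

lemma integrable_norm_stdGaussian : Integrable (fun x : E => ‖x‖) (stdGaussian E) :=
  (IsGaussian.integrable_id (μ := stdGaussian E)).norm

lemma hasLineDerivAt_gaussDensity (x v : E) :
    HasLineDerivAt ℝ gaussDensity (-(⟪v, x⟫ * gaussDensity x)) x v := by
  unfold HasLineDerivAt gaussDensity
  have h1 : HasDerivAt (fun t : ℝ => ‖x + t • v‖ ^ 2) (2 * ⟪x, v⟫) 0 := by
    have h : HasDerivAt (fun t : ℝ => x + t • v) v 0 := by
      simpa using ((hasDerivAt_id (0 : ℝ)).smul_const v).const_add x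
    simpa using h.norm_sq
  have h2 := ((h1.neg.div_const 2).exp).const_mul
    ((2 * Real.pi) ^ (-(Module.finrank ℝ E : ℝ) / 2))
  refine h2.congr_deriv ?_
  simp [real_inner_comm]; ring

/-- Gaussian integration by parts along a vector `v`. -/
lemma integral_inner_mul_stdGaussian {G G' : E → ℝ} {v : E} {C : ℝ}
    (hG : Continuous G) (hG' : Continuous G') (hGb : ∀ x, |G x| ≤ C) (hGb' : ∀ x, |G' x| ≤ C)
    (hd : ∀ x, HasLineDerivAt ℝ G (G' x) x v) :
    ∫ x, ⟪v, x⟫ * G x ∂(stdGaussian E) = ∫ x, G' x ∂(stdGaussian E) := by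
  have hcd := continuous_gaussDensity (E := E)
  have i1 : Integrable G' (stdGaussian E) :=
    Integrable.of_bound hG'.aestronglyMeasurable C (.of_forall hGb')
  have i2 : Integrable G (stdGaussian E) :=
    Integrable.of_bound hG.aestronglyMeasurable C (.of_forall hGb)
  have i3 : Integrable (fun x => ⟪v, x⟫ * G x) (stdGaussian E) := by
    refine Integrable.mono' ((integrable_norm_stdGaussian (E := E)).const_mul (‖v‖ * C))
      (by fun_prop) (.of_forall fun x => ?_)
    rw [Real.norm_eq_abs, abs_mul]
    calc |⟪v, x⟫| * |G x| ≤ (‖v‖ * ‖x‖) * C :=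
          mul_le_mul (abs_real_inner_le_norm v x) (hGb x) (abs_nonneg _) (by positivity)
      _ = ‖v‖ * C * ‖x‖ := by ring
  rw [integrable_stdGaussian_iff] at i1 i2 i3
  rw [integral_stdGaussian, integral_stdGaussian]
  have key := integral_bilinear_hasLineDerivAt_right_eq_neg_left_of_integrable
    (μ := (volume : Measure E)) (f := gaussDensity) (f' := fun x => -(⟪v, x⟫ * gaussDensity x))
    (g := G) (g' := G') (v := v) (B := ContinuousLinearMap.mul ℝ ℝ)
    (by
      refine (i3.neg).congr (.of_forall fun x => ?_)
      simp; ring)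
    (by simpa using i1) (by simpa using i2)
    (fun x _ => hasLineDerivAt_gaussDensity x v) (fun x _ => hd x)
  simp only [ContinuousLinearMap.mul_apply'] at key
  rw [key, ← integral_neg]
  congr 1; ext x; ring

end StdGaussian

/-! ### Gaussian comparison by rotation. -/

section Comparison

variable {E : Type*} [NormedAddCommGroup E] [InnerProductSpace ℝ E] [FiniteDimensional ℝ E]
  [MeasurableSpace E] [BorelSpace E] {R I : Type*} [Fintype R] [Fintype I]

/-- The exponential sum `∑ u, exp (∑ j, ψ j ⟪p j u, z⟫)`. -/
noncomputable def expSum (ψ : R → ℝ → ℝ) (p : R → I → E) (z : E) : ℝ :=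
  ∑ u, Real.exp (∑ j, ψ j ⟪p j u, z⟫)

lemma expSum_nonneg (ψ : R → ℝ → ℝ) (p : R → I → E) (z : E) : 0 ≤ expSum ψ p z :=
  Finset.sum_nonneg fun _ _ => (Real.exp_pos _).le

lemma exp_le_expSum (ψ : R → ℝ → ℝ) (p : R → I → E) (z : E) (u : I) :
    Real.exp (∑ j, ψ j ⟪p j u, z⟫) ≤ expSum ψ p z :=
  Finset.single_le_sum (f := fun u => Real.exp (∑ j, ψ j ⟪p j u, z⟫))
    (fun _ _ => (Real.exp_pos _).le) (Finset.mem_univ u)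

lemma continuous_expSum {ψ : R → ℝ → ℝ} (hψ : ∀ j, Continuous (ψ j)) (p : R → I → E) :
    Continuous (expSum ψ p) := by
  unfold expSum
  fun_prop

variable {ψ ψ' : R → ℝ → ℝ} {K t : ℝ}

/-- The integrand of the derivative after integration by parts. -/
lemma hasLineDerivAt_weight [DecidableEq R] (ht : 0 < t)
    (hψ : ∀ j x, HasDerivAt (ψ j) (ψ' j x) x) {p : R → I → E} {v : E} (j : R) (u : I)
    (s : I → ℝ) (hs : ∀ k w, ⟪p k w, v⟫ = if k = j then s w else 0) (hsu : s u = 0) (z : E) :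
    HasLineDerivAt ℝ
      (fun z => Real.exp (∑ k, ψ k ⟪p k u, z⟫) * ((t + expSum ψ p z) ^ 2)⁻¹ * ψ' j ⟪p j u, z⟫)
      (-2 * (Real.exp (∑ k, ψ k ⟪p k u, z⟫) * ((t + expSum ψ p z) ^ 3)⁻¹ *
        ψ' j ⟪p j u, z⟫ * ∑ w, Real.exp (∑ k, ψ k ⟪p k w, z⟫) * (ψ' j ⟪p j w, z⟫ * s w))) z v := by
  have hin : ∀ k w, HasDerivAt (fun τ : ℝ => ⟪p k w, z + τ • v⟫) ⟪p k w, v⟫ 0 := by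
    intro k w
    have : (fun τ : ℝ => ⟪p k w, z + τ • v⟫) = fun τ => ⟪p k w, z⟫ + τ * ⟪p k w, v⟫ := by
      ext τ; rw [inner_add_right, inner_smul_right]
    rw [this]
    simpa using ((hasDerivAt_id (0 : ℝ)).mul_const ⟪p k w, v⟫).const_add ⟪p k w, z⟫
  have hW : ∀ w, HasDerivAt (fun τ : ℝ => Real.exp (∑ k, ψ k ⟪p k w, z + τ • v⟫))
      (Real.exp (∑ k, ψ k ⟪p k w, z⟫) * (ψ' j ⟪p j w, z⟫ * s w)) 0 := by
    intro w
    have h1 : HasDerivAt (fun τ : ℝ => ∑ k, ψ k ⟪p k w, z + τ • v⟫)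
        (∑ k, ψ' k ⟪p k w, z⟫ * ⟪p k w, v⟫) 0 := by
      refine HasDerivAt.fun_sum fun k _ => ?_
      have := (hψ k (⟪p k w, z + (0 : ℝ) • v⟫)).comp (0 : ℝ) (hin k w)
      simpa [Function.comp_def] using this
    have h2 := h1.exp
    simp only [hs] at h2
    simpa using h2
  have hS : HasDerivAt (fun τ : ℝ => expSum ψ p (z + τ • v))
      (∑ w, Real.exp (∑ k, ψ k ⟪p k w, z⟫) * (ψ' j ⟪p j w, z⟫ * s w)) 0 :=
    HasDerivAt.fun_sum fun w _ => hW w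
  -- As `s u = 0`, the argument of `ψ' j` does not move along `v`, so no second derivative of `ψ` is
  -- ever needed.
  have hconst : ∀ τ : ℝ, ψ' j ⟪p j u, z + τ • v⟫ = ψ' j ⟪p j u, z⟫ := by
    intro τ
    rw [inner_add_right, inner_smul_right, hs]
    simp [hsu]
  unfold HasLineDerivAt
  simp_rw [hconst]
  have hpos : 0 < t + expSum ψ p z := by have := expSum_nonneg ψ p z; linarith
  have hinv := ((hS.const_add t).pow 2).inv (by simpa using hpos.ne')
  have hfin := ((hW u).mul hinv).mul_const (ψ' j ⟪p j u, z⟫)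
  refine hfin.congr_deriv ?_
  simp only [zero_smul, add_zero, hsu, Pi.inv_apply, Pi.pow_apply]
  field_simp
  push_cast
  ring

lemma exp_mul_inv_le (ht : 0 < t) (p : R → I → E) (z : E) (u : I) :
    Real.exp (∑ k, ψ k ⟪p k u, z⟫) * ((t + expSum ψ p z) ^ 2)⁻¹ ≤ t⁻¹ := by
  have h1 := exp_le_expSum ψ p z u
  have h0 := expSum_nonneg ψ p z
  have he := Real.exp_pos (∑ k, ψ k ⟪p k u, z⟫)
  rw [← div_eq_mul_inv, div_le_iff₀ (by positivity), ← div_eq_inv_mul, le_div_iff₀ ht]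
  nlinarith

/-- The derivative of the interpolated functional is nonpositive when the covariances of the
rows are ordered suitably. -/
lemma integral_interp_deriv_nonpos [DecidableEq R] (ht : 0 < t)
    (hψ : ∀ j x, HasDerivAt (ψ j) (ψ' j x) x) (hψc : ∀ j, Continuous (ψ' j))
    (hψb : ∀ j x, |ψ' j x| ≤ K) {p q : R → I → E} (s : R → I → I → ℝ)
    (hs : ∀ j u k w, ⟪p k w, q j u⟫ = if k = j then s j u w else 0) (hsu : ∀ j u, s j u u = 0)
    (hneg : ∀ u w (x y : R → ℝ), ∑ j, s j u w * (ψ' j (x j) * ψ' j (y j)) ≤ 0) :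
    ∫ z, -((t + expSum ψ p z) ^ 2)⁻¹ * ∑ u, Real.exp (∑ k, ψ k ⟪p k u, z⟫) *
      (∑ j, ψ' j ⟪p j u, z⟫ * ⟪q j u, z⟫) ∂(stdGaussian E) ≤ 0 := by
  have hψ0 : ∀ j, Continuous (ψ j) := fun j =>
    continuous_iff_continuousAt.2 fun x => (hψ j x).continuousAt
  have hSc := continuous_expSum hψ0 p
  have hpos : ∀ z, 0 < t + expSum ψ p z := fun z => by
    have := expSum_nonneg ψ p z; linarith
  set G : R → I → E → ℝ := fun j u z =>
    Real.exp (∑ k, ψ k ⟪p k u, z⟫) * ((t + expSum ψ p z) ^ 2)⁻¹ * ψ' j ⟪p j u, z⟫ with hG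
  set G' : R → I → E → ℝ := fun j u z =>
    -2 * (Real.exp (∑ k, ψ k ⟪p k u, z⟫) * ((t + expSum ψ p z) ^ 3)⁻¹ *
        ψ' j ⟪p j u, z⟫ * ∑ w, Real.exp (∑ k, ψ k ⟪p k w, z⟫) * (ψ' j ⟪p j w, z⟫ * s j u w))
    with hG'
  have hGc : ∀ j u, Continuous (G j u) := by
    intro j u
    simp only [hG]
    have : Continuous fun z => ((t + expSum ψ p z) ^ 2)⁻¹ :=
      (by fun_prop : Continuous fun z => (t + expSum ψ p z) ^ 2).inv₀
        fun z => pow_ne_zero _ (hpos z).ne'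
    fun_prop
  have hGc' : ∀ j u, Continuous (G' j u) := by
    intro j u
    simp only [hG']
    have : Continuous fun z => ((t + expSum ψ p z) ^ 3)⁻¹ :=
      (by fun_prop : Continuous fun z => (t + expSum ψ p z) ^ 3).inv₀
        fun z => pow_ne_zero _ (hpos z).ne'
    fun_prop
  have hK : ∀ j : R, 0 ≤ K := fun j => (abs_nonneg _).trans (hψb j 0)
  have hGb : ∀ j u z, |G j u z| ≤ t⁻¹ * K := by
    intro j u z
    simp only [hG]
    rw [abs_mul, abs_of_nonneg (by have := hpos z; positivity)]
    exact mul_le_mul (exp_mul_inv_le ht p z u) (hψb j _) (abs_nonneg _) (by positivity)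
  have hGb' : ∀ j u z, |G' j u z| ≤ 2 * (t⁻¹ * K * ∑ w, K * |s j u w|) := by
    intro j u z
    have hp := hpos z
    -- One of the three inverse powers is given to the weight of `w`, making it at most 1; the other
    -- two absorb the weight of `u`.
    have e1 : G' j u z = -2 * (Real.exp (∑ k, ψ k ⟪p k u, z⟫) * ((t + expSum ψ p z) ^ 2)⁻¹ *
        ψ' j ⟪p j u, z⟫ * ∑ w, (Real.exp (∑ k, ψ k ⟪p k w, z⟫) * (t + expSum ψ p z)⁻¹) *
          (ψ' j ⟪p j w, z⟫ * s j u w)) := by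
      simp only [hG', Finset.mul_sum]
      refine Finset.sum_congr rfl fun w _ => ?_
      field_simp
    rw [e1, abs_mul, abs_neg, abs_two]
    refine mul_le_mul_of_nonneg_left ?_ zero_le_two
    rw [abs_mul]
    refine mul_le_mul (hGb j u z) ?_ (abs_nonneg _) (mul_nonneg (inv_nonneg.2 ht.le) (hK j))
    refine (Finset.abs_sum_le_sum_abs _ _).trans (Finset.sum_le_sum fun w _ => ?_)
    rw [abs_mul, abs_mul (ψ' j _)]
    have h1 : |Real.exp (∑ k, ψ k ⟪p k w, z⟫) * (t + expSum ψ p z)⁻¹| ≤ 1 := by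
      rw [abs_of_nonneg (by positivity), ← div_eq_mul_inv, div_le_one hp]
      have := exp_le_expSum ψ p z w
      linarith
    calc _ ≤ 1 * (K * |s j u w|) :=
          mul_le_mul h1 (mul_le_mul_of_nonneg_right (hψb j _) (abs_nonneg _)) (by positivity)
            zero_le_one
      _ = _ := one_mul _
  -- Integration by parts along `q j u`. Since `s j u u = 0`, the derivative falls only on the
  -- resolvent factor, producing the second derivative of 1/(t + S), which has a fixed sign.
  have hibp : ∀ j u, ∫ z, ⟪q j u, z⟫ * G j u z ∂(stdGaussian E) = ∫ z, G' j u z ∂(stdGaussian E) :=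
    fun j u => integral_inner_mul_stdGaussian
      (C := max (t⁻¹ * K) (2 * (t⁻¹ * K * ∑ w, K * |s j u w|)))
      (hGc j u) (hGc' j u)
      (fun z => (hGb j u z).trans (le_max_left _ _)) (fun z => (hGb' j u z).trans (le_max_right _ _))
      (fun z => hasLineDerivAt_weight ht hψ j u (s j u) (fun k w => hs j u k w) (hsu j u) z)
  have i1 : ∀ j u, Integrable (fun z => ⟪q j u, z⟫ * G j u z) (stdGaussian E) := by
    intro j u
    refine Integrable.mono' ((integrable_norm_stdGaussian (E := E)).const_mul
      (‖q j u‖ * (t⁻¹ * K))) ?_ (.of_forall fun z => ?_)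
    · have := hGc j u
      fun_prop
    rw [Real.norm_eq_abs, abs_mul]
    calc |⟪q j u, z⟫| * |G j u z| ≤ (‖q j u‖ * ‖z‖) * (t⁻¹ * K) :=
          mul_le_mul (abs_real_inner_le_norm _ z) (hGb j u z) (abs_nonneg _) (by positivity)
      _ = _ := by ring
  have i2 : ∀ j u, Integrable (fun z => G' j u z) (stdGaussian E) := fun j u =>
    Integrable.of_bound (hGc' j u).aestronglyMeasurable _ (.of_forall (hGb' j u))
  have e : ∀ z, -((t + expSum ψ p z) ^ 2)⁻¹ * ∑ u, Real.exp (∑ k, ψ k ⟪p k u, z⟫) *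
      (∑ j, ψ' j ⟪p j u, z⟫ * ⟪q j u, z⟫) = -∑ u, ∑ j, ⟪q j u, z⟫ * G j u z := by
    intro z
    rw [neg_mul, Finset.mul_sum]
    congr 1
    refine Finset.sum_congr rfl fun u _ => ?_
    rw [Finset.mul_sum, Finset.mul_sum]
    refine Finset.sum_congr rfl fun j _ => ?_
    simp only [hG]; ring
  simp_rw [e]
  rw [integral_neg, integral_finsetSum _ (fun u _ => integrable_finsetSum _ fun j _ => i1 j u)]
  simp_rw [integral_finsetSum _ (fun j (_ : j ∈ Finset.univ) => i1 j _), hibp]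
  simp_rw [← integral_finsetSum _ (fun j (_ : j ∈ Finset.univ) => i2 j _)]
  rw [← integral_finsetSum _ (fun u _ => integrable_finsetSum _ fun j _ => i2 j u), neg_nonpos]
  refine integral_nonneg fun z => ?_
  -- Grouped by pairs (u, w), a nonpositive weight multiplies exactly the form controlled by `hneg`.
  have e2 : ∑ u, ∑ j, G' j u z = ∑ u, ∑ w, (-2 * (Real.exp (∑ k, ψ k ⟪p k u, z⟫) *
      Real.exp (∑ k, ψ k ⟪p k w, z⟫) * ((t + expSum ψ p z) ^ 3)⁻¹)) *
        ∑ j, s j u w * (ψ' j ⟪p j u, z⟫ * ψ' j ⟪p j w, z⟫) := by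
    refine Finset.sum_congr rfl fun u _ => ?_
    simp only [hG', Finset.mul_sum]
    rw [Finset.sum_comm]
    refine Finset.sum_congr rfl fun w _ => Finset.sum_congr rfl fun j _ => ?_
    ring
  show 0 ≤ ∑ u, ∑ j, G' j u z
  rw [e2]
  refine Finset.sum_nonneg fun u _ => Finset.sum_nonneg fun w _ => ?_
  refine mul_nonneg_of_nonpos_of_nonpos ?_ (hneg u w _ _)
  have := hpos z
  have : 0 < (t + expSum ψ p z) ^ 3 := by positivity
  have : 0 ≤ Real.exp (∑ k, ψ k ⟪p k u, z⟫) *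
      Real.exp (∑ k, ψ k ⟪p k w, z⟫) * ((t + expSum ψ p z) ^ 3)⁻¹ := by positivity
  linarith

/-- A Gaussian comparison inequality: interpolating along a rotation, the resolvent of the
exponential sum decreases. -/
theorem integral_inv_add_expSum_le [DecidableEq R] (ht : 0 < t)
    (hψ : ∀ j x, HasDerivAt (ψ j) (ψ' j x) x) (hψc : ∀ j, Continuous (ψ' j))
    (hψb : ∀ j x, |ψ' j x| ≤ K) {a b : R → I → E}
    (haa : ∀ j k u w, j ≠ k → ⟪a j u, a k w⟫ = 0) (hbb : ∀ j k u w, j ≠ k → ⟪b j u, b k w⟫ = 0)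
    (hab : ∀ j k u w, ⟪a j u, b k w⟫ = 0) (hnorm : ∀ j u, ‖a j u‖ = ‖b j u‖)
    (hneg : ∀ u w (x y : R → ℝ),
      ∑ j, (⟪b j u, b j w⟫ - ⟪a j u, a j w⟫) * (ψ' j (x j) * ψ' j (y j)) ≤ 0) :
    ∫ z, (t + expSum ψ b z)⁻¹ ∂(stdGaussian E) ≤ ∫ z, (t + expSum ψ a z)⁻¹ ∂(stdGaussian E) := by
  have hψ0 : ∀ j, Continuous (ψ j) := fun j =>
    continuous_iff_continuousAt.2 fun x => (hψ j x).continuousAt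
  -- A quarter turn from `a` to `b`, with `q` its velocity. The inner product of `p θ j w` with `q θ
  -- j u` is sin θ cos θ times the difference of the covariances of `b` and `a`; equal norms make it
  -- vanish for w = u.
  set p : ℝ → R → I → E := fun θ j u => Real.cos θ • a j u + Real.sin θ • b j u with hp
  set q : ℝ → R → I → E := fun θ j u => -Real.sin θ • a j u + Real.cos θ • b j u with hq
  set F' : ℝ → E → ℝ := fun θ z => -((t + expSum ψ (p θ) z) ^ 2)⁻¹ *
    ∑ u, Real.exp (∑ k, ψ k ⟪p θ k u, z⟫) * (∑ j, ψ' j ⟪p θ j u, z⟫ * ⟪q θ j u, z⟫) with hF'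
  have hpos : ∀ θ z, 0 < t + expSum ψ (p θ) z := fun θ z => by
    have := expSum_nonneg ψ (p θ) z; linarith
  have hcont : ∀ θ, Continuous fun z => (t + expSum ψ (p θ) z)⁻¹ := fun θ =>
    ((continuous_expSum hψ0 (p θ)).const_add t).inv₀ fun z => (hpos θ z).ne'
  have hd : ∀ θ z, HasDerivAt (fun θ => (t + expSum ψ (p θ) z)⁻¹) (F' θ z) θ := by
    intro θ z
    have hin : ∀ k w, HasDerivAt (fun θ => ⟪p θ k w, z⟫) ⟪q θ k w, z⟫ θ := by
      intro k w
      have h : HasDerivAt (fun θ => p θ k w) (q θ k w) θ :=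
        ((Real.hasDerivAt_cos θ).smul_const _).add ((Real.hasDerivAt_sin θ).smul_const _)
      simpa using h.inner ℝ (hasDerivAt_const θ z)
    have hS : HasDerivAt (fun θ => expSum ψ (p θ) z)
        (∑ u, Real.exp (∑ k, ψ k ⟪p θ k u, z⟫) * (∑ j, ψ' j ⟪p θ j u, z⟫ * ⟪q θ j u, z⟫)) θ := by
      refine HasDerivAt.fun_sum fun u _ => ?_
      refine HasDerivAt.exp (HasDerivAt.fun_sum fun k _ => ?_)
      exact (hψ k _).comp θ (hin k u)
    refine ((hS.const_add t).inv (hpos θ z).ne').congr_deriv ?_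
    simp only [hF']
    ring
  have hF'c : ∀ θ, Continuous (F' θ) := by
    intro θ
    simp only [hF']
    have : Continuous fun z => ((t + expSum ψ (p θ) z) ^ 2)⁻¹ :=
      (((continuous_expSum hψ0 (p θ)).const_add t).pow 2).inv₀
        fun z => pow_ne_zero _ (hpos θ z).ne'
    fun_prop
  set C : ℝ := ∑ u, ∑ j, t⁻¹ * (|K| * (‖a j u‖ + ‖b j u‖)) with hC
  have hbound : ∀ θ z, ‖F' θ z‖ ≤ C * ‖z‖ := by
    intro θ z
    simp only [hF', hC]
    rw [neg_mul, norm_neg, Finset.mul_sum, Finset.sum_mul]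
    refine (norm_sum_le _ _).trans (Finset.sum_le_sum fun u _ => ?_)
    rw [← mul_assoc, Finset.mul_sum, Finset.sum_mul]
    refine (norm_sum_le _ _).trans (Finset.sum_le_sum fun j _ => ?_)
    rw [norm_mul, mul_assoc]
    have h1 : ‖((t + expSum ψ (p θ) z) ^ 2)⁻¹ * Real.exp (∑ k, ψ k ⟪p θ k u, z⟫)‖ ≤ t⁻¹ := by
      rw [Real.norm_of_nonneg (by have := hpos θ z; positivity), mul_comm]
      exact exp_mul_inv_le ht _ z u
    refine mul_le_mul h1 ?_ (norm_nonneg _) (by positivity)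
    rw [norm_mul, mul_assoc]
    refine mul_le_mul ((hψb j _).trans (le_abs_self K)) ?_ (norm_nonneg _) (abs_nonneg _)
    refine (norm_inner_le_norm _ _).trans (mul_le_mul_of_nonneg_right ?_ (norm_nonneg _))
    refine (norm_add_le _ _).trans (add_le_add ?_ ?_)
    · rw [norm_smul, norm_neg]
      exact mul_le_of_le_one_left (norm_nonneg _) (Real.abs_sin_le_one θ)
    · rw [norm_smul]
      exact mul_le_of_le_one_left (norm_nonneg _) (Real.abs_cos_le_one θ)
  have hH : ∀ θ, HasDerivAt (fun θ => ∫ z, (t + expSum ψ (p θ) z)⁻¹ ∂(stdGaussian E))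
      (∫ z, F' θ z ∂(stdGaussian E)) θ := by
    intro θ
    refine (hasDerivAt_integral_of_dominated_loc_of_deriv_le (s := Set.univ)
      (bound := fun z => C * ‖z‖) Filter.univ_mem
      (.of_forall fun θ => (hcont θ).aestronglyMeasurable) ?_ (hF'c θ).aestronglyMeasurable
      (.of_forall fun z θ _ => hbound θ z)
      (integrable_norm_stdGaussian.const_mul C) (.of_forall fun z θ _ => hd θ z)).2
    refine Integrable.of_bound (hcont θ).aestronglyMeasurable t⁻¹ (.of_forall fun z => ?_)
    rw [Real.norm_of_nonneg (inv_nonneg.2 (hpos θ z).le)]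
    exact inv_anti₀ ht (by have := expSum_nonneg ψ (p θ) z; linarith)
  have hanti : AntitoneOn (fun θ => ∫ z, (t + expSum ψ (p θ) z)⁻¹ ∂(stdGaussian E))
      (Set.Icc 0 (Real.pi / 2)) := by
    refine antitoneOn_of_deriv_nonpos (convex_Icc _ _)
      (fun θ _ => (hH θ).continuousAt.continuousWithinAt)
      (fun θ _ => (hH θ).differentiableAt.differentiableWithinAt) ?_
    intro θ hθ
    rw [interior_Icc] at hθ
    rw [(hH θ).deriv]
    have hsc : 0 ≤ Real.sin θ * Real.cos θ :=
      mul_nonneg (Real.sin_nonneg_of_nonneg_of_le_pi hθ.1.le (by linarith [hθ.2, Real.pi_pos]))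
        (Real.cos_nonneg_of_neg_pi_div_two_le_of_le (by linarith [hθ.1, Real.pi_pos]) hθ.2.le)
    refine integral_interp_deriv_nonpos ht hψ hψc hψb
      (s := fun j u w => Real.sin θ * Real.cos θ * (⟪b j u, b j w⟫ - ⟪a j u, a j w⟫)) ?_ ?_ ?_
    · intro j u k w
      have hba : ∀ j k u w, ⟪b j u, a k w⟫ = 0 := fun j k u w => by
        rw [real_inner_comm]; exact hab k j w u
      simp only [hp, hq, inner_add_left, inner_add_right, real_inner_smul_left,
        real_inner_smul_right, hab, hba]
      split_ifs with h
      · subst h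
        rw [real_inner_comm (a k u), real_inner_comm (b k u)]
        ring
      · rw [haa k j w u h, hbb k j w u h]
        ring
    · intro j u
      rw [real_inner_self_eq_norm_sq, real_inner_self_eq_norm_sq, hnorm]
      ring
    · intro u w x y
      have := hneg u w x y
      simp_rw [mul_assoc (Real.sin θ * Real.cos θ)]
      rw [← Finset.mul_sum]
      exact mul_nonpos_of_nonneg_of_nonpos hsc this
  have h0 : p 0 = a := by ext j u; simp [hp]
  have h1 : p (Real.pi / 2) = b := by ext j u; simp [hp]
  have := hanti (Set.left_mem_Icc.2 (by positivity)) (Set.right_mem_Icc.2 (by positivity))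
    (by positivity : (0 : ℝ) ≤ Real.pi / 2)
  simpa only [h0, h1] using this

end Comparison

/-! ### From resolvents to fractional moments. -/

section Resolvent

variable {Ω : Type*} [MeasurableSpace Ω] {P : Measure Ω} [IsProbabilityMeasure P]

lemma lintegral_rpowIntegrand {S : Ω → ℝ} (hS : Measurable S) (hS0 : ∀ ω, 0 ≤ S ω) {p t : ℝ}
    (ht : 0 < t) :
    ∫⁻ ω, ENNReal.ofReal (Real.rpowIntegrand₀₁ p t (S ω)) ∂P
      = ENNReal.ofReal (t ^ p * (t⁻¹ - ∫ ω, (t + S ω)⁻¹ ∂P)) := by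
  have hi : Integrable (fun ω => (t + S ω)⁻¹) P := by
    refine Integrable.of_bound (by fun_prop) t⁻¹ (.of_forall fun ω => ?_)
    have := hS0 ω
    rw [Real.norm_of_nonneg (by positivity)]
    exact inv_anti₀ ht (by linarith)
  rw [← ofReal_integral_eq_lintegral_ofReal]
  · simp only [Real.rpowIntegrand₀₁]
    rw [integral_const_mul, integral_sub (integrable_const _) hi]
    simp
  · simp only [Real.rpowIntegrand₀₁]
    exact ((integrable_const _).sub hi).const_mul _
  · refine .of_forall fun ω => ?_
    have := hS0 ω
    simp only [Real.rpowIntegrand₀₁, Pi.zero_apply]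
    have : (t + S ω)⁻¹ ≤ t⁻¹ := inv_anti₀ ht (by linarith)
    have := Real.rpow_nonneg ht.le p
    nlinarith

/-- Ordered resolvents give ordered moments of order `p < 1`. -/
lemma lintegral_rpow_le_of_resolvent_le {S T : Ω → ℝ} (hS : Measurable S) (hT : Measurable T)
    (hS0 : ∀ ω, 0 ≤ S ω) (hT0 : ∀ ω, 0 ≤ T ω) {p : ℝ} (hp : p ∈ Set.Ioo 0 1)
    (h : ∀ t : ℝ, 0 < t → ∫ ω, (t + T ω)⁻¹ ∂P ≤ ∫ ω, (t + S ω)⁻¹ ∂P) :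
    ∫⁻ ω, ENNReal.ofReal (S ω ^ p) ∂P ≤ ∫⁻ ω, ENNReal.ofReal (T ω ^ p) ∂P := by
  set K : ℝ := ∫ t in Set.Ioi 0, Real.rpowIntegrand₀₁ p t 1 with hK
  have hKpos : 0 < K := Real.integral_rpowIntegrand₀₁_one_pos hp
  -- For 0 < p < 1, x^p is up to a constant the integral of t^p(1/t - 1/(t + x)) over t > 0. The
  -- resolvent enters with a minus sign, which reverses the order.
  have rep : ∀ x : ℝ, 0 ≤ x → ENNReal.ofReal (x ^ p) * ENNReal.ofReal K
      = ∫⁻ t in Set.Ioi 0, ENNReal.ofReal (Real.rpowIntegrand₀₁ p t x) := by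
    intro x hx
    rw [← ENNReal.ofReal_mul (Real.rpow_nonneg hx p),
      ← Real.integral_rpowIntegrand₀₁_eq_rpow_mul_const hp hx,
      ofReal_integral_eq_lintegral_ofReal (Real.integrableOn_rpowIntegrand₀₁_Ioi hp hx)]
    refine (ae_restrict_iff' measurableSet_Ioi).2 (.of_forall fun t ht => ?_)
    exact Real.rpowIntegrand₀₁_nonneg hp.1 (le_of_lt ht) hx
  have swap : ∀ X : Ω → ℝ, Measurable X → (∀ ω, 0 ≤ X ω) →
      (∫⁻ ω, ENNReal.ofReal (X ω ^ p) ∂P) * ENNReal.ofReal K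
        = ∫⁻ t in Set.Ioi 0, ENNReal.ofReal (t ^ p * (t⁻¹ - ∫ ω, (t + X ω)⁻¹ ∂P)) := by
    intro X hX hX0
    rw [← lintegral_mul_const _ (by fun_prop)]
    simp_rw [rep _ (hX0 _)]
    rw [lintegral_lintegral_swap]
    · refine setLIntegral_congr_fun measurableSet_Ioi fun t ht => ?_
      exact lintegral_rpowIntegrand hX hX0 ht
    · simp only [Real.rpowIntegrand₀₁]
      fun_prop
  have hfin : ENNReal.ofReal K ≠ 0 := by simpa using hKpos
  rw [← ENNReal.mul_le_mul_iff_left hfin ENNReal.ofReal_ne_top, swap S hS hS0, swap T hT hT0]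
  refine setLIntegral_mono' measurableSet_Ioi fun t ht => ENNReal.ofReal_le_ofReal ?_
  refine mul_le_mul_of_nonneg_left ?_ (Real.rpow_nonneg (le_of_lt ht) p)
  linarith [h t ht]

end Resolvent

/-! ### Exponential moments of |g| and of the norm of a Gaussian vector. -/

section PiGaussian

variable {V : Type*} [NormedAddCommGroup V] [InnerProductSpace ℝ V] [FiniteDimensional ℝ V]
  [MeasurableSpace V] [BorelSpace V]

lemma map_pi_stdGaussian {J : Type*} [Fintype J] :
    (Measure.pi (fun _ : J => stdGaussian V)).map (WithLp.toLp 2)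
      = stdGaussian (PiLp 2 (fun _ : J => V)) := by
  apply Measure.ext_of_charFun
  ext t
  rw [charFun_pi, charFun_stdGaussian]
  simp_rw [charFun_stdGaussian, ← Complex.exp_sum]
  congr 1
  rw [← Complex.ofReal_pow, PiLp.norm_sq_eq_of_L2]
  push_cast
  rw [← Finset.sum_div, Finset.sum_neg_distrib]

lemma map_inner_stdGaussian {u : V} (hu : ‖u‖ = 1) :
    (stdGaussian V).map (fun x => ⟪u, x⟫) = gaussianReal 0 1 := by
  have h := IsGaussian.map_eq_gaussianReal (μ := stdGaussian V) (innerSL ℝ u)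
  rw [variance_dual_stdGaussian, integral_strongDual_stdGaussian, innerSL_apply_norm, hu] at h
  simpa using h

lemma lintegral_exp_mul_gaussianReal (s : ℝ) :
    ∫⁻ x, ENNReal.ofReal (Real.exp (s * x)) ∂(gaussianReal 0 1)
      = ENNReal.ofReal (Real.exp (s ^ 2 / 2)) := by
  rw [← ofReal_integral_eq_lintegral_ofReal (integrable_exp_mul_gaussianReal s)
    (.of_forall fun x => (Real.exp_pos _).le)]
  have := congrFun (mgf_fun_id_gaussianReal (μ := 0) (v := 1)) s
  simp only [mgf, NNReal.coe_one] at this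
  rw [this]
  congr 2; ring

lemma integral_abs_gaussianReal : ∫ x, |x| ∂(gaussianReal 0 1) = √(2 / Real.pi) := by
  rw [integral_gaussianReal_eq_integral_smul (by simp)]
  have h1 : ∀ x : ℝ, gaussianPDFReal 0 1 x • |x|
      = (fun y : ℝ => (√(2 * Real.pi))⁻¹ * (y ^ (1 : ℝ) * Real.exp (-(1 / 2) * y ^ (2 : ℝ)))) |x| := by
    intro x
    simp only [gaussianPDFReal, smul_eq_mul, Real.rpow_one, NNReal.coe_one]
    rw [show |x| ^ (2 : ℝ) = x ^ 2 by rw [Real.rpow_two, sq_abs]]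
    rw [show -(x - 0) ^ 2 / (2 * 1) = -(1 / 2) * x ^ 2 by ring]
    ring_nf
  simp_rw [h1]
  rw [integral_comp_abs (f := fun y : ℝ =>
    (√(2 * Real.pi))⁻¹ * (y ^ (1 : ℝ) * Real.exp (-(1 / 2) * y ^ (2 : ℝ)))), integral_const_mul,
    integral_rpow_mul_exp_neg_mul_rpow (by norm_num) (by norm_num) (by norm_num)]
  rw [show ((1 : ℝ) + 1) / 2 = 1 by norm_num, Real.Gamma_one,
    show -((1 : ℝ) + 1) / 2 = -1 by norm_num, Real.rpow_neg_one]
  rw [Real.sqrt_mul zero_le_two, Real.sqrt_div zero_le_two]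
  have : √2 * √2 = 2 := Real.mul_self_sqrt zero_le_two
  have : √Real.pi ≠ 0 := by positivity
  field_simp
  linarith

lemma integrable_abs_gaussianReal : Integrable (fun x : ℝ => |x|) (gaussianReal 0 1) :=
  ((memLp_id_gaussianReal (μ := 0) (v := 1) 1).integrable (by norm_num)).abs

lemma integrable_sq_gaussianReal : Integrable (fun x : ℝ => x ^ 2) (gaussianReal 0 1) :=
  (memLp_id_gaussianReal (μ := 0) (v := 1) 2).integrable_sq

lemma integral_sq_gaussianReal : ∫ x, x ^ 2 ∂(gaussianReal 0 1) = 1 := by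
  have h := variance_id_gaussianReal (μ := 0) (v := 1)
  rw [variance_eq_integral (by fun_prop)] at h
  simpa using h

/-- Integrate e^{-y} ≤ 1 - y + y²/2 for y ≥ 0, using E|g| = √(2/π) and E g² = 1, then apply 1 + y ≤
e^y. -/
lemma lintegral_exp_neg_abs_gaussianReal {s : ℝ} (hs : 0 ≤ s) :
    ∫⁻ x, ENNReal.ofReal (Real.exp (-(s * |x|))) ∂(gaussianReal 0 1)
      ≤ ENNReal.ofReal (Real.exp (-(s * √(2 / Real.pi)) + s ^ 2 / 2)) := by
  have hexp : ∀ y : ℝ, 0 ≤ y → Real.exp (-y) ≤ 1 - y + y ^ 2 / 2 := by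
    intro y hy
    -- Works because (1 + y + y²/2)(1 - y + y²/2) = 1 + y⁴/4.
    have h1 := Real.quadratic_le_exp_of_nonneg hy
    have h0 : 0 < 1 + y + y ^ 2 / 2 := by positivity
    rw [Real.exp_neg, inv_le_comm₀ (Real.exp_pos y) (by nlinarith [sq_nonneg (y - 1)])]
    refine le_trans ?_ h1
    rw [inv_le_iff_one_le_mul₀ (by nlinarith [sq_nonneg (y - 1)])]
    nlinarith [sq_nonneg (y ^ 2)]
  have i1 := integrable_abs_gaussianReal
  have i2 := integrable_sq_gaussianReal
  calc ∫⁻ x, ENNReal.ofReal (Real.exp (-(s * |x|))) ∂(gaussianReal 0 1)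
      ≤ ∫⁻ x, ENNReal.ofReal (1 - s * |x| + s ^ 2 / 2 * x ^ 2) ∂(gaussianReal 0 1) := by
        refine lintegral_mono fun x => ENNReal.ofReal_le_ofReal ?_
        refine (hexp _ (by positivity)).trans (le_of_eq ?_)
        rw [mul_pow, sq_abs]; ring
    _ = ENNReal.ofReal (1 - s * √(2 / Real.pi) + s ^ 2 / 2) := by
        rw [← ofReal_integral_eq_lintegral_ofReal]
        · rw [integral_add, integral_sub, integral_const_mul, integral_const_mul,
            integral_abs_gaussianReal, integral_sq_gaussianReal]
          · simp
          · exact integrable_const _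
          · exact i1.const_mul s
          · exact (integrable_const _).sub (i1.const_mul s)
          · exact i2.const_mul _
        · exact ((integrable_const _).sub (i1.const_mul s)).add (i2.const_mul _)
        · refine .of_forall fun x => ?_
          simp only [Pi.zero_apply]
          have : s ^ 2 / 2 * x ^ 2 = (s * |x|) ^ 2 / 2 := by rw [mul_pow, sq_abs]; ring
          rw [this]
          nlinarith [sq_nonneg (s * |x| - 1)]
    _ ≤ _ := by
        refine ENNReal.ofReal_le_ofReal ?_
        have := Real.add_one_le_exp (-(s * √(2 / Real.pi)) + s ^ 2 / 2)
        linarith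

/-- The half line has mass at most 1/2 and the density on [-s, 0) is at most 1/√(2π). The factor 2
is the one that arises from folding |g|. -/
lemma gaussianReal_Ici_neg_le {s : ℝ} (hs : 0 ≤ s) :
    2 * gaussianReal 0 1 (Set.Ici (-s)) ≤ ENNReal.ofReal (1 + s * √(2 / Real.pi)) := by
  have hhalf : 2 * gaussianReal 0 1 (Set.Ici 0) ≤ 1 := by
    have hn : gaussianReal 0 1 (Set.Ici (0 : ℝ)) = gaussianReal 0 1 (Set.Iic 0) := by
      have h := gaussianReal_map_neg (μ := 0) (v := 1)
      rw [neg_zero] at h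
      conv_lhs => rw [← h]
      rw [Measure.map_apply (by fun_prop) measurableSet_Ici]
      congr 1
      ext x; simp
    have hne : (1 : NNReal) ≠ 0 := one_ne_zero
    have := nullSingletonClass_gaussianReal (μ := 0) hne
    have hio : gaussianReal 0 1 (Set.Ici (0 : ℝ)) = gaussianReal 0 1 (Set.Ioi 0) :=
      measure_congr Ioi_ae_eq_Ici.symm
    rw [two_mul]
    conv_lhs => rw [hio]
    conv_lhs => 
      arg 2
      rw [← hio, hn]
    rw [← measure_union (by
      rw [Set.disjoint_iff]; rintro x ⟨h1, h2⟩
      simp only [Set.mem_Ioi, Set.mem_Iic] at h1 h2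
      exact absurd h1 (not_lt.2 h2)) measurableSet_Iic]
    exact prob_le_one
  have hmid : gaussianReal 0 1 (Set.Ico (-s) 0) ≤ ENNReal.ofReal (s * (√(2 * Real.pi))⁻¹) := by
    rw [gaussianReal_apply 0 one_ne_zero]
    calc ∫⁻ x in Set.Ico (-s) 0, gaussianPDF 0 1 x
        ≤ ∫⁻ x in Set.Ico (-s) 0, ENNReal.ofReal ((√(2 * Real.pi))⁻¹) := by
          refine lintegral_mono fun x => ENNReal.ofReal_le_ofReal ?_
          simp only [gaussianPDFReal, NNReal.coe_one, mul_one]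
          refine mul_le_of_le_one_right (by positivity) (Real.exp_le_one_iff.2 ?_)
          nlinarith [sq_nonneg (x - 0)]
      _ = _ := by
          rw [setLIntegral_const, Real.volume_Ico, zero_sub, neg_neg, mul_comm,
            ENNReal.ofReal_mul hs]
  have hsub : Set.Ici (-s) ⊆ Set.Ico (-s) 0 ∪ Set.Ici 0 := by
    intro x hx
    rcases lt_or_ge x 0 with h | h
    · exact Or.inl ⟨hx, h⟩
    · exact Or.inr h
  calc 2 * gaussianReal 0 1 (Set.Ici (-s))
      ≤ 2 * (gaussianReal 0 1 (Set.Ico (-s) 0) + gaussianReal 0 1 (Set.Ici 0)) := by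
        gcongr
        exact (measure_mono hsub).trans (measure_union_le _ _)
    _ ≤ 2 * ENNReal.ofReal (s * (√(2 * Real.pi))⁻¹) + 1 := by
        rw [mul_add]
        gcongr
    _ = _ := by
        rw [show (2 : ℝ≥0∞) = ENNReal.ofReal 2 by simp, ← ENNReal.ofReal_mul zero_le_two,
          ← ENNReal.ofReal_one, ← ENNReal.ofReal_add (by positivity) zero_le_one]
        congr 1
        rw [Real.sqrt_mul zero_le_two, Real.sqrt_div zero_le_two]
        have : √2 * √2 = 2 := Real.mul_self_sqrt zero_le_two
        have : √Real.pi ≠ 0 := by positivity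
        field_simp
        nlinarith

/-- By symmetry and completing the square, E e^{s|g|} = 2e^{s²/2} P(g ≥ -s). This keeps the variance
term s²/2 sharp, as in the case of the opposite sign. -/
lemma lintegral_exp_abs_gaussianReal {s : ℝ} (hs : 0 ≤ s) :
    ∫⁻ x, ENNReal.ofReal (Real.exp (s * |x|)) ∂(gaussianReal 0 1)
      ≤ ENNReal.ofReal (Real.exp (s * √(2 / Real.pi) + s ^ 2 / 2)) := by
  have hpos : ∫⁻ x in Set.Ici 0, ENNReal.ofReal (Real.exp (s * x)) ∂(gaussianReal 0 1)
      = ENNReal.ofReal (Real.exp (s ^ 2 / 2)) * gaussianReal 0 1 (Set.Ici (-s)) := by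
    have hshift : gaussianReal 0 1 (Set.Ici (-s)) = gaussianReal s 1 (Set.Ici 0) := by
      have h := gaussianReal_map_add_const (μ := 0) (v := 1) s
      rw [zero_add] at h
      rw [← h, Measure.map_apply (by fun_prop) measurableSet_Ici]
      congr 1
      ext x
      simp only [Set.mem_Ici, Set.mem_preimage]
      constructor <;> intro h <;> linarith
    rw [hshift, gaussianReal_apply s one_ne_zero, gaussianReal_of_var_ne_zero 0 one_ne_zero,
      restrict_withDensity measurableSet_Ici,
      lintegral_withDensity_eq_lintegral_mul _ (measurable_gaussianPDF 0 1) (by fun_prop),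
      ← lintegral_const_mul _ (measurable_gaussianPDF s 1)]
    refine lintegral_congr fun x => ?_
    simp only [Pi.mul_apply, gaussianPDF]
    rw [← ENNReal.ofReal_mul (gaussianPDFReal_nonneg _ _ _), ← ENNReal.ofReal_mul (by positivity)]
    congr 1
    simp only [gaussianPDFReal, NNReal.coe_one, mul_one]
    rw [mul_assoc, ← Real.exp_add, mul_left_comm, ← Real.exp_add]
    congr 2
    ring
  have hneg : ∫⁻ x in Set.Iic 0, ENNReal.ofReal (Real.exp (-(s * x))) ∂(gaussianReal 0 1)
      = ∫⁻ x in Set.Ici 0, ENNReal.ofReal (Real.exp (s * x)) ∂(gaussianReal 0 1) := by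
    have h := gaussianReal_map_neg (μ := 0) (v := 1)
    rw [neg_zero] at h
    conv_rhs => rw [← h]
    rw [setLIntegral_map measurableSet_Ici (by fun_prop) (by fun_prop)]
    have : (fun x : ℝ => -x) ⁻¹' (Set.Ici 0) = Set.Iic 0 := by ext x; simp
    rw [this]
    simp
  calc ∫⁻ x, ENNReal.ofReal (Real.exp (s * |x|)) ∂(gaussianReal 0 1)
      ≤ ∫⁻ x in Set.Iic 0, ENNReal.ofReal (Real.exp (s * |x|)) ∂(gaussianReal 0 1) +
        ∫⁻ x in Set.Ici 0, ENNReal.ofReal (Real.exp (s * |x|)) ∂(gaussianReal 0 1) := by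
        rw [← setLIntegral_univ, ← Set.Iic_union_Ici (a := (0 : ℝ))]
        exact lintegral_union_le _ _ _
    _ = 2 * gaussianReal 0 1 (Set.Ici (-s)) * ENNReal.ofReal (Real.exp (s ^ 2 / 2)) := by
        rw [setLIntegral_congr_fun (g := fun x => ENNReal.ofReal (Real.exp (-(s * x))))
            measurableSet_Iic (fun x hx => by
              simp only [Set.mem_Iic] at hx
              rw [abs_of_nonpos hx, mul_neg]),
          setLIntegral_congr_fun (g := fun x => ENNReal.ofReal (Real.exp (s * x)))
            measurableSet_Ici (fun x hx => by
              simp only [Set.mem_Ici] at hx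
              rw [abs_of_nonneg hx]), hneg, hpos]
        ring
    _ ≤ ENNReal.ofReal (1 + s * √(2 / Real.pi)) * ENNReal.ofReal (Real.exp (s ^ 2 / 2)) := by
        gcongr
        exact gaussianReal_Ici_neg_le hs
    _ ≤ _ := by
        rw [← ENNReal.ofReal_mul (by positivity), Real.exp_add]
        refine ENNReal.ofReal_le_ofReal (mul_le_mul_of_nonneg_right ?_ (Real.exp_pos _).le)
        linarith [Real.add_one_le_exp (s * √(2 / Real.pi))]

/-- The moment generating function of the norm of a standard Gaussian vector. -/
lemma lintegral_exp_norm_stdGaussian {s : ℝ} (hs : 0 ≤ s) (hd : 0 < Module.finrank ℝ V) :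
    ∫⁻ x, ENNReal.ofReal (Real.exp (s * ‖x‖)) ∂(stdGaussian V)
      ≤ ENNReal.ofReal (Real.exp (s * √(Module.finrank ℝ V) + s ^ 2 / 2)) := by
  set d : ℝ := (Module.finrank ℝ V : ℝ) with hdd
  have hd0 : 0 < d := Nat.cast_pos.2 hd
  have hq : 0 < √d := Real.sqrt_pos.2 hd0
  have hqq : √d * √d = d := Real.mul_self_sqrt hd0.le
  -- The linear term s‖x‖ is replaced by a quadratic tangent to it at ‖x‖ = √d + s; `b` is the
  -- coefficient of -‖x‖² that remains, so the integral becomes exactly Gaussian.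
  set b : ℝ := √d / (2 * (√d + s)) with hb
  have hb0 : 0 < b := by positivity
  have hpt : ∀ x : V, s * ‖x‖ - ‖x‖ ^ 2 / 2 ≤ s * (√d + s) / 2 + -b * ‖x‖ ^ 2 := by
    intro x
    have h2 : s * (√d + s) / 2 + -b * ‖x‖ ^ 2 - (s * ‖x‖ - ‖x‖ ^ 2 / 2)
        = s * (√d + s - ‖x‖) ^ 2 / (2 * (√d + s)) := by
      rw [hb]; field_simp; ring
    have h3 : 0 ≤ s * (√d + s - ‖x‖) ^ 2 / (2 * (√d + s)) := by positivity
    linarith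
  rw [stdGaussian_eq_withDensity, lintegral_withDensity_eq_lintegral_mul _
    (by have := continuous_gaussDensity (E := V); fun_prop) (by fun_prop)]
  set c : ℝ := (2 * Real.pi) ^ (-d / 2) with hc
  have hc0 : 0 < c := by positivity
  calc _ ≤ ∫⁻ x : V, ENNReal.ofReal (c * Real.exp (s * (√d + s) / 2) * Real.exp (-b * ‖x‖ ^ 2)) := by
        refine lintegral_mono fun x => ?_
        simp only [Pi.mul_apply]
        rw [← ENNReal.ofReal_mul (gaussDensity_pos x).le]
        refine ENNReal.ofReal_le_ofReal ?_
        rw [gaussDensity, mul_assoc, ← Real.exp_add, mul_assoc, ← Real.exp_add]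
        refine mul_le_mul_of_nonneg_left (Real.exp_le_exp.2 ?_) hc0.le
        linarith [hpt x]
    _ = ENNReal.ofReal (c * Real.exp (s * (√d + s) / 2) * (Real.pi / b) ^ (d / 2)) := by
        rw [← ofReal_integral_eq_lintegral_ofReal
          ((integrable_exp_neg_mul_sq_norm hb0).const_mul _)
          (.of_forall fun x => by positivity), integral_const_mul,
          GaussianFourier.integral_rexp_neg_mul_sq_norm hb0]
    _ ≤ _ := by
        refine ENNReal.ofReal_le_ofReal ?_
        have e1 : c * (Real.pi / b) ^ (d / 2) = (1 + s / √d) ^ (d / 2) := by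
          have : Real.pi / b = (2 * Real.pi) * (1 + s / √d) := by
            rw [hb]; field_simp
          rw [this, Real.mul_rpow (by positivity) (by positivity), ← mul_assoc, hc,
            ← Real.rpow_add (by positivity), neg_div, neg_add_cancel, Real.rpow_zero, one_mul]
        have e2 : (1 + s / √d) ^ (d / 2) ≤ Real.exp (s * √d / 2) := by
          calc (1 + s / √d) ^ (d / 2) ≤ (Real.exp (s / √d)) ^ (d / 2) := by
                refine Real.rpow_le_rpow (by positivity) ?_ (by positivity)
                linarith [Real.add_one_le_exp (s / √d)]
            _ = _ := by
                rw [← Real.exp_mul]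
                congr 1
                field_simp
                nlinarith
        calc c * Real.exp (s * (√d + s) / 2) * (Real.pi / b) ^ (d / 2)
            = Real.exp (s * (√d + s) / 2) * (c * (Real.pi / b) ^ (d / 2)) := by ring
          _ ≤ Real.exp (s * (√d + s) / 2) * Real.exp (s * √d / 2) := by
              rw [e1]; exact mul_le_mul_of_nonneg_left e2 (Real.exp_pos _).le
          _ = _ := by rw [← Real.exp_add]; congr 1; ring

end PiGaussian

/-! ### Exponential moments of suprema over finite families of unit vectors. -/

lemma lintegral_pi_prod {J : Type*} [Fintype J] {X : J → Type*} [∀ j, MeasurableSpace (X j)]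
    (μ : ∀ j, Measure (X j)) [∀ j, IsProbabilityMeasure (μ j)] {f : ∀ j, X j → ℝ≥0∞}
    (hf : ∀ j, Measurable (f j)) :
    ∫⁻ z, ∏ j, f j (z j) ∂(Measure.pi μ) = ∏ j, ∫⁻ x, f j x ∂(μ j) := by
  have h := lintegral_prod_eq_prod_lintegral_of_indepFun Finset.univ
    (fun j (z : ∀ j, X j) => f j (z j))
    (iIndepFun_pi (μ := μ) (X := f) fun j => (hf j).aemeasurable)
    (fun j => (hf j).comp (measurable_pi_apply j))
  rw [h]
  refine Finset.prod_congr rfl fun j _ => ?_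
  rw [← (measurePreserving_eval μ j).lintegral_comp (hf j)]

section

variable {V : Type*} [NormedAddCommGroup V] [InnerProductSpace ℝ V] [FiniteDimensional ℝ V]
  [MeasurableSpace V] [BorelSpace V]

lemma measurePreserving_pi_inl {A B : Type*} [Fintype A] [Fintype B] (μ : Measure V)
    [IsProbabilityMeasure μ] :
    MeasurePreserving (fun (z : A ⊕ B → V) (j : A) => z (Sum.inl j))
      (Measure.pi fun _ => μ) (Measure.pi fun _ => μ) :=
  measurePreserving_fst.comp (measurePreserving_sumPiEquivProdPi fun _ : A ⊕ B => μ)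

lemma measurePreserving_pi_inr {A B : Type*} [Fintype A] [Fintype B] (μ : Measure V)
    [IsProbabilityMeasure μ] :
    MeasurePreserving (fun (z : A ⊕ B → V) (j : B) => z (Sum.inr j))
      (Measure.pi fun _ => μ) (Measure.pi fun _ => μ) :=
  measurePreserving_snd.comp (measurePreserving_sumPiEquivProdPi fun _ : A ⊕ B => μ)

lemma inner_piLp_single {J : Type*} [Fintype J] [DecidableEq J] (j : J) (x : V)
    (z : PiLp 2 (fun _ : J => V)) : ⟪(PiLp.single 2 j x : PiLp 2 (fun _ : J => V)), z⟫ = ⟪x, z j⟫ := by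
  rw [PiLp.inner_apply, Finset.sum_eq_single j]
  · simp
  · intro k _ hk
    rw [PiLp.single_eq_of_ne 2 hk]
    simp
  · simp

lemma lintegral_stdGaussian_piLp {J : Type*} [Fintype J] (F : (J → V) → ℝ≥0∞) (hF : Measurable F) :
    ∫⁻ z, F (WithLp.ofLp z) ∂(stdGaussian (PiLp 2 (fun _ : J => V)))
      = ∫⁻ z, F z ∂(Measure.pi fun _ : J => stdGaussian V) := by
  rw [← map_pi_stdGaussian, lintegral_map]
  · exact hF.comp (WithLp.measurable_ofLp 2 _)
  · exact WithLp.measurable_toLp 2 _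

variable {N I : Type*} [Fintype N] [DecidableEq N] [Fintype I]

/-- Gaussian comparison for the maximum of `∑ i, ψ ⟪u a, z i⟫` over unit vectors `u a`,
with `ψ` smooth and `1`-Lipschitz. -/
lemma lintegral_iSup_exp_le_smooth {ψ ψ' : ℝ → ℝ} (hψ : ∀ x, HasDerivAt ψ (ψ' x) x)
    (hψc : Continuous ψ') (hψb : ∀ x, |ψ' x| ≤ 1) {u : I → V} (hu : ∀ a, ‖u a‖ = 1)
    (hI : Nonempty I) {l ν : ℝ} (hl : 0 ≤ l) (hν : ν ∈ Set.Ioo (0 : ℝ) 1) :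
    ∫⁻ z, ⨆ a, ENNReal.ofReal (Real.exp (l * ∑ i, ψ ⟪u a, z i⟫))
        ∂(Measure.pi fun _ : N => stdGaussian V)
      ≤ ENNReal.ofReal ((Fintype.card I : ℝ) ^ ν) *
        (∫⁻ x, ENNReal.ofReal (Real.exp (l * ψ x)) ∂(gaussianReal 0 1)) ^ Fintype.card N *
        ENNReal.ofReal (Real.exp (l * √(Fintype.card N) * √(Module.finrank ℝ V))) := by
  obtain ⟨a₀⟩ := hI
  set v₀ : V := u a₀ with hv₀
  have hv : ‖v₀‖ = 1 := hu a₀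
  have hd : 0 < Module.finrank ℝ V := by
    have : Nontrivial V := ⟨⟨v₀, 0, by intro h; rw [h, norm_zero] at hv; exact zero_ne_one hv⟩⟩
    exact Module.finrank_pos
  set n : ℝ := (Fintype.card N : ℝ) with hn
  have hψ0 : Continuous ψ := continuous_iff_continuousAt.2 fun x => (hψ x).continuousAt
  -- With this scale the ν-th power of a single summand is exp(l · ), so the ν-th moment of the sum
  -- captures the supremum up to the factor |I|^ν.
  set c : ℝ := l / ν with hc
  have hcν : c * ν = l := div_mul_cancel₀ l hν.1.ne'
  have hc0 : 0 ≤ c := div_nonneg hl hν.1.le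
  set f : N ⊕ Unit → ℝ → ℝ := Sum.elim (fun _ x => c * ψ x) (fun _ x => c * √n * x) with hf
  set f' : N ⊕ Unit → ℝ → ℝ := Sum.elim (fun _ x => c * ψ' x) (fun _ _ => c * √n) with hf'
  -- The extra row `Unit` carries the linear function. In `α` it is constant and the other rows vary
  -- with the index; in `β` the roles are exchanged. The doubled index set of `E` makes the two
  -- families independent.
  set α : N ⊕ Unit → I → V := Sum.elim (fun _ => u) (fun _ _ => v₀) with hα
  set β : N ⊕ Unit → I → V := Sum.elim (fun _ _ => v₀) (fun _ => u) with hβ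
  let E := PiLp 2 (fun _ : (N ⊕ Unit) ⊕ (N ⊕ Unit) => V)
  let a : N ⊕ Unit → I → E := fun j w => PiLp.single 2 (Sum.inl j) (α j w)
  let b : N ⊕ Unit → I → E := fun j w => PiLp.single 2 (Sum.inr j) (β j w)
  have hfd : ∀ j x, HasDerivAt (f j) (f' j x) x := by
    rintro (i | i) x
    · exact (hψ x).const_mul c
    · simpa [hf, hf'] using (hasDerivAt_id x).const_mul (c * √n)
  have hfc' : ∀ j, Continuous (f' j) := by
    rintro (i | i)
    · exact hψc.const_mul c
    · exact continuous_const
  have hfc : ∀ j, Continuous (f j) := by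
    rintro (i | i)
    · exact hψ0.const_mul c
    · exact continuous_const.mul continuous_id
  have hfb : ∀ j x, |f' j x| ≤ c + c * √n := by
    rintro (i | i) x
    · simp only [hf', Sum.elim_inl, abs_mul, abs_of_nonneg hc0]
      nlinarith [hψb x, Real.sqrt_nonneg n, mul_nonneg hc0 (Real.sqrt_nonneg n)]
    · simp only [hf', Sum.elim_inr]
      rw [abs_of_nonneg (by positivity)]
      linarith
  have ha : ∀ j w z, ⟪a j w, z⟫ = ⟪α j w, z (Sum.inl j)⟫ := fun j w z => inner_piLp_single _ _ _
  have hb : ∀ j w z, ⟪b j w, z⟫ = ⟪β j w, z (Sum.inr j)⟫ := fun j w z => inner_piLp_single _ _ _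
  have hcomp : ∀ t : ℝ, 0 < t → ∫ z, (t + expSum f b z)⁻¹ ∂(stdGaussian E)
      ≤ ∫ z, (t + expSum f a z)⁻¹ ∂(stdGaussian E) := by
    intro t ht
    refine integral_inv_add_expSum_le ht hfd hfc' hfb ?_ ?_ ?_ ?_ ?_
    · intro j k w w' hjk
      rw [ha]
      simp only [a]
      rw [PiLp.single_eq_of_ne 2 (by simpa using hjk), inner_zero_right]
    · intro j k w w' hjk
      rw [hb]
      simp only [b]
      rw [PiLp.single_eq_of_ne 2 (by simpa using hjk), inner_zero_right]
    · intro j k w w'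
      rw [ha]
      simp only [b]
      rw [PiLp.single_eq_of_ne 2 (by simp), inner_zero_right]
    · intro j w
      simp only [a, b]
      rw [PiLp.norm_single, PiLp.norm_single]
      rcases j with i | i <;> simp [hα, hβ, hu, hv]
    · intro w w' x y
      have e : ∀ j, ⟪b j w, b j w'⟫ - ⟪a j w, a j w'⟫ = ⟪β j w, β j w'⟫ - ⟪α j w, α j w'⟫ := by
        intro j
        rw [ha, hb]
        simp only [a, b]
        rw [PiLp.single_eq_same, PiLp.single_eq_same]
      simp_rw [e]
      rw [Fintype.sum_sum_type]
      simp only [hα, hβ, hf', Sum.elim_inl, Sum.elim_inr, Finset.univ_unique, Finset.sum_singleton]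
      rw [real_inner_self_eq_norm_sq, hv]
      have hρ : ⟪u w, u w'⟫ ≤ 1 := by
        have := real_inner_le_norm (u w) (u w')
        rwa [hu, hu, one_mul] at this
      -- The Lipschitz constant 1 enters here, and this sum is why the linear row has weight √n: its
      -- contribution must outweigh n products of derivatives.
      have hsum : ∑ i : N, ψ' (x (Sum.inl i)) * ψ' (y (Sum.inl i)) ≤ n := by
        calc ∑ i : N, ψ' (x (Sum.inl i)) * ψ' (y (Sum.inl i)) ≤ ∑ i : N, (1 : ℝ) := by
              refine Finset.sum_le_sum fun i _ => (le_abs_self _).trans ?_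
              rw [abs_mul]
              exact mul_le_one₀ (hψb _) (abs_nonneg _) (hψb _)
          _ = n := by simp [hn]
      have e3 : ∑ i : N, ((1 : ℝ) ^ 2 - ⟪u w, u w'⟫) * (c * ψ' (x (Sum.inl i)) * (c * ψ' (y (Sum.inl i))))
          = (1 - ⟪u w, u w'⟫) * c ^ 2 * ∑ i : N, ψ' (x (Sum.inl i)) * ψ' (y (Sum.inl i)) := by
        rw [Finset.mul_sum]
        exact Finset.sum_congr rfl fun i _ => by ring
      rw [e3]
      have hsq : √n * √n = n := Real.mul_self_sqrt (Nat.cast_nonneg _)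
      have e4 : (⟪u w, u w'⟫ - (1 : ℝ) ^ 2) * (c * √n * (c * √n))
          = -((1 - ⟪u w, u w'⟫) * c ^ 2 * n) := by
        linear_combination (⟪u w, u w'⟫ - 1) * c ^ 2 * hsq
      rw [e4]
      have : 0 ≤ (1 - ⟪u w, u w'⟫) * c ^ 2 := mul_nonneg (by linarith) (sq_nonneg c)
      nlinarith
  have hmom := lintegral_rpow_le_of_resolvent_le (P := stdGaussian E)
    (continuous_expSum hfc a).measurable (continuous_expSum hfc b).measurable
    (expSum_nonneg f a) (expSum_nonneg f b) hν hcomp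
  set γ : Measure (N → V) := Measure.pi fun _ : N => stdGaussian V with hγ
  set γ' : Measure (Unit → V) := Measure.pi fun _ : Unit => stdGaussian V with hγ'
  set A : (N → V) → ℝ≥0∞ := fun z => ⨆ a, ENNReal.ofReal (Real.exp (l * ∑ i, ψ ⟪u a, z i⟫)) with hA
  have hAm : Measurable A := by
    refine Measurable.iSup fun a => ?_
    fun_prop
  have hunit : ∀ F : V → ℝ≥0∞, Measurable F → ∫⁻ z, F (z ()) ∂γ' = ∫⁻ x, F x ∂(stdGaussian V) :=
    fun F hF => (measurePreserving_eval (fun _ : Unit => stdGaussian V) ()).lintegral_comp hF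
  have hsplit : ∀ (F : (N → V) → ℝ≥0∞) (G : V → ℝ≥0∞), Measurable F → Measurable G →
      ∫⁻ z, F (fun i => z (Sum.inl i)) * G (z (Sum.inr ()))
        ∂(Measure.pi fun _ : N ⊕ Unit => stdGaussian V)
      = (∫⁻ z, F z ∂γ) * ∫⁻ x, G x ∂(stdGaussian V) := by
    intro F G hF hG
    have h := (measurePreserving_sumPiEquivProdPi fun _ : N ⊕ Unit => stdGaussian V).lintegral_comp
      (f := fun z : (N → V) × (Unit → V) => F z.1 * G (z.2 ())) (by fun_prop)
    refine Eq.trans h ?_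
    rw [lintegral_prod_mul (g := fun z : Unit → V => G (z ())) hF.aemeasurable
      (hG.comp (measurable_pi_apply ())).aemeasurable]
    congr 1
    exact hunit G hG
  have hgauss : ∀ (s : ℝ), ∫⁻ x, ENNReal.ofReal (Real.exp (s * ⟪v₀, x⟫)) ∂(stdGaussian V)
      = ENNReal.ofReal (Real.exp (s ^ 2 / 2)) := by
    intro s
    rw [← lintegral_exp_mul_gaussianReal, ← map_inner_stdGaussian hv, lintegral_map]
    · fun_prop
    · fun_prop
  -- The independent row integrates to exp((l√n)²/2). The same factor appears in `hupp` from the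
  -- norm of the Gaussian vector, and the two cancel, so the linear row leaves only its mean term
  -- l√n√d.
  have hlow : (∫⁻ z, A z ∂γ) * ENNReal.ofReal (Real.exp ((l * √n) ^ 2 / 2))
      ≤ ∫⁻ z, ENNReal.ofReal (expSum f a z ^ ν) ∂(stdGaussian E) := by
    rw [← hgauss, ← hsplit A _ hAm (by fun_prop)]
    have h1 := (measurePreserving_pi_inl (A := N ⊕ Unit) (B := N ⊕ Unit) (stdGaussian V)).lintegral_comp
      (f := fun z : N ⊕ Unit → V => A (fun i => z (Sum.inl i)) *
        ENNReal.ofReal (Real.exp (l * √n * ⟪v₀, z (Sum.inr ())⟫))) (by fun_prop)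
    rw [← h1, ← lintegral_stdGaussian_piLp
      (fun z : (N ⊕ Unit) ⊕ (N ⊕ Unit) → V => A (fun i => z (Sum.inl (Sum.inl i))) *
        ENNReal.ofReal (Real.exp (l * √n * ⟪v₀, z (Sum.inl (Sum.inr ()))⟫))) (by fun_prop)]
    refine lintegral_mono fun z => ?_
    simp only [hA]
    rw [ENNReal.iSup_mul]
    refine iSup_le fun w => ?_
    rw [← ENNReal.ofReal_mul (Real.exp_pos _).le, ← Real.exp_add]
    refine ENNReal.ofReal_le_ofReal ?_
    have h2 := Real.rpow_le_rpow (Real.exp_pos _).le (exp_le_expSum f a z w) hν.1.le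
    refine le_trans (le_of_eq ?_) h2
    rw [← Real.exp_mul, Fintype.sum_sum_type]
    simp only [ha, hf, hα, Sum.elim_inl, Sum.elim_inr, Finset.univ_unique, Finset.sum_singleton]
    rw [← Finset.mul_sum, ← hcν]
    congr 1
    simp only [PUnit.default_eq_unit]
    ring
  have hupp : ∫⁻ z, ENNReal.ofReal (expSum f b z ^ ν) ∂(stdGaussian E)
      ≤ ENNReal.ofReal ((Fintype.card I : ℝ) ^ ν) *
        ((∫⁻ x, ENNReal.ofReal (Real.exp (l * ψ x)) ∂(gaussianReal 0 1)) ^ Fintype.card N *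
        ENNReal.ofReal (Real.exp (l * √n * √(Module.finrank ℝ V) + (l * √n) ^ 2 / 2))) := by
    set B : (N → V) → ℝ≥0∞ := fun z => ∏ i, ENNReal.ofReal (Real.exp (l * ψ ⟪v₀, z i⟫)) with hB
    have hBm : Measurable B := by fun_prop
    have hBint : ∫⁻ z, B z ∂γ
        = (∫⁻ x, ENNReal.ofReal (Real.exp (l * ψ x)) ∂(gaussianReal 0 1)) ^ Fintype.card N := by
      rw [hB, hγ, lintegral_pi_prod (fun _ : N => stdGaussian V)
        (f := fun _ x => ENNReal.ofReal (Real.exp (l * ψ ⟪v₀, x⟫))) (fun _ => by fun_prop),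
        Finset.prod_const, Finset.card_univ, ← map_inner_stdGaussian hv, lintegral_map]
      · fun_prop
      · fun_prop
    calc ∫⁻ z, ENNReal.ofReal (expSum f b z ^ ν) ∂(stdGaussian E)
        ≤ ∫⁻ z : E, ENNReal.ofReal ((Fintype.card I : ℝ) ^ ν) *
          (B (fun i => z (Sum.inr (Sum.inl i))) *
            ENNReal.ofReal (Real.exp (l * √n * ‖z (Sum.inr (Sum.inr ()))‖)))
            ∂(stdGaussian E) := by
          refine lintegral_mono fun z => ?_
          simp only [hB]
          rw [← ENNReal.ofReal_prod_of_nonneg (fun _ _ => (Real.exp_pos _).le), ← Real.exp_sum,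
            ← ENNReal.ofReal_mul (Real.exp_pos _).le, ← Real.exp_add,
            ← ENNReal.ofReal_mul (by positivity)]
          refine ENNReal.ofReal_le_ofReal ?_
          -- Only ⟨u,g⟩ depends on the index here, and it is at most ‖g‖ for every unit vector.
          have h1 : expSum f b z ≤ Fintype.card I * Real.exp
              (c * (∑ i, ψ ⟪v₀, z (Sum.inr (Sum.inl i))⟫ + √n * ‖z (Sum.inr (Sum.inr ()))‖)) := by
            unfold expSum
            rw [← nsmul_eq_mul, ← Finset.card_univ, ← Finset.sum_const]
            refine Finset.sum_le_sum fun w _ => Real.exp_le_exp.2 ?_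
            rw [Fintype.sum_sum_type]
            simp only [hb, hf, hβ, Sum.elim_inl, Sum.elim_inr, Finset.univ_unique,
              Finset.sum_singleton, PUnit.default_eq_unit]
            rw [← Finset.mul_sum, mul_add, ← mul_assoc]
            have := real_inner_le_norm (u w) (z (Sum.inr (Sum.inr ())))
            rw [hu, one_mul] at this
            have h0 : 0 ≤ c * √n := by positivity
            nlinarith
          refine (Real.rpow_le_rpow (expSum_nonneg f b z) h1 hν.1.le).trans (le_of_eq ?_)
          rw [Real.mul_rpow (Nat.cast_nonneg _) (Real.exp_pos _).le, ← Real.exp_mul, mul_comm c,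
            mul_assoc, hcν, ← Finset.mul_sum]
          congr 2
          ring
      _ = ENNReal.ofReal ((Fintype.card I : ℝ) ^ ν) * ((∫⁻ z, B z ∂γ) *
            ∫⁻ x, ENNReal.ofReal (Real.exp (l * √n * ‖x‖)) ∂(stdGaussian V)) := by
          rw [lintegral_stdGaussian_piLp (fun z : (N ⊕ Unit) ⊕ (N ⊕ Unit) → V =>
            ENNReal.ofReal ((Fintype.card I : ℝ) ^ ν) *
            (B (fun i => z (Sum.inr (Sum.inl i))) *
              ENNReal.ofReal (Real.exp (l * √n * ‖z (Sum.inr (Sum.inr ()))‖)))) (by fun_prop),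
            lintegral_const_mul _ (by fun_prop), ← hsplit B _ hBm (by fun_prop)]
          congr 1
          exact (measurePreserving_pi_inr (A := N ⊕ Unit) (B := N ⊕ Unit)
            (stdGaussian V)).lintegral_comp
            (f := fun z : N ⊕ Unit → V => B (fun i => z (Sum.inl i)) *
              ENNReal.ofReal (Real.exp (l * √n * ‖z (Sum.inr ())‖))) (by fun_prop)
      _ ≤ _ := by
          rw [hBint]
          gcongr
          exact lintegral_exp_norm_stdGaussian (by positivity) hd
  have hfin := hlow.trans (hmom.trans hupp)
  rw [Real.exp_add, ENNReal.ofReal_mul (Real.exp_pos _).le, ← mul_assoc, ← mul_assoc] at hfin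
  exact (ENNReal.mul_le_mul_iff_left (by simpa using Real.exp_pos _) ENNReal.ofReal_ne_top).1 hfin

end

/-! ### Removing the smoothing and the cardinality. -/

section

variable {V : Type*} [NormedAddCommGroup V] [InnerProductSpace ℝ V] [FiniteDimensional ℝ V]
  [MeasurableSpace V] [BorelSpace V]
variable {N I : Type*} [Fintype N] [DecidableEq N] [Fintype I]

lemma hasDerivAt_sqrt_sq_add {ε : ℝ} (hε : 0 < ε) (x : ℝ) :
    HasDerivAt (fun x => √(x ^ 2 + ε ^ 2)) (x / √(x ^ 2 + ε ^ 2)) x := by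
  have h1 : HasDerivAt (fun x : ℝ => x ^ 2 + ε ^ 2) (2 * x) x := by
    simpa using (hasDerivAt_pow 2 x).add_const (ε ^ 2)
  refine (h1.sqrt (by positivity)).congr_deriv ?_
  field_simp

lemma abs_le_sqrt_sq_add (x ε : ℝ) : |x| ≤ √(x ^ 2 + ε ^ 2) :=
  Real.abs_le_sqrt (by nlinarith [sq_nonneg ε])

lemma sqrt_sq_add_le {ε : ℝ} (hε : 0 < ε) (x : ℝ) : √(x ^ 2 + ε ^ 2) ≤ |x| + ε := by
  rw [Real.sqrt_le_left (by positivity)]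
  nlinarith [sq_abs x, abs_nonneg x]

/-- Gaussian comparison for the maximum over unit vectors of `s * ∑ i, |⟪u a, z i⟫|`, `s = ±1`. -/
lemma lintegral_iSup_exp_abs_le {s : ℝ} (hs : s = 1 ∨ s = -1) {u : I → V} (hu : ∀ a, ‖u a‖ = 1)
    (hI : Nonempty I) {l : ℝ} (hl : 0 ≤ l) :
    ∫⁻ z, ⨆ a, ENNReal.ofReal (Real.exp (l * (s * ∑ i, |⟪u a, z i⟫|)))
        ∂(Measure.pi fun _ : N => stdGaussian V)
      ≤ ENNReal.ofReal (Real.exp (l * (Fintype.card N * (s * √(2 / Real.pi)) +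
          √(Fintype.card N) * √(Module.finrank ℝ V)) + Fintype.card N * (l ^ 2 / 2))) := by
  set n := Fintype.card N with hn
  set q := √(2 / Real.pi) with hq
  have hs1 : |s| = 1 := by rcases hs with h | h <;> simp [h]
  have hgauss : ∫⁻ x, ENNReal.ofReal (Real.exp (l * (s * |x|))) ∂(gaussianReal 0 1)
      ≤ ENNReal.ofReal (Real.exp (l * (s * q) + l ^ 2 / 2)) := by
    rcases hs with h | h
    · subst h
      simpa only [one_mul] using lintegral_exp_abs_gaussianReal hl
    · subst h
      simpa only [neg_mul, one_mul, mul_neg] using lintegral_exp_neg_abs_gaussianReal hl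
  -- The same ν is the order of the moment and the width of the smoothing √(x² + ν²), so a single
  -- limit ν → 0 removes both errors and the factor |I|^ν.
  set g : ℝ → ℝ := fun ν => Real.exp (l * (n * ν)) * ((Fintype.card I : ℝ) ^ ν *
    Real.exp (l * (s * q) + l ^ 2 / 2 + l * ν) ^ n * Real.exp (l * √n * √(Module.finrank ℝ V)))
    with hg
  have hbound : ∀ ν ∈ Set.Ioo (0 : ℝ) 1,
      ∫⁻ z, ⨆ a, ENNReal.ofReal (Real.exp (l * (s * ∑ i, |⟪u a, z i⟫|)))
        ∂(Measure.pi fun _ : N => stdGaussian V) ≤ ENNReal.ofReal (g ν) := by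
    intro ν hν
    have hψ : ∀ x, HasDerivAt (fun x => s * √(x ^ 2 + ν ^ 2)) (s * (x / √(x ^ 2 + ν ^ 2))) x :=
      fun x => (hasDerivAt_sqrt_sq_add hν.1 x).const_mul s
    have hpos : ∀ x : ℝ, 0 < √(x ^ 2 + ν ^ 2) := fun x =>
      Real.sqrt_pos.2 (by have := hν.1; positivity)
    have hψc : Continuous fun x : ℝ => s * (x / √(x ^ 2 + ν ^ 2)) := by
      refine continuous_const.mul (continuous_id.div (by fun_prop) fun x => (hpos x).ne')
    have hψb : ∀ x : ℝ, |s * (x / √(x ^ 2 + ν ^ 2))| ≤ 1 := by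
      intro x
      rw [abs_mul, hs1, one_mul, abs_div, abs_of_pos (hpos x), div_le_one (hpos x)]
      exact abs_le_sqrt_sq_add x ν
    have happrox1 : ∀ x : ℝ, s * |x| ≤ s * √(x ^ 2 + ν ^ 2) + ν := by
      intro x
      have h1 := abs_le_sqrt_sq_add x ν
      have h2 := sqrt_sq_add_le hν.1 x
      have h3 := hν.1
      rcases hs with h | h <;> rw [h] <;> linarith
    have happrox2 : ∀ x : ℝ, s * √(x ^ 2 + ν ^ 2) ≤ s * |x| + ν := by
      intro x
      have h1 := abs_le_sqrt_sq_add x ν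
      have h2 := sqrt_sq_add_le hν.1 x
      have h3 := hν.1
      rcases hs with h | h <;> rw [h] <;> linarith
    have hmain := lintegral_iSup_exp_le_smooth (N := N) hψ hψc hψb hu hI hl hν
    have h1 : ∫⁻ x, ENNReal.ofReal (Real.exp (l * (s * √(x ^ 2 + ν ^ 2)))) ∂(gaussianReal 0 1)
        ≤ ENNReal.ofReal (Real.exp (l * (s * q) + l ^ 2 / 2 + l * ν)) := by
      rw [Real.exp_add _ (l * ν), mul_comm (Real.exp _), ENNReal.ofReal_mul (Real.exp_pos _).le]
      refine le_trans ?_ (mul_le_mul_right hgauss _)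
      rw [← lintegral_const_mul _ (by fun_prop)]
      refine lintegral_mono fun x => ?_
      rw [← ENNReal.ofReal_mul (Real.exp_pos _).le, ← Real.exp_add]
      refine ENNReal.ofReal_le_ofReal (Real.exp_le_exp.2 ?_)
      have := mul_le_mul_of_nonneg_left (happrox2 x) hl
      linarith
    calc _ ≤ ∫⁻ z, ENNReal.ofReal (Real.exp (l * (n * ν))) *
          ⨆ a, ENNReal.ofReal (Real.exp (l * ∑ i, s * √(⟪u a, z i⟫ ^ 2 + ν ^ 2)))
          ∂(Measure.pi fun _ : N => stdGaussian V) := by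
          refine lintegral_mono fun z => ?_
          rw [ENNReal.mul_iSup]
          refine iSup_mono fun a => ?_
          rw [← ENNReal.ofReal_mul (Real.exp_pos _).le, ← Real.exp_add]
          refine ENNReal.ofReal_le_ofReal (Real.exp_le_exp.2 ?_)
          rw [← mul_add]
          refine mul_le_mul_of_nonneg_left ?_ hl
          rw [Finset.mul_sum, hn, ← nsmul_eq_mul, ← Finset.card_univ, ← Finset.sum_const,
            ← Finset.sum_add_distrib]
          refine Finset.sum_le_sum fun i _ => ?_
          linarith [happrox1 ⟪u a, z i⟫]
      _ ≤ ENNReal.ofReal (Real.exp (l * (n * ν))) * (ENNReal.ofReal ((Fintype.card I : ℝ) ^ ν) *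
          (ENNReal.ofReal (Real.exp (l * (s * q) + l ^ 2 / 2 + l * ν))) ^ n *
          ENNReal.ofReal (Real.exp (l * √n * √(Module.finrank ℝ V)))) := by
          rw [lintegral_const_mul _ (Measurable.iSup fun a => by fun_prop)]
          refine mul_le_mul_right (hmain.trans ?_) _
          gcongr
      _ = _ := by
          rw [hg, ENNReal.ofReal_mul (by positivity), ENNReal.ofReal_mul (by positivity),
            ENNReal.ofReal_mul (by positivity), ENNReal.ofReal_pow (by positivity)]
  have hI0 : (0 : ℝ) < Fintype.card I := Nat.cast_pos.2 (Fintype.card_pos_iff.2 hI)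
  have hlim : Filter.Tendsto (fun ν => ENNReal.ofReal (g ν)) (nhdsWithin 0 (Set.Ioi 0))
      (nhds (ENNReal.ofReal (g 0))) := by
    refine (ENNReal.continuous_ofReal.tendsto _).comp ?_
    have : Continuous g := by
      simp only [hg]
      have : Continuous fun ν : ℝ => (Fintype.card I : ℝ) ^ ν :=
        Real.continuous_const_rpow hI0.ne'
      fun_prop
    exact (this.tendsto 0).mono_left nhdsWithin_le_nhds
  have hfin := ge_of_tendsto hlim (Filter.eventually_of_mem
    (Ioo_mem_nhdsGT (zero_lt_one (α := ℝ))) hbound)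
  refine hfin.trans (le_of_eq ?_)
  congr 1
  simp only [hg, mul_zero, Real.exp_zero, Real.rpow_zero, one_mul, add_zero]
  rw [← Real.exp_nat_mul, ← Real.exp_add]
  congr 1
  ring

end

/-! ### Polar decomposition of the Gaussian measure. -/

section Polar

variable {V : Type*} [NormedAddCommGroup V] [InnerProductSpace ℝ V] [FiniteDimensional ℝ V]
  [MeasurableSpace V] [BorelSpace V]

/-- The normalized surface measure of the unit sphere. -/
noncomputable def sphereMeasure (V : Type*) [NormedAddCommGroup V] [InnerProductSpace ℝ V]
    [FiniteDimensional ℝ V] [MeasurableSpace V] [BorelSpace V] :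
    Measure (Metric.sphere (0 : V) 1) :=
  ((volume : Measure V).toSphere Set.univ)⁻¹ • (volume : Measure V).toSphere

lemma isProbabilityMeasure_sphereMeasure [Nontrivial V] :
    IsProbabilityMeasure (sphereMeasure V) := by
  constructor
  rw [sphereMeasure, Measure.smul_apply, smul_eq_mul]
  refine ENNReal.inv_mul_cancel ?_ (measure_ne_top _ _)
  rw [Ne, Measure.measure_univ_eq_zero]
  exact Measure.toSphere_ne_zero _

/-- The law of the norm of a standard Gaussian vector. -/
noncomputable def radialMeasure (V : Type*) [NormedAddCommGroup V] [InnerProductSpace ℝ V]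
    [FiniteDimensional ℝ V] [MeasurableSpace V] [BorelSpace V] : Measure (Set.Ioi (0 : ℝ)) :=
  (volume : Measure V).toSphere Set.univ •
    (Measure.volumeIoiPow (Module.finrank ℝ V - 1)).withDensity (fun ρ => ENNReal.ofReal
      ((2 * Real.pi) ^ (-(Module.finrank ℝ V : ℝ) / 2) * Real.exp (-ρ.1 ^ 2 / 2)))

instance : SFinite (radialMeasure V) := by
  unfold radialMeasure; infer_instance

lemma lintegral_stdGaussian_eq_polar [Nontrivial V] {F : V → ℝ≥0∞} (hF : Measurable F) :
    ∫⁻ x, F x ∂(stdGaussian V) = ∫⁻ p, F ((p.2 : ℝ) • (p.1 : V))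
      ∂((sphereMeasure V).prod (radialMeasure V)) := by
  have hcd := continuous_gaussDensity (E := V)
  have h0 : (volume : Measure V).toSphere Set.univ ≠ 0 := by
    rw [Ne, Measure.measure_univ_eq_zero]
    exact Measure.toSphere_ne_zero _
  have ht : (volume : Measure V).toSphere Set.univ ≠ ∞ := measure_ne_top _ _
  rw [sphereMeasure, radialMeasure, Measure.prod_smul_left, Measure.prod_smul_right, smul_smul,
    ENNReal.inv_mul_cancel h0 ht, one_smul, prod_withDensity_right (by fun_prop),
    lintegral_withDensity_eq_lintegral_mul _ (by fun_prop) (by fun_prop),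
    stdGaussian_eq_withDensity, lintegral_withDensity_eq_lintegral_mul _ (by fun_prop) hF]
  have hmp := (volume : Measure V).measurePreserving_homeomorphUnitSphereProd
  rw [← hmp.lintegral_comp (by fun_prop)]
  have hr : (volume : Measure V) = volume.restrict ({0}ᶜ : Set V) := by
    rw [restrict_compl_singleton]
  conv_lhs => rw [hr]
  rw [← lintegral_subtype_comap (measurableSet_singleton _).compl]
  refine lintegral_congr fun x => ?_
  have hx : ‖(x : V)‖ ≠ 0 := norm_ne_zero_iff.2 x.2
  have e1 : (((homeomorphUnitSphereProd V x).2 : ℝ)) = ‖(x : V)‖ := by simp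
  have e2 : (((homeomorphUnitSphereProd V x).1 : V)) = ‖(x : V)‖⁻¹ • (x : V) := by simp
  simp only [Pi.mul_apply]
  rw [e1, e2, smul_smul, mul_inv_cancel₀ hx, one_smul, gaussDensity]

lemma isProbabilityMeasure_radialMeasure [Nontrivial V] :
    IsProbabilityMeasure (radialMeasure V) := by
  have := isProbabilityMeasure_sphereMeasure (V := V)
  have h := lintegral_stdGaussian_eq_polar (V := V) (F := fun _ => 1) measurable_const
  rw [lintegral_one, measure_univ, lintegral_one, ← Set.univ_prod_univ, Measure.prod_prod,
    measure_univ, one_mul] at h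
  exact ⟨h.symm⟩

lemma measurePreserving_polar [Nontrivial V] :
    MeasurePreserving (fun p : Metric.sphere (0 : V) 1 × Set.Ioi (0 : ℝ) => (p.2 : ℝ) • (p.1 : V))
      ((sphereMeasure V).prod (radialMeasure V)) (stdGaussian V) := by
  have hm : Measurable
      (fun p : Metric.sphere (0 : V) 1 × Set.Ioi (0 : ℝ) => (p.2 : ℝ) • (p.1 : V)) := by fun_prop
  refine ⟨hm, ?_⟩
  ext s hs
  have h := lintegral_stdGaussian_eq_polar (V := V) (F := s.indicator 1)
    (measurable_const.indicator hs)
  rw [lintegral_indicator_one hs] at h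
  rw [Measure.map_apply hm hs, h, ← lintegral_indicator_one (hm hs)]
  rfl

/-- The mean of the norm of a standard Gaussian vector in dimension `r`. -/
noncomputable def gaussMean (r : ℕ) : ℝ :=
  √2 * Real.Gamma (((r : ℝ) + 1) / 2) / Real.Gamma ((r : ℝ) / 2)

/-- Polar coordinates turn both the total mass and the mean norm into Gamma integrals with the same
prefactor; total mass 1 eliminates it. -/
lemma integral_norm_stdGaussian [Nontrivial V] :
    ∫ x, ‖x‖ ∂(stdGaussian V) = gaussMean (Module.finrank ℝ V) := by
  set r := Module.finrank ℝ V with hr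
  have hr0 : 0 < r := Module.finrank_pos
  have hrc : ((r - 1 : ℕ) : ℝ) = (r : ℝ) - 1 := by
    rw [Nat.cast_sub (by omega)]; simp
  have hr1 : (0 : ℝ) < r := Nat.cast_pos.2 hr0
  set c : ℝ := (2 * Real.pi) ^ (-(r : ℝ) / 2) with hc
  set A : ℝ := r * (volume : Measure V).real (Metric.ball 0 1) * c with hA
  have h1 : ∫ x : V, gaussDensity x = A * ((1 / 2 : ℝ) ^ (-(r : ℝ) / 2) * (1 / 2) *
      Real.Gamma ((r : ℝ) / 2)) := by
    have h := integral_fun_norm_addHaar (volume : Measure V)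
      (fun y => c * Real.exp (-y ^ 2 / 2))
    have e : ∀ x : V, gaussDensity x = (fun y => c * Real.exp (-y ^ 2 / 2)) ‖x‖ := fun x => rfl
    simp_rw [e]
    rw [h, ← hr]
    have hi := integral_rpow_mul_exp_neg_mul_rpow (p := 2) (q := (r : ℝ) - 1) (b := 1 / 2)
      two_pos (by linarith) (by norm_num)
    rw [sub_add_cancel] at hi
    rw [← hi, nsmul_eq_mul, smul_eq_mul, hA, mul_assoc, mul_assoc]
    congr 2
    rw [← integral_const_mul]
    refine setIntegral_congr_fun measurableSet_Ioi fun y hy => ?_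
    simp only [smul_eq_mul]
    rw [← hrc, Real.rpow_natCast, Real.rpow_two, mul_left_comm]
    congr 3
    ring
  have h2 : ∫ x : V, gaussDensity x * ‖x‖ = A * ((1 / 2 : ℝ) ^ (-((r : ℝ) + 1) / 2) * (1 / 2) *
      Real.Gamma (((r : ℝ) + 1) / 2)) := by
    have h := integral_fun_norm_addHaar (volume : Measure V)
      (fun y => c * Real.exp (-y ^ 2 / 2) * y)
    have e : ∀ x : V, gaussDensity x * ‖x‖ = (fun y => c * Real.exp (-y ^ 2 / 2) * y) ‖x‖ :=
      fun x => rfl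
    simp_rw [e]
    rw [h, ← hr]
    have hi := integral_rpow_mul_exp_neg_mul_rpow (p := 2) (q := (r : ℝ)) (b := 1 / 2)
      two_pos (by linarith) (by norm_num)
    rw [← hi, nsmul_eq_mul, smul_eq_mul, hA, mul_assoc, mul_assoc]
    congr 2
    rw [← integral_const_mul]
    refine setIntegral_congr_fun measurableSet_Ioi fun y hy => ?_
    simp only [smul_eq_mul]
    rw [Real.rpow_natCast, Real.rpow_two]
    have : y ^ r = y ^ (r - 1) * y := by rw [← pow_succ]; congr 1; omega
    rw [this, show -(1 / 2 : ℝ) * y ^ 2 = -y ^ 2 / 2 by ring]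
    ring
  have h3 : ∫ x : V, gaussDensity x = 1 := integral_gaussDensity
  rw [integral_stdGaussian, h2]
  rw [h1] at h3
  have hG : 0 < Real.Gamma ((r : ℝ) / 2) := Real.Gamma_pos_of_pos (by positivity)
  have hpow : (1 / 2 : ℝ) ^ (-((r : ℝ) + 1) / 2) = (1 / 2 : ℝ) ^ (-(r : ℝ) / 2) * √2 := by
    rw [show -((r : ℝ) + 1) / 2 = -(r : ℝ) / 2 + (-(1 / 2)) by ring,
      Real.rpow_add (by norm_num), Real.rpow_neg (by norm_num : (0 : ℝ) ≤ 1 / 2) (1 / 2),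
      ← Real.sqrt_eq_rpow, one_div, Real.sqrt_inv, inv_inv]
  rw [hpow, gaussMean]
  rw [eq_div_iff hG.ne']
  linear_combination (√2 * Real.Gamma (((r : ℝ) + 1) / 2)) * h3

lemma lintegral_radialMeasure_id [Nontrivial V] :
    ∫⁻ ρ, ENNReal.ofReal ρ.1 ∂(radialMeasure V)
      = ENNReal.ofReal (gaussMean (Module.finrank ℝ V)) := by
  have := isProbabilityMeasure_sphereMeasure (V := V)
  have := isProbabilityMeasure_radialMeasure (V := V)
  have h := lintegral_stdGaussian_eq_polar (V := V) (F := fun x => ENNReal.ofReal ‖x‖)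
    (by fun_prop)
  rw [← ofReal_integral_eq_lintegral_ofReal integrable_norm_stdGaussian
    (.of_forall fun x => norm_nonneg x), integral_norm_stdGaussian] at h
  rw [h]
  have e : ∀ p : Metric.sphere (0 : V) 1 × Set.Ioi (0 : ℝ),
      ENNReal.ofReal ‖(p.2 : ℝ) • (p.1 : V)‖ = ENNReal.ofReal p.2.1 := by
    intro p
    have h1 : ‖(p.1 : V)‖ = 1 := norm_eq_of_mem_sphere p.1
    rw [norm_smul, h1, mul_one, Real.norm_of_nonneg (le_of_lt p.2.2)]
  simp_rw [e]
  have := (measurePreserving_snd (μ := sphereMeasure V) (ν := radialMeasure V)).lintegral_comp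
    (f := fun ρ : Set.Ioi (0 : ℝ) => ENNReal.ofReal ρ.1) (by fun_prop)
  exact this.symm

lemma ofReal_integral_le_lintegral {Ω : Type*} [MeasurableSpace Ω] {μ : Measure Ω} {f : Ω → ℝ}
    (hf : Integrable f μ) : ENNReal.ofReal (∫ ω, f ω ∂μ) ≤ ∫⁻ ω, ENNReal.ofReal (f ω) ∂μ := by
  refine ENNReal.ofReal_le_of_le_toReal ?_
  rw [integral_eq_lintegral_pos_part_sub_lintegral_neg_part hf]
  linarith [ENNReal.toReal_nonneg (a := ∫⁻ ω, ENNReal.ofReal (-f ω) ∂μ)]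

/-- Jensen's inequality, from the tangent of exp at c times the mean. It holds for either sign of
`c`, so it serves both tails. -/
lemma exp_mul_gaussMean_le [Nontrivial V] (c : ℝ) :
    ENNReal.ofReal (Real.exp (c * gaussMean (Module.finrank ℝ V)))
      ≤ ∫⁻ ρ, ENNReal.ofReal (Real.exp (c * ρ.1)) ∂(radialMeasure V) := by
  have := isProbabilityMeasure_radialMeasure (V := V)
  set m := gaussMean (Module.finrank ℝ V) with hm
  have hm0 : 0 ≤ m := by
    rw [hm, ← integral_norm_stdGaussian (V := V)]
    exact integral_nonneg fun x => norm_nonneg x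
  have hi : Integrable (fun ρ : Set.Ioi (0 : ℝ) => ρ.1) (radialMeasure V) := by
    refine ⟨by fun_prop, ?_⟩
    rw [hasFiniteIntegral_iff_ofReal (.of_forall fun ρ => le_of_lt ρ.2),
      lintegral_radialMeasure_id]
    exact ENNReal.ofReal_lt_top
  have hmean : ∫ ρ, ρ.1 ∂(radialMeasure V) = m := by
    rw [integral_eq_lintegral_of_nonneg_ae (.of_forall fun ρ => le_of_lt ρ.2) (by fun_prop),
      lintegral_radialMeasure_id, ENNReal.toReal_ofReal hm0]
  have hi2 : Integrable (fun ρ : Set.Ioi (0 : ℝ) =>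
      Real.exp (c * m) * (1 - c * m + c * ρ.1)) (radialMeasure V) :=
    ((integrable_const _).add (hi.const_mul c)).const_mul _
  have h1 : ∫ ρ, Real.exp (c * m) * (1 - c * m + c * ρ.1) ∂(radialMeasure V)
      = Real.exp (c * m) := by
    rw [integral_const_mul, integral_add (integrable_const _) (hi.const_mul c),
      integral_const_mul, hmean]
    simp
  rw [← h1]
  refine (ofReal_integral_le_lintegral hi2).trans (lintegral_mono fun ρ => ?_)
  refine ENNReal.ofReal_le_ofReal ?_
  have h2 := Real.add_one_le_exp (c * ρ.1 - c * m)
  calc Real.exp (c * m) * (1 - c * m + c * ρ.1)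
      ≤ Real.exp (c * m) * Real.exp (c * ρ.1 - c * m) :=
        mul_le_mul_of_nonneg_left (by linarith) (Real.exp_pos _).le
    _ = _ := by rw [← Real.exp_add]; congr 1; ring

variable {N I : Type*} [Fintype N] [DecidableEq N] [Fintype I]

/-- Passing from uniform vectors on the sphere to Gaussian vectors, by Jensen's inequality in
the norms. -/
lemma lintegral_iSup_exp_sphere_le [Nontrivial V] (u : I → V) (s l : ℝ) :
    ∫⁻ A, ⨆ a, ENNReal.ofReal (Real.exp (l * (s * (gaussMean (Module.finrank ℝ V) *
        ∑ i, |⟪u a, (A i : V)⟫|)))) ∂(Measure.pi fun _ : N => sphereMeasure V)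
      ≤ ∫⁻ z, ⨆ a, ENNReal.ofReal (Real.exp (l * (s * ∑ i, |⟪u a, z i⟫|)))
        ∂(Measure.pi fun _ : N => stdGaussian V) := by
  have := isProbabilityMeasure_sphereMeasure (V := V)
  have := isProbabilityMeasure_radialMeasure (V := V)
  set m := gaussMean (Module.finrank ℝ V) with hm
  have hG : Measurable fun z : N → V =>
      ⨆ a, ENNReal.ofReal (Real.exp (l * (s * ∑ i, |⟪u a, z i⟫|))) :=
    Measurable.iSup fun a => by fun_prop
  have h1 := (measurePreserving_pi (fun _ : N => (sphereMeasure V).prod (radialMeasure V))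
    (fun _ : N => stdGaussian V) fun _ => measurePreserving_polar).lintegral_comp hG
  rw [← h1]
  have h2 := (measurePreserving_arrowProdEquivProdArrow _ _ N (fun _ => sphereMeasure V)
    (fun _ => radialMeasure V)).symm.lintegral_comp (hG.comp (measurePreserving_pi
      (fun _ : N => (sphereMeasure V).prod (radialMeasure V))
      (fun _ : N => stdGaussian V) fun _ => measurePreserving_polar).measurable)
  simp only [Function.comp_def] at h2
  rw [← h2, lintegral_prod]
  swap
  · refine Measurable.aemeasurable ?_
    refine Measurable.iSup fun a => ?_
    simp only [MeasurableEquiv.arrowProdEquivProdArrow, MeasurableEquiv.symm_mk,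
      MeasurableEquiv.coe_mk, Equiv.arrowProdEquivProdArrow]
    dsimp
    fun_prop
  refine lintegral_mono fun A => ?_
  -- For fixed directions and a fixed index the exponent is linear in the independent radii, so the
  -- exponential factors and Jensen applies to each factor.
  refine iSup_le fun a => ?_
  calc ENNReal.ofReal (Real.exp (l * (s * (m * ∑ i, |⟪u a, (A i : V)⟫|))))
      = ∏ i, ENNReal.ofReal (Real.exp (l * s * |⟪u a, (A i : V)⟫| * m)) := by
        rw [← ENNReal.ofReal_prod_of_nonneg (fun _ _ => (Real.exp_pos _).le), ← Real.exp_sum]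
        congr 2
        rw [← Finset.sum_mul, ← Finset.mul_sum]
        ring
    _ ≤ ∏ i, ∫⁻ ρ, ENNReal.ofReal (Real.exp (l * s * |⟪u a, (A i : V)⟫| * ρ.1))
          ∂(radialMeasure V) :=
        Finset.prod_le_prod' fun i _ => exp_mul_gaussMean_le _
    _ = ∫⁻ ρ, ∏ i, ENNReal.ofReal (Real.exp (l * s * |⟪u a, (A i : V)⟫| * (ρ i).1))
          ∂(Measure.pi fun _ : N => radialMeasure V) := by
        rw [lintegral_pi_prod (fun _ : N => radialMeasure V)
          (f := fun i ρ => ENNReal.ofReal (Real.exp (l * s * |⟪u a, (A i : V)⟫| * ρ.1)))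
          fun i => by fun_prop]
    _ ≤ _ := by
        refine lintegral_mono fun ρ => ?_
        refine le_trans (le_of_eq ?_) (le_iSup _ a)
        rw [← ENNReal.ofReal_prod_of_nonneg (fun _ _ => (Real.exp_pos _).le), ← Real.exp_sum]
        congr 2
        rw [Finset.mul_sum, Finset.mul_sum]
        refine Finset.sum_congr rfl fun i _ => ?_
        simp only [MeasurableEquiv.arrowProdEquivProdArrow, MeasurableEquiv.symm_mk,
          MeasurableEquiv.coe_mk, Equiv.arrowProdEquivProdArrow, Equiv.coe_fn_symm_mk]
        rw [inner_smul_right, abs_mul, abs_of_pos (show (0 : ℝ) < (ρ i : ℝ) from (ρ i).2)]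
        ring

end Polar

/-! ### Bounds on the mean norm of a Gaussian vector. -/

section GaussMean

lemma gaussMean_pos {r : ℕ} (hr : 1 ≤ r) : 0 < gaussMean r := by
  have hr0 : (0 : ℝ) < r := by exact_mod_cast hr
  unfold gaussMean
  have h1 := Real.Gamma_pos_of_pos (show (0 : ℝ) < ((r : ℝ) + 1) / 2 by positivity)
  have h2 := Real.Gamma_pos_of_pos (show (0 : ℝ) < (r : ℝ) / 2 by positivity)
  positivity

lemma gaussMean_mul_succ {r : ℕ} (hr : 1 ≤ r) : gaussMean r * gaussMean (r + 1) = r := by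
  have hr0 : (0 : ℝ) < r := by exact_mod_cast hr
  have h1 := Real.Gamma_pos_of_pos (show (0 : ℝ) < ((r : ℝ) + 1) / 2 by positivity)
  have h2 := Real.Gamma_pos_of_pos (show (0 : ℝ) < (r : ℝ) / 2 by positivity)
  have h3 : Real.Gamma (((r + 1 : ℕ) + 1 : ℝ) / 2) = (r : ℝ) / 2 * Real.Gamma ((r : ℝ) / 2) := by
    rw [← Real.Gamma_add_one (by positivity)]
    congr 1
    push_cast
    ring
  have h4 : √(2 : ℝ) * √2 = 2 := Real.mul_self_sqrt (by norm_num)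
  unfold gaussMean
  rw [h3]
  push_cast
  field_simp
  nlinarith

/-- Midpoint log-convexity of Γ at r/2 and r/2 + 1. -/
lemma gaussMean_le_succ {r : ℕ} (hr : 1 ≤ r) : gaussMean r ≤ gaussMean (r + 1) := by
  have hr0 : (0 : ℝ) < r := by exact_mod_cast hr
  have h1 := Real.Gamma_pos_of_pos (show (0 : ℝ) < ((r : ℝ) + 1) / 2 by positivity)
  have h2 := Real.Gamma_pos_of_pos (show (0 : ℝ) < (r : ℝ) / 2 by positivity)
  have h3 := Real.Gamma_pos_of_pos (show (0 : ℝ) < ((r : ℝ) + 1 + 1) / 2 by positivity)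
  have h := Real.Gamma_mul_add_mul_le_rpow_Gamma_mul_rpow_Gamma
    (show (0 : ℝ) < (r : ℝ) / 2 by positivity) (show (0 : ℝ) < ((r : ℝ) + 1 + 1) / 2 by positivity)
    (a := 1 / 2) (b := 1 / 2) (by norm_num) (by norm_num) (by norm_num)
  rw [show 1 / 2 * ((r : ℝ) / 2) + 1 / 2 * (((r : ℝ) + 1 + 1) / 2) = ((r : ℝ) + 1) / 2 by ring,
    ← Real.sqrt_eq_rpow, ← Real.sqrt_eq_rpow, ← Real.sqrt_mul h2.le] at h
  have h' := (Real.le_sqrt h1.le (by positivity)).1 h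
  unfold gaussMean
  push_cast
  rw [div_le_div_iff₀ h2 h1]
  have := Real.sqrt_nonneg (2 : ℝ)
  nlinarith

lemma gaussMean_sq_le {r : ℕ} (hr : 1 ≤ r) : gaussMean r ^ 2 ≤ r := by
  rw [← gaussMean_mul_succ hr, pow_two]
  exact mul_le_mul_of_nonneg_left (gaussMean_le_succ hr) (gaussMean_pos hr).le

lemma sub_one_le_gaussMean_sq {r : ℕ} (hr : 1 ≤ r) : (r : ℝ) - 1 ≤ gaussMean r ^ 2 := by
  obtain ⟨k, rfl⟩ : ∃ k, r = k + 1 := ⟨r - 1, by omega⟩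
  rcases Nat.eq_zero_or_pos k with rfl | hk
  · simp; positivity
  · push_cast
    rw [add_sub_cancel_right, ← gaussMean_mul_succ hk, pow_two]
    exact mul_le_mul_of_nonneg_right (gaussMean_le_succ hk) (gaussMean_pos (by omega)).le

lemma gaussMean_add_two_sq_mul {n : ℕ} (hn : 1 ≤ n) :
    gaussMean (n + 2) ^ 2 * (n : ℝ) ^ 2 = ((n : ℝ) + 1) ^ 2 * gaussMean n ^ 2 := by
  have h1 := gaussMean_mul_succ hn
  have h2 := gaussMean_mul_succ (show 1 ≤ n + 1 by omega)
  push_cast at h2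
  rw [← h2, ← h1]
  ring

/-- The mean norm of a standard Gaussian vector satisfies `r - 1/2 ≤ (E‖z‖)²`. -/
lemma sub_half_le_gaussMean_sq {r : ℕ} (hr : 1 ≤ r) : (r : ℝ) - 1 / 2 ≤ gaussMean r ^ 2 := by
  have hr1 : (1 : ℝ) ≤ r := by exact_mod_cast hr
  -- The ratio of `gaussMean n ^ 2` to n - 1/2 does not increase from n to n + 2, because (n + 1)²(n
  -- - 1/2) ≤ n²(n + 3/2).
  have key : ∀ k : ℕ, gaussMean (r + 2 * k) ^ 2 * ((r : ℝ) - 1 / 2) ≤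
      gaussMean r ^ 2 * ((r : ℝ) + 2 * k - 1 / 2) := by
    intro k
    induction k with
    | zero => simp
    | succ k ih =>
      have hn : 1 ≤ r + 2 * k := by omega
      have h1 := gaussMean_add_two_sq_mul hn
      rw [show r + 2 * k + 2 = r + 2 * (k + 1) by ring] at h1
      set q := gaussMean (r + 2 * k) ^ 2
      set q' := gaussMean (r + 2 * (k + 1)) ^ 2
      push_cast at h1 ⊢
      have hk : (0 : ℝ) ≤ k := Nat.cast_nonneg k
      set x : ℝ := (r : ℝ) + 2 * k with hx
      have hx1 : 1 ≤ x := by rw [hx]; linarith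
      have hq : 0 ≤ q := sq_nonneg _
      have h2 : q' * (x - 1 / 2) ≤ q * (x + 3 / 2) := by
        refine le_of_mul_le_mul_right ?_ (show 0 < x ^ 2 by positivity)
        calc q' * (x - 1 / 2) * x ^ 2 = (x + 1) ^ 2 * q * (x - 1 / 2) := by rw [← h1]; ring
          _ ≤ q * (x + 3 / 2) * x ^ 2 := by nlinarith
      refine le_of_mul_le_mul_right ?_ (show 0 < x - 1 / 2 by linarith)
      calc q' * ((r : ℝ) - 1 / 2) * (x - 1 / 2) = q' * (x - 1 / 2) * ((r : ℝ) - 1 / 2) := by ring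
        _ ≤ q * (x + 3 / 2) * ((r : ℝ) - 1 / 2) :=
          mul_le_mul_of_nonneg_right h2 (by linarith)
        _ = q * ((r : ℝ) - 1 / 2) * (x + 3 / 2) := by ring
        _ ≤ gaussMean r ^ 2 * (x - 1 / 2) * (x + 3 / 2) :=
          mul_le_mul_of_nonneg_right ih (by linarith)
        _ = _ := by rw [hx]; ring
  -- The cruder bound n - 1 keeps the limit of this ratio at least 1, so the ratio is at least 1
  -- already at r.
  by_contra! hlt
  set ε := (r : ℝ) - 1 / 2 - gaussMean r ^ 2 with hε
  have hε0 : 0 < ε := by rw [hε]; linarith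
  obtain ⟨k, hk⟩ := exists_nat_gt (((r : ℝ) - 1 / 2) / ε)
  rw [div_lt_iff₀ hε0] at hk
  have h1 := key k
  have h2 := sub_one_le_gaussMean_sq (show 1 ≤ r + 2 * k by omega)
  push_cast at h2
  have hk0 : (0 : ℝ) ≤ k := Nat.cast_nonneg k
  have h3 := (mul_le_mul_of_nonneg_right h2 (show (0 : ℝ) ≤ (r : ℝ) - 1 / 2 by linarith)).trans h1
  rw [show gaussMean r ^ 2 = (r : ℝ) - 1 / 2 - ε by rw [hε]; ring] at h3
  nlinarith

end GaussMean

/-! ### Uniform tail bounds on the sphere. -/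

section Tail

variable {V : Type*} [NormedAddCommGroup V] [InnerProductSpace ℝ V] [FiniteDimensional ℝ V]
  [MeasurableSpace V] [BorelSpace V] [Nontrivial V]
variable {N : Type*} [Fintype N] [DecidableEq N]

/-- The threshold of the tail bound for `s * ∑ i, |⟪u, A i⟫|`, uniformly over unit vectors `u`. -/
noncomputable def tailLevel (n r : ℕ) (s L : ℝ) : ℝ :=
  n * (s * √(2 / Real.pi)) + √n * √r + √(2 * n * L)

/-- Chernoff's bound. That the estimate does not involve the size of `I` is what later allows all
unit vectors at once. -/
lemma measure_pi_sphere_exists_finite_le {I : Type*} [Fintype I] [Nonempty I] {u : I → V}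
    (hu : ∀ a, ‖u a‖ = 1) {s L : ℝ} (hs : s = 1 ∨ s = -1) (hL : 0 ≤ L) :
    (Measure.pi fun _ : N => sphereMeasure V) {A | ∃ a,
      tailLevel (Fintype.card N) (Module.finrank ℝ V) s L <
        s * (gaussMean (Module.finrank ℝ V) * ∑ i, |⟪u a, (A i : V)⟫|)}
      ≤ ENNReal.ofReal (Real.exp (-L)) := by
  set n := Fintype.card N with hn
  set r := Module.finrank ℝ V
  set T := tailLevel n r s L with hT
  -- The exponent `l` below has n in its denominator.
  rcases Nat.eq_zero_or_pos n with h0 | hpos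
  · have : IsEmpty N := Fintype.card_eq_zero_iff.1 h0
    have hT0 : T = 0 := by simp [hT, tailLevel, h0]
    simp [hT0]
  have hn0 : (0 : ℝ) < n := Nat.cast_pos.2 hpos
  -- The minimizer of nl²/2 - l√(2nL), whose minimum is -L.
  set l := √(2 * L / n) with hl
  have hl0 : 0 ≤ l := Real.sqrt_nonneg _
  have hl2 : l ^ 2 = 2 * L / n := Real.sq_sqrt (by positivity)
  have hlT : l * √(2 * n * L) = 2 * L := by
    rw [hl, ← Real.sqrt_mul (by positivity), show 2 * L / n * (2 * n * L) = (2 * L) ^ 2 by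
      field_simp, Real.sqrt_sq (by positivity)]
  set F : (N → Metric.sphere (0 : V) 1) → ℝ≥0∞ := fun A => ⨆ a, ENNReal.ofReal (Real.exp
    (l * (s * (gaussMean r * ∑ i, |⟪u a, (A i : V)⟫|)))) with hF
  have hFm : Measurable F := Measurable.iSup fun a => by fun_prop
  have h1 := mul_meas_ge_le_lintegral (μ := Measure.pi fun _ : N => sphereMeasure V) hFm
    (ENNReal.ofReal (Real.exp (l * T)))
  have h2 := h1.trans ((lintegral_iSup_exp_sphere_le u s l).trans
    (lintegral_iSup_exp_abs_le hs hu inferInstance hl0))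
  have hsub : {A : N → Metric.sphere (0 : V) 1 | ∃ a,
      T < s * (gaussMean r * ∑ i, |⟪u a, (A i : V)⟫|)} ⊆
      {A | ENNReal.ofReal (Real.exp (l * T)) ≤ F A} := by
    rintro A ⟨a, ha⟩
    refine le_trans (ENNReal.ofReal_le_ofReal (Real.exp_le_exp.2 ?_)) (le_iSup (fun a =>
      ENNReal.ofReal (Real.exp (l * (s * (gaussMean r * ∑ i, |⟪u a, (A i : V)⟫|))))) a)
    exact mul_le_mul_of_nonneg_left ha.le hl0
  refine (measure_mono hsub).trans ?_
  have hp : ENNReal.ofReal (Real.exp (l * T)) ≠ 0 := by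
    simpa using Real.exp_pos _
  rw [← ENNReal.mul_le_mul_iff_right hp ENNReal.ofReal_ne_top]
  refine h2.trans (le_of_eq ?_)
  rw [← ENNReal.ofReal_mul (Real.exp_pos _).le, ← Real.exp_add]
  congr 2
  rw [hT, tailLevel, hl2, show (n : ℝ) * (2 * L / n / 2) = L by field_simp]
  linear_combination -hlT

/-- A strict inequality at some unit vector persists at a point of a dense sequence, so the event is
covered by an increasing union of finite-family events with a common bound. -/
lemma measure_pi_sphere_exists_le {s L : ℝ} (hs : s = 1 ∨ s = -1) (hL : 0 ≤ L) :
    (Measure.pi fun _ : N => sphereMeasure V) {A | ∃ u : V, ‖u‖ = 1 ∧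
      tailLevel (Fintype.card N) (Module.finrank ℝ V) s L <
        s * (gaussMean (Module.finrank ℝ V) * ∑ i, |⟪u, (A i : V)⟫|)}
      ≤ ENNReal.ofReal (Real.exp (-L)) := by
  have hne : Nonempty (Metric.sphere (0 : V) 1) :=
    (NormedSpace.sphere_nonempty.2 zero_le_one).to_subtype
  set v := TopologicalSpace.denseSeq (Metric.sphere (0 : V) 1) with hv
  set S : ℕ → Set (N → Metric.sphere (0 : V) 1) := fun k => {A | ∃ a : Fin (k + 1),
    tailLevel (Fintype.card N) (Module.finrank ℝ V) s L <
        s * (gaussMean (Module.finrank ℝ V) * ∑ i, |⟪(v a : V), (A i : V)⟫|)} with hS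
  have hmono : Monotone S := by
    intro k k' hk A hA
    obtain ⟨a, ha⟩ := hA
    exact ⟨⟨a, by omega⟩, ha⟩
  have hsub : {A : N → Metric.sphere (0 : V) 1 | ∃ u : V, ‖u‖ = 1 ∧
      tailLevel (Fintype.card N) (Module.finrank ℝ V) s L <
        s * (gaussMean (Module.finrank ℝ V) * ∑ i, |⟪u, (A i : V)⟫|)} ⊆ ⋃ k, S k := by
    rintro A ⟨u, hu, h⟩
    have hopen : IsOpen {w : Metric.sphere (0 : V) 1 |
        tailLevel (Fintype.card N) (Module.finrank ℝ V) s L <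
        s * (gaussMean (Module.finrank ℝ V) * ∑ i, |⟪(w : V), (A i : V)⟫|)} :=
      isOpen_lt continuous_const (by fun_prop)
    obtain ⟨k, hk⟩ := (TopologicalSpace.denseRange_denseSeq _).exists_mem_open hopen
      ⟨⟨u, by simpa using hu⟩, h⟩
    exact Set.mem_iUnion.2 ⟨k, ⟨⟨k, by omega⟩, hk⟩⟩
  refine (measure_mono hsub).trans ?_
  rw [hmono.measure_iUnion]
  refine iSup_le fun k => measure_pi_sphere_exists_finite_le (fun a => ?_) hs hL
  simp

/-- A subspace is a cone, so its polar preimage is a product with all radii, while a proper subspace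
is null for the Gaussian measure. -/
lemma sphereMeasure_submodule {W : Submodule ℝ V} (hW : W ≠ ⊤) :
    sphereMeasure V {x | (x : V) ∈ W} = 0 := by
  have := isProbabilityMeasure_radialMeasure (V := V)
  have hWm : MeasurableSet (W : Set V) := W.closed_of_finiteDimensional.measurableSet
  have h0 : stdGaussian V (W : Set V) = 0 := by
    rw [stdGaussian_eq_withDensity]
    exact withDensity_absolutelyContinuous _ _ (Measure.addHaar_submodule _ _ hW)
  rw [← measurePreserving_polar.measure_preimage hWm.nullMeasurableSet] at h0
  have hset : (fun p : Metric.sphere (0 : V) 1 × Set.Ioi (0 : ℝ) => (p.2 : ℝ) • (p.1 : V)) ⁻¹'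
      (W : Set V) = {x : Metric.sphere (0 : V) 1 | (x : V) ∈ W} ×ˢ Set.univ := by
    ext p
    have hp : (p.2 : ℝ) ≠ 0 := (show (0 : ℝ) < p.2 from p.2.2).ne'
    simp [W.smul_mem_iff hp]
  rwa [hset, Measure.prod_prod, measure_univ, mul_one] at h0

end Tail

/-! ### Transfer to random vectors in a subspace of the ambient space. -/

section Subspace

variable {Ω : Type*} [MeasurableSpace Ω] {P : Measure Ω} {M : ℕ}
  {V : Submodule ℝ (Vec M)}

lemma uniformSphere_eq_map : uniformSphere V =
    (sphereMeasure V).map fun x : Metric.sphere (0 : V) 1 => ((x : V) : Vec M) := rfl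

lemma ae_mem_sphere_of_hasLaw {X : Ω → Vec M} (hX : HasLaw X (uniformSphere V) P) :
    ∀ᵐ ω ∂P, X ω ∈ V ∧ ‖X ω‖ = 1 := by
  have hm : MeasurableSet {x : Vec M | x ∈ V ∧ ‖x‖ = 1} :=
    (V.closed_of_finiteDimensional.inter (isClosed_eq continuous_norm continuous_const)).measurableSet
  refine ae_of_ae_map (p := fun x : Vec M => x ∈ V ∧ ‖x‖ = 1) hX.aemeasurable ?_
  rw [hX.map_eq, uniformSphere_eq_map, ae_map_iff (by fun_prop) hm]
  exact .of_forall fun x => ⟨(x : V).2, norm_eq_of_mem_sphere x⟩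

lemma ae_notMem_of_hasLaw [Nontrivial V] {X : Ω → Vec M} (hX : HasLaw X (uniformSphere V) P)
    {W : Submodule ℝ (Vec M)} (hW : ¬ V ≤ W) : ∀ᵐ ω ∂P, X ω ∉ W := by
  have hm : MeasurableSet {x : Vec M | x ∉ W} :=
    W.closed_of_finiteDimensional.measurableSet.compl
  refine ae_of_ae_map (p := fun x : Vec M => x ∉ W) hX.aemeasurable ?_
  rw [hX.map_eq, uniformSphere_eq_map, ae_map_iff (by fun_prop) hm, ae_iff]
  have h := sphereMeasure_submodule (V := V) (W := W.comap V.subtype) (by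
    rwa [Ne, Submodule.comap_subtype_eq_top])
  simpa using h

/-- Uniform tail bound for `s * ∑ i, |⟪u, X i⟫|` over the unit vectors of `V`. -/
lemma measure_exists_tail_le [IsProbabilityMeasure P] [Nontrivial V] {N : Type*} [Fintype N] [DecidableEq N]
    {X : N → Ω → Vec M} (hind : iIndepFun X P) (hX : ∀ i, HasLaw (X i) (uniformSphere V) P)
    {s L : ℝ} (hs : s = 1 ∨ s = -1) (hL : 0 ≤ L) :
    P {ω | ∃ u ∈ V, ‖u‖ = 1 ∧ tailLevel (Fintype.card N) (Module.finrank ℝ V) s L <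
        s * (gaussMean (Module.finrank ℝ V) * ∑ i, |⟪u, X i ω⟫|)}
      ≤ ENNReal.ofReal (Real.exp (-L)) := by
  have := isProbabilityMeasure_sphereMeasure (V := V)
  set S : Set (N → Vec M) := {x | ∃ u ∈ V, ‖u‖ = 1 ∧
    tailLevel (Fintype.card N) (Module.finrank ℝ V) s L <
        s * (gaussMean (Module.finrank ℝ V) * ∑ i, |⟪u, x i⟫|)} with hS
  -- The union over unit vectors is uncountable, so measurability is obtained from openness.
  have hSo : IsOpen S := by
    have : S = ⋃ u ∈ {u : Vec M | u ∈ V ∧ ‖u‖ = 1}, {x |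
        tailLevel (Fintype.card N) (Module.finrank ℝ V) s L <
        s * (gaussMean (Module.finrank ℝ V) * ∑ i, |⟪u, x i⟫|)} := by
      ext x
      simp [hS, and_assoc]
    rw [this]
    exact isOpen_biUnion fun u _ => isOpen_lt continuous_const (by fun_prop)
  have hmap : P.map (fun ω i => X i ω) = (Measure.pi fun _ : N => sphereMeasure V).map
      (fun A i => (((A i : Metric.sphere (0 : V) 1) : V) : Vec M)) := by
    rw [(iIndepFun_iff_map_fun_eq_pi_map fun i => (hX i).aemeasurable).1 hind]
    simp_rw [fun i => (hX i).map_eq, uniformSphere_eq_map]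
    have hc : Measurable fun x : Metric.sphere (0 : V) 1 => ((x : V) : Vec M) := by fun_prop
    have hpm := Measure.isProbabilityMeasure_map (μ := sphereMeasure V) hc.aemeasurable
    exact (Measure.pi_map_pi (μ := fun _ : N => sphereMeasure V) fun _ => hc.aemeasurable).symm
  have h1 : P ((fun ω i => X i ω) ⁻¹' S) ≤ ENNReal.ofReal (Real.exp (-L)) := by
    rw [← Measure.map_apply_of_aemeasurable
      (aemeasurable_pi_lambda _ fun i => (hX i).aemeasurable) hSo.measurableSet, hmap,
      Measure.map_apply (by fun_prop) hSo.measurableSet]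
    refine le_trans (measure_mono ?_) (measure_pi_sphere_exists_le (V := V) (N := N) hs hL)
    rintro A ⟨u, huV, hu, h⟩
    exact ⟨⟨u, huV⟩, by simpa using hu, by simpa [Submodule.coe_inner] using h⟩
  exact h1

end Subspace

/-! ### Numerical deduction of the outlier bound. -/

section Numeric

/-- A bound on the coefficients in front of `p`, `q`, `l` gives the bound on the sum. -/
lemma mul_div_le_of_coeff {x k m R p q l α β γ : ℝ} (hp : 0 ≤ p)
    (hq : 0 ≤ q) (hl : 0 ≤ l) (hα : x * √(2 / Real.pi) / m ≤ α) (hβ : x * R / m ≤ β)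
    (hγ : x / m ≤ γ) (hk : 0 ≤ k) :
    x * k * ((p * √(2 / Real.pi) + q * R + l) / m) ≤ k * (α * p + β * q + γ * l) := by
  have h1 := mul_le_mul_of_nonneg_right hα hp
  have h2 := mul_le_mul_of_nonneg_right hβ hq
  have h3 := mul_le_mul_of_nonneg_right hγ hl
  calc x * k * ((p * √(2 / Real.pi) + q * R + l) / m)
      = k * (x * √(2 / Real.pi) / m * p + x * R / m * q + x / m * l) := by ring
    _ ≤ _ := mul_le_mul_of_nonneg_left (by linarith) hk

/-- The constant 0.6367 is just above 2/π; its distance from 1 supplies the slack for replacing √r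
by m. -/
lemma mul_sqrt_two_div_pi_div_le {m r c x : ℝ} (hm : 0 < m) (hr : 0 < r) (hc : 0 < c)
    (h : 0.6367 * r ≤ c ^ 2 * m ^ 2) (hx : 0 ≤ x) : x * √(2 / Real.pi) / m ≤ c * (x / √r) := by
  have h2 : 2 / Real.pi ≤ 0.6367 := by
    rw [div_le_iff₀ Real.pi_pos]
    linarith [Real.pi_gt_d4]
  have h1 : √(2 / Real.pi) * √r ≤ c * m := by
    rw [← Real.sqrt_mul (by positivity), Real.sqrt_le_left (by positivity), mul_pow]
    exact (mul_le_mul_of_nonneg_right h2 hr.le).trans h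
  rw [mul_div_assoc', div_le_div_iff₀ hm (Real.sqrt_pos.2 hr)]
  calc x * √(2 / Real.pi) * √r = x * (√(2 / Real.pi) * √r) := by ring
    _ ≤ x * (c * m) := mul_le_mul_of_nonneg_left h1 hx
    _ = _ := by ring

lemma mul_div_le_mul_sqrt {m x a c : ℝ} (hm : 0 < m) (hx : 0 ≤ x) (hc : 0 ≤ c)
    (h : x * a ≤ c ^ 2 * m ^ 2) : x * √a / m ≤ c * √x := by
  have h1 : √x * √a ≤ c * m := by
    rw [← Real.sqrt_mul hx, Real.sqrt_le_left (by positivity), mul_pow]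
    exact h
  rw [div_le_iff₀ hm]
  calc x * √a = √x * (√x * √a) := by rw [← mul_assoc, Real.mul_self_sqrt hx]
    _ ≤ √x * (c * m) := mul_le_mul_of_nonneg_left h1 (Real.sqrt_nonneg _)
    _ = _ := by ring

lemma le_of_sq_mul_one_sub_le {x κ a b : ℝ} (hb : 0 ≤ b) (hx : x ^ 2 * (1 - κ ^ 2) ≤ 1)
    (ha : κ ^ 2 ≤ a) (ha1 : a < 1) (hab : 1 ≤ b ^ 2 * (1 - a)) : x ≤ b := by
  by_contra! h
  have h1 : b ^ 2 < x ^ 2 := pow_lt_pow_left₀ h hb two_ne_zero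
  have h2 := mul_lt_mul_of_pos_right h1 (show 0 < 1 - a by linarith)
  have h3 := mul_le_mul_of_nonneg_left (show 1 - a ≤ 1 - κ ^ 2 by linarith) (sq_nonneg x)
  linarith

/-- For κ²r ≤ 1 one gets x²(r - 1) ≤ r, hence x(r - 1) ≤ √(r(r - 1)) ≤ r - 1/2 ≤ m². The weaker
estimate m² ≥ r - 1 would not suffice for this chain. -/
lemma coeff_sqrt_sub_one_le {x κ r m : ℝ} (hr : 2 ≤ r) (hm0 : 0 < m)
    (hm : r - 1 / 2 ≤ m ^ 2) (hx0 : 0 ≤ x) (hx : x ^ 2 * (1 - κ ^ 2) ≤ 1)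
    (hκr : κ ^ 2 * r ≤ 1) : x / m ≤ √x / √(r - 1) := by
  have hT0 : 0 < √(r - 1) := Real.sqrt_pos.2 (by linarith)
  have hxr : x ^ 2 * (r - 1) ≤ r := by
    have h1 := mul_le_mul_of_nonneg_right hx (show 0 ≤ r by linarith)
    have h2 := mul_le_mul_of_nonneg_left hκr (sq_nonneg x)
    linarith
  have hxr' : x * (r - 1) ≤ m ^ 2 := by
    refine le_trans ?_ hm
    refine le_of_sq_le_sq ?_ (by linarith)
    calc (x * (r - 1)) ^ 2 = x ^ 2 * (r - 1) * (r - 1) := by ring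
      _ ≤ r * (r - 1) := mul_le_mul_of_nonneg_right hxr (by linarith)
      _ ≤ _ := by linarith
  have := mul_div_le_mul_sqrt (c := 1) hm0 hx0 zero_le_one (by linarith) (a := r - 1)
  rw [div_le_div_iff₀ hm0 hT0]
  rw [div_le_iff₀ hm0] at this
  linarith

variable {r m κ κ' x A p q l : ℝ}

/-- Compares the concentration level s with the bracket of the second inequality. In this section r,
p, q, l stand for r_o, n_o, √n_o, √(2 n_o log(1/δ)), m for the mean norm in dimension r_o, and A for
𝒜. -/
lemma outlier_level_le (hr : 2 ≤ r) (hm0 : 0 < m) (hm : r - 1 / 2 ≤ m ^ 2)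
    (hp : 0 ≤ p) (hq : 0 ≤ q) (hl : 0 ≤ l) :
    (p * √(2 / Real.pi) + q * √r + l) / m ≤ p / √r + 2 * q + l / √(r - 1) := by
  have hT0 : 0 < √(r - 1) := Real.sqrt_pos.2 (by linarith)
  have hTm : √(r - 1) ≤ m := (Real.sqrt_le_left hm0.le).2 (by linarith)
  have h := mul_div_le_of_coeff (x := 1) (α := 1 * (1 / √r)) (β := 2) (γ := 1 / √(r - 1)) hp hq hl
    (mul_sqrt_two_div_pi_div_le hm0 (by linarith) one_pos (by linarith) zero_le_one) (R := √r) ?_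
    (div_le_div_of_nonneg_left zero_le_one hT0 hTm) zero_le_one
  · rw [one_mul, one_mul] at h
    exact h.trans_eq (by ring)
  · rw [div_le_iff₀ hm0, one_mul]
    exact (Real.sqrt_le_left (by positivity)).2 (by linarith)

/-- Here 2κ ≥ 1, so the second inequality alone is enough. -/
lemma outlier_bound_of_half_le (hr : 2 ≤ r) (hm0 : 0 < m)
    (hm : r - 1 / 2 ≤ m ^ 2) (hκ2 : 1 / 2 ≤ κ) (hκ'0 : 0 ≤ κ') (hx0 : 0 < x)
    (hp : 0 ≤ p) (hq : 0 ≤ q) (hl : 0 ≤ l)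
    (h2 : 2 * κ * (x * κ') * (p / √r + 2 * q + l / √(r - 1) + √2 * l / √r) < A) :
    x * κ' * ((p * √(2 / Real.pi) + q * √r + l) / m) < A := by
  have hT0 : 0 < √(r - 1) := Real.sqrt_pos.2 (by linarith)
  refine lt_of_le_of_lt (mul_le_mul_of_nonneg_left (outlier_level_le hr hm0 hm hp hq hl)
    (by positivity)) (lt_of_le_of_lt ?_ h2)
  have h0 : 0 ≤ x * κ' * (p / √r + 2 * q + l / √(r - 1)) := by positivity
  have h0' : 0 ≤ 2 * κ * (x * κ') * (√2 * l / √r) := by positivity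
  calc x * κ' * (p / √r + 2 * q + l / √(r - 1))
      = 1 * (x * κ' * (p / √r + 2 * q + l / √(r - 1))) := by ring
    _ ≤ 2 * κ * (x * κ' * (p / √r + 2 * q + l / √(r - 1))) :=
      mul_le_mul_of_nonneg_right (by linarith) h0
    _ ≤ _ := by linarith

/-- Here x² ≤ r/(r - 1), so the third inequality alone is enough. -/
lemma outlier_bound_of_sq_mul_le (hr : 2 ≤ r) (hm0 : 0 < m) (hm : r - 1 / 2 ≤ m ^ 2)
    (hκ'0 : 0 ≤ κ') (hx0 : 0 < x) (hx116 : x ≤ 1.16)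
    (hx : x ^ 2 * (1 - κ ^ 2) ≤ 1) (hp : 0 ≤ p) (hq : 0 ≤ q) (hl : 0 ≤ l)
    (hκr : κ ^ 2 * r ≤ 1)
    (h3 : (x * p / √r + 2 * √x * q + √x * l / √(r - 1)) * κ' < A) :
    x * κ' * ((p * √(2 / Real.pi) + q * √r + l) / m) < A := by
  refine lt_of_le_of_lt (mul_div_le_of_coeff (α := 1 * (x / √r)) (β := 2 * √x)
    (γ := √x / √(r - 1)) hp hq hl
    (mul_sqrt_two_div_pi_div_le hm0 (by linarith) one_pos (by linarith) hx0.le)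
    (mul_div_le_mul_sqrt hm0 hx0.le (by norm_num) (by nlinarith))
    (coeff_sqrt_sub_one_le hr hm0 hm hx0.le hx hκr) hκ'0)
    (lt_of_eq_of_lt (by ring) h3)

/-- A convex combination: 0.65 of the third inequality and 0.35 of the second, whose factor 2κ is at
least 0.6. -/
lemma outlier_bound_of_mid (hr : 4 < r) (hm0 : 0 < m) (hm : r - 1 / 2 ≤ m ^ 2)
    (hκ : 0.3 ≤ κ) (hκ'0 : 0 ≤ κ') (hx1 : 1 ≤ x) (hx116 : x ≤ 1.16)
    (hp : 0 ≤ p) (hq : 0 ≤ q) (hl : 0 ≤ l)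
    (h2 : 2 * κ * (x * κ') * (p / √r + 2 * q + l / √(r - 1) + √2 * l / √r) < A)
    (h3 : (x * p / √r + 2 * √x * q + √x * l / √(r - 1)) * κ' < A) :
    x * κ' * ((p * √(2 / Real.pi) + q * √r + l) / m) < A := by
  have hR0 : 0 < √r := Real.sqrt_pos.2 (by linarith)
  have hR2 : √r ^ 2 = r := Real.sq_sqrt (by linarith)
  have hT0 : 0 < √(r - 1) := Real.sqrt_pos.2 (by linarith)
  have hTm : √(r - 1) ≤ m := (Real.sqrt_le_left hm0.le).2 (by linarith)
  have hx0 : 0 < x := by linarith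
  have hy2 : √x ^ 2 = x := Real.sq_sqrt hx0.le
  have hy1 : 1 ≤ √x := Real.one_le_sqrt.2 hx1
  have hyx : √x ≤ x := by nlinarith
  have hs2' : (1.414 : ℝ) ≤ √2 := Real.le_sqrt_of_sq_le (by norm_num)
  -- In the coefficients 0.21 = 0.35 · 0.6, and 1.7 = 2 · 0.65 + 0.4 where 0.4√x is covered by
  -- 0.42x. The values 0.86 and 1.7 are affordable because r > 4 and x ≤ 1.16.
  refine lt_of_le_of_lt (mul_div_le_of_coeff (α := 0.86 * (x / √r)) (β := 1.7 * √x)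
    (γ := 0.65 * (√x / √(r - 1)) + 0.21 * x * (1 / √(r - 1) + √2 / √r)) hp hq hl
    (mul_sqrt_two_div_pi_div_le hm0 (by linarith) (by norm_num) (by linarith) hx0.le)
    (mul_div_le_mul_sqrt hm0 hx0.le (by norm_num) (by nlinarith))
    ((div_le_div_of_nonneg_left hx0.le hT0 hTm).trans ?_) hκ'0) ?_
  · have hTR : 0.86 * √r ≤ √(r - 1) := Real.le_sqrt_of_sq_le (by rw [mul_pow, hR2]; linarith)
    have h5 : 1.2 / √(r - 1) ≤ √2 / √r := by
      rw [div_le_div_iff₀ hT0 hR0]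
      calc 1.2 * √r ≤ 1.414 * (0.86 * √r) := by linarith
        _ ≤ √2 * √(r - 1) := mul_le_mul hs2' hTR (by positivity) (by positivity)
    have h6 : x ≤ 0.65 * √x + 0.21 * x * 2.2 := by
      have : √x ≤ 1.08 := (Real.sqrt_le_left (by norm_num)).2 (by linarith)
      have := mul_le_mul_of_nonneg_left this (Real.sqrt_nonneg x)
      rw [← pow_two, hy2] at this
      linarith
    calc x / √(r - 1) ≤ (0.65 * √x + 0.21 * x * 2.2) / √(r - 1) :=
          div_le_div_of_nonneg_right h6 hT0.le
      _ = 0.65 * (√x / √(r - 1)) + 0.21 * x * (1 / √(r - 1) + 1.2 / √(r - 1)) := by ring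
      _ ≤ _ := by gcongr
  · have h0 : 0 ≤ x * κ' * (p / √r + 2 * q + l / √(r - 1) + √2 * l / √r) := by positivity
    have h7 := mul_le_mul_of_nonneg_right (show 0.6 ≤ 2 * κ by linarith) h0
    have h9 : κ' * √x * q ≤ κ' * x * q := by gcongr
    have h10 : 0 ≤ κ' * x * q := by positivity
    calc κ' * (0.86 * (x / √r) * p + 1.7 * √x * q +
        (0.65 * (√x / √(r - 1)) + 0.21 * x * (1 / √(r - 1) + √2 / √r)) * l) =
        0.65 * ((x * p / √r + 2 * √x * q + √x * l / √(r - 1)) * κ') +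
        0.35 * (0.6 * (x * κ' * (p / √r + 2 * q + l / √(r - 1) + √2 * l / √r)))
        + (0.4 * (κ' * √x * q) - 0.42 * (κ' * x * q)) := by ring
      _ < A := by linarith

/-- A convex combination: 0.85 of the third inequality and 0.15 of the first. As κ²r ≥ 1, the
coefficient κ√2 of the first is not small compared with 1/√(r - 1), and x is within five percent of
1. -/
lemma outlier_bound_of_small (hr : 11 ≤ r) (hm0 : 0 < m) (hm : r - 1 / 2 ≤ m ^ 2)
    (hκ0 : 0 ≤ κ) (hκ : κ ^ 2 ≤ 0.09) (hκ'0 : 0 ≤ κ') (hκ'1 : κ' ≤ 1) (hx1 : 1 ≤ x)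
    (hx : x ^ 2 * (1 - κ ^ 2) ≤ 1) (hp : 0 ≤ p) (hq : 0 ≤ q) (hl : 0 ≤ l)
    (hκr : 1 ≤ κ ^ 2 * r) (h1 : κ * √2 * l ≤ A)
    (h3 : (x * p / √r + 2 * √x * q + √x * l / √(r - 1)) * κ' < A) :
    x * κ' * ((p * √(2 / Real.pi) + q * √r + l) / m) < A := by
  have hT0 : 0 < √(r - 1) := Real.sqrt_pos.2 (by linarith)
  have hT2 : √(r - 1) ^ 2 = r - 1 := Real.sq_sqrt (by linarith)
  have hTm : √(r - 1) ≤ m := (Real.sqrt_le_left hm0.le).2 (by linarith)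
  have hx0 : 0 < x := by linarith
  have hy1 : 1 ≤ √x := Real.one_le_sqrt.2 hx1
  have hs2' : (1.414 : ℝ) ≤ √2 := Real.le_sqrt_of_sq_le (by norm_num)
  -- κ²(r - 1) ≥ 1 - 0.09 = 0.91.
  have hκT : 0.953 ≤ κ * √(r - 1) := by
    refine le_of_sq_le_sq ?_ (by positivity)
    rw [mul_pow, hT2]
    linarith
  have hx105 : x ≤ 1.0488 := le_of_sq_mul_one_sub_le (by norm_num) hx hκ (by norm_num) (by norm_num)
  refine lt_of_le_of_lt (mul_div_le_of_coeff (α := 0.85 * (x / √r)) (β := 1.7 * √x)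
    (γ := 0.85 * (√x / √(r - 1)) + 0.15 * (κ * √2)) hp hq hl
    (mul_sqrt_two_div_pi_div_le hm0 (by linarith) (by norm_num) (by linarith) hx0.le)
    (mul_div_le_mul_sqrt hm0 hx0.le (by norm_num) (by nlinarith))
    ((div_le_div_of_nonneg_left hx0.le hT0 hTm).trans ?_) hκ'0) ?_
  · rw [div_le_iff₀ hT0, add_mul, mul_assoc, div_mul_cancel₀ _ hT0.ne']
    have := mul_le_mul hs2' hκT (by norm_num) (by positivity)
    linarith
  · have h4 := mul_le_mul_of_nonneg_right hκ'1 (show 0 ≤ κ * √2 * l by positivity)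
    calc κ' * (0.85 * (x / √r) * p + 1.7 * √x * q +
        (0.85 * (√x / √(r - 1)) + 0.15 * (κ * √2)) * l) =
        0.85 * ((x * p / √r + 2 * √x * q + √x * l / √(r - 1)) * κ') +
        0.15 * (κ' * (κ * √2 * l)) := by ring
      _ < A := by linarith

lemma outlier_bound_of_conditions (hr : 2 ≤ r) (hm0 : 0 < m)
    (hm : r - 1 / 2 ≤ m ^ 2) (hκ : 0 ≤ κ) (hκ'0 : 0 ≤ κ') (hκ'1 : κ' ≤ 1) (hx1 : 1 ≤ x)
    (hx : x ^ 2 * (1 - κ ^ 2) ≤ 1) (hp : 0 ≤ p) (hq : 0 ≤ q) (hl : 0 ≤ l)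
    (h1 : κ * √2 * l ≤ A)
    (h2 : 2 * κ * (x * κ') * (p / √r + 2 * q + l / √(r - 1) + √2 * l / √r) < A)
    (h3 : κ < 1 / 2 → (x * p / √r + 2 * √x * q + √x * l / √(r - 1)) * κ' < A) :
    x * κ' * ((p * √(2 / Real.pi) + q * √r + l) / m) < A := by
  have hx0 : 0 < x := by linarith
  rcases le_or_gt (1 / 2) κ with hκ2 | hκ2
  · exact outlier_bound_of_half_le hr hm0 hm hκ2 hκ'0 hx0 hp hq hl h2
  have hκ4 : κ ^ 2 < 1 / 4 := by nlinarith only [hκ, hκ2]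
  have hx116 : x ≤ 1.16 :=
    le_of_sq_mul_one_sub_le (by norm_num) hx hκ4.le (by norm_num) (by norm_num)
  rcases le_or_gt (κ ^ 2 * r) 1 with hκr | hκr
  · exact outlier_bound_of_sq_mul_le hr hm0 hm hκ'0 hx0 hx116 hx hp hq hl hκr (h3 hκ2)
  rcases le_or_gt 0.3 κ with hκ3 | hκ3
  · refine outlier_bound_of_mid ?_ hm0 hm hκ3 hκ'0 hx1 hx116 hp hq hl h2 (h3 hκ2)
    nlinarith only [hκr, hκ4, hr]
  · have hκ9 : κ ^ 2 ≤ 0.09 := by nlinarith only [hκ, hκ3]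
    refine outlier_bound_of_small ?_ hm0 hm hκ hκ9 hκ'0 hκ'1 hx1 hx hp hq hl hκr.le h1 (h3 hκ2)
    nlinarith only [hκr, hκ9, hr]

end Numeric

/-! ### The spectral norm between two subspaces. -/

section CrossNorm

variable {M : ℕ} {V W : Submodule ℝ (Vec M)}

lemma crossNorm_nonneg : 0 ≤ crossNorm V W := by
  unfold crossNorm
  exact ContinuousLinearMap.opNorm_nonneg _

lemma norm_starProjection_le_crossNorm_mul {w : Vec M} (hw : w ∈ W) :
    ‖V.starProjection w‖ ≤ crossNorm V W * ‖w‖ :=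
  (V.starProjection ∘L W.subtypeL).le_opNorm ⟨w, hw⟩

lemma inner_starProjection_of_mem {v x : Vec M} (hv : v ∈ V) :
    ⟪v, V.starProjection x⟫ = ⟪v, x⟫ := by
  rw [← V.inner_starProjection_left_eq_right, V.starProjection_eq_self_iff.2 hv]

/-- An operator and its adjoint have the same norm, so the two subspaces may exchange roles. -/
lemma norm_starProjection_le_crossNorm_mul' {v : Vec M} (hv : v ∈ V) :
    ‖W.starProjection v‖ ≤ crossNorm V W * ‖v‖ := by
  have hw : W.starProjection v ∈ W := W.starProjection_apply_mem v
  rcases (norm_nonneg (W.starProjection v)).eq_or_lt with h0 | h0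
  · rw [← h0]
    exact mul_nonneg crossNorm_nonneg (norm_nonneg _)
  refine le_of_mul_le_mul_right ?_ h0
  calc ‖W.starProjection v‖ * ‖W.starProjection v‖
      = ⟪W.starProjection v, W.starProjection v⟫ := (real_inner_self_eq_norm_mul_norm _).symm
    _ = ⟪W.starProjection v, v⟫ := inner_starProjection_of_mem hw
    _ = ⟪v, V.starProjection (W.starProjection v)⟫ := by
      rw [inner_starProjection_of_mem hv, real_inner_comm]
    _ ≤ ‖v‖ * ‖V.starProjection (W.starProjection v)‖ := real_inner_le_norm _ _
    _ ≤ ‖v‖ * (crossNorm V W * ‖W.starProjection v‖) :=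
      mul_le_mul_of_nonneg_left (norm_starProjection_le_crossNorm_mul hw) (norm_nonneg _)
    _ = _ := by ring

lemma crossNorm_le_one : crossNorm V W ≤ 1 := by
  refine ContinuousLinearMap.opNorm_le_bound _ zero_le_one fun w => ?_
  rw [one_mul]
  exact V.norm_starProjection_apply_le _

/-- Pythagoras. Applied to the outlier nearest to U it yields x²(1 - κ²) ≤ 1. -/
lemma one_sub_crossNorm_sq_le {b : Vec M} (hb : b ∈ W) (hb1 : ‖b‖ = 1) :
    1 - crossNorm V W ^ 2 ≤ ‖Vᗮ.starProjection b‖ ^ 2 := by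
  have h1 := V.norm_sq_eq_add_norm_sq_starProjection b
  have h2 := norm_starProjection_le_crossNorm_mul (V := V) hb
  rw [hb1, mul_one] at h2
  have h3 := pow_le_pow_left₀ (norm_nonneg _) h2 2
  rw [hb1] at h1
  linarith

end CrossNorm

/-! ### Optimal directions and recovery, given concentration. -/

section Deterministic

variable {M no ni : ℕ} {U Uo : Submodule ℝ (Vec M)} {D : Fin no ⊕ Fin ni → Vec M} {a s : ℝ}

lemma l1_eq_add (c : Vec M) :
    l1 D c = ∑ k, |⟪D (Sum.inl k), c⟫| + ∑ i, |⟪D (Sum.inr i), c⟫| := by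
  simp [l1, Fintype.sum_sum_type]

lemma one_le_l1 {k : Fin no ⊕ Fin ni} {c : Vec M} (h : IsOptimalDirection D (D k) c) :
    1 ≤ l1 D c := by
  have h1 : |⟪D k, c⟫| ≤ l1 D c :=
    Finset.single_le_sum (f := fun i => |⟪D i, c⟫|) (fun i _ => abs_nonneg _) (Finset.mem_univ k)
  rwa [h.1, abs_one] at h1

lemma sum_outliers_le (hB : ∀ w ∈ Uo, ∑ k, |⟪D (Sum.inl k), w⟫| ≤ s * ‖w‖)
    (hout : ∀ j, D (Sum.inl j) ∈ Uo) (c : Vec M) :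
    ∑ k, |⟪D (Sum.inl k), c⟫| ≤ s * ‖Uo.starProjection c‖ := by
  refine le_of_eq_of_le ?_ (hB _ (Uo.starProjection_apply_mem c))
  simp_rw [fun k => inner_starProjection_of_mem (x := c) (hout k)]

lemma le_sum_inliers (hA : ∀ u ∈ U, a * ‖u‖ ≤ ∑ i, |⟪D (Sum.inr i), u⟫|)
    (hin : ∀ i, D (Sum.inr i) ∈ U) (c : Vec M) :
    a * ‖U.starProjection c‖ ≤ ∑ i, |⟪D (Sum.inr i), c⟫| := by
  refine (hA _ (U.starProjection_apply_mem c)).trans_eq ?_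
  simp_rw [fun i => inner_starProjection_of_mem (x := c) (hin i)]

/-- Feasibility for a unit vector of U forces the projection of `c` onto U to have norm at least 1,
and only that projection meets the inliers. -/
lemma le_l1_inlier (ha : 0 ≤ a) (hA : ∀ u ∈ U, a * ‖u‖ ≤ ∑ i, |⟪D (Sum.inr i), u⟫|)
    (hin : ∀ i, D (Sum.inr i) ∈ U) (hin1 : ∀ i, ‖D (Sum.inr i)‖ = 1) {i : Fin ni} {c : Vec M}
    (hc : IsOptimalDirection D (D (Sum.inr i)) c) : a ≤ l1 D c := by
  have h1 : 1 ≤ ‖U.starProjection c‖ := by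
    have h := real_inner_le_norm (D (Sum.inr i)) (U.starProjection c)
    rwa [inner_starProjection_of_mem (hin i), hc.1, hin1, one_mul] at h
  have h2 := le_sum_inliers hA hin c
  have h3 : 0 ≤ ∑ k, |⟪D (Sum.inl k), c⟫| := Finset.sum_nonneg fun _ _ => abs_nonneg _
  rw [l1_eq_add]
  nlinarith

lemma sum_inliers_eq_zero (hin : ∀ i, D (Sum.inr i) ∈ U) {c : Vec M} (hc : c ∈ Uᗮ) :
    ∑ i, |⟪D (Sum.inr i), c⟫| = 0 :=
  Finset.sum_eq_zero fun i _ => by rw [hc _ (hin i), abs_zero]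

/-- The direction of the projection of `b` onto `Uᗮ`, normalized to be feasible for `b`. -/
noncomputable def residualDirection (U : Submodule ℝ (Vec M)) (b : Vec M) : Vec M :=
  (‖Uᗮ.starProjection b‖ ^ 2)⁻¹ • Uᗮ.starProjection b

lemma residualDirection_mem (b : Vec M) : residualDirection U b ∈ Uᗮ :=
  Uᗮ.smul_mem _ (Uᗮ.starProjection_apply_mem b)

lemma norm_starProjection_orthogonal_pos {b : Vec M} (hb : b ∉ U) :
    0 < ‖Uᗮ.starProjection b‖ := by
  rw [norm_pos_iff, Ne, Submodule.starProjection_apply_eq_zero_iff,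
    Submodule.orthogonal_orthogonal]
  exact hb

lemma inner_residualDirection {b : Vec M} (hb : b ∉ U) : ⟪b, residualDirection U b⟫ = 1 := by
  have h0 := norm_starProjection_orthogonal_pos hb
  have h1 := inner_starProjection_of_mem (x := b) (Uᗮ.starProjection_apply_mem b)
  rw [real_inner_self_eq_norm_sq] at h1
  rw [residualDirection, inner_smul_right, real_inner_comm, ← h1, inv_mul_cancel₀ (by positivity)]

lemma norm_residualDirection {b : Vec M} (hb : b ∉ U) :
    ‖residualDirection U b‖ = ‖Uᗮ.starProjection b‖⁻¹ := by
  have h0 := norm_starProjection_orthogonal_pos hb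
  rw [residualDirection, norm_smul, norm_inv, norm_pow, norm_norm]
  field_simp

lemma sum_outliers_residualDirection_le (hs : 0 ≤ s)
    (hB : ∀ w ∈ Uo, ∑ k, |⟪D (Sum.inl k), w⟫| ≤ s * ‖w‖)
    (hout : ∀ j, D (Sum.inl j) ∈ Uo) {b : Vec M} (hb : b ∉ U) {x : ℝ}
    (hx : ‖Uᗮ.starProjection b‖⁻¹ ≤ x) :
    ∑ k, |⟪D (Sum.inl k), residualDirection U b⟫| ≤ x * crossNorm Uo Uᗮ * s := by
  refine (sum_outliers_le hB hout _).trans ?_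
  have h1 := norm_starProjection_le_crossNorm_mul (V := Uo) (residualDirection_mem (U := U) b)
  rw [norm_residualDirection hb] at h1
  have h2 := mul_le_mul_of_nonneg_left hx (crossNorm_nonneg (V := Uo) (W := Uᗮ))
  calc s * ‖Uo.starProjection (residualDirection U b)‖ ≤ s * (crossNorm Uo Uᗮ * x) :=
        mul_le_mul_of_nonneg_left (h1.trans h2) hs
    _ = _ := by ring

/-- The residual direction is a feasible competitor that annihilates every inlier. -/
lemma l1_outlier_le (hs : 0 ≤ s) (hB : ∀ w ∈ Uo, ∑ k, |⟪D (Sum.inl k), w⟫| ≤ s * ‖w‖)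
    (hout : ∀ j, D (Sum.inl j) ∈ Uo) (hin : ∀ i, D (Sum.inr i) ∈ U) {j : Fin no}
    (hj : D (Sum.inl j) ∉ U) {x : ℝ} (hx : ‖Uᗮ.starProjection (D (Sum.inl j))‖⁻¹ ≤ x)
    {c : Vec M} (hc : IsOptimalDirection D (D (Sum.inl j)) c) :
    l1 D c ≤ x * crossNorm Uo Uᗮ * s := by
  refine (hc.2 _ (inner_residualDirection hj)).trans ?_
  rw [l1_eq_add, sum_inliers_eq_zero hin (residualDirection_mem _), add_zero]
  exact sum_outliers_residualDirection_le hs hB hout hj hx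

/-- If the inliers dominate, the optimal directions of the outliers are orthogonal to `U`. -/
lemma mem_orthogonal_of_isOptimalDirection (hs : 0 ≤ s)
    (hA : ∀ u ∈ U, a * ‖u‖ ≤ ∑ i, |⟪D (Sum.inr i), u⟫|)
    (hB : ∀ w ∈ Uo, ∑ k, |⟪D (Sum.inl k), w⟫| ≤ s * ‖w‖)
    (hout : ∀ j, D (Sum.inl j) ∈ Uo) (hout1 : ∀ j, ‖D (Sum.inl j)‖ = 1)
    (hin : ∀ i, D (Sum.inr i) ∈ U) {j : Fin no}
    (hj : D (Sum.inl j) ∉ U) {x : ℝ} (hx : ‖Uᗮ.starProjection (D (Sum.inl j))‖⁻¹ ≤ x)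
    (ha : crossNorm U Uo * (s + x * crossNorm Uo Uᗮ * s) < a)
    {c : Vec M} (hc : IsOptimalDirection D (D (Sum.inl j)) c) : c ∈ Uᗮ := by
  set b := D (Sum.inl j) with hb
  set v := U.starProjection c with hv
  have hvU : v ∈ U := U.starProjection_apply_mem c
  set w := residualDirection U b with hw
  set τ := ⟪b, v⟫ with hτ
  have hτ1 : |τ| ≤ crossNorm U Uo * ‖v‖ := by
    have h1 : τ = ⟪U.starProjection b, v⟫ := by
      rw [hτ, real_inner_comm, real_inner_comm v, inner_starProjection_of_mem hvU]
    rw [h1]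
    refine (abs_real_inner_le_norm _ _).trans (mul_le_mul_of_nonneg_right ?_ (norm_nonneg _))
    have h2 := norm_starProjection_le_crossNorm_mul (V := U) (hout j)
    rwa [hout1, mul_one] at h2
  have hcv : c - v ∈ Uᗮ := U.sub_starProjection_mem_orthogonal c
  -- The competitor trades the U-component v of `c` for the multiple of the residual direction that
  -- restores feasibility. It saves at least a‖v‖ on the inliers and adds at most κ(s + xκ's)‖v‖ on
  -- the outliers, which forces v = 0.
  have hc'U : c - v + τ • w ∈ Uᗮ := Uᗮ.add_mem hcv (Uᗮ.smul_mem _ (residualDirection_mem b))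
  have hc' : ⟪b, c - v + τ • w⟫ = 1 := by
    rw [inner_add_right, inner_sub_right, inner_smul_right, hc.1, inner_residualDirection hj]
    ring
  have hopt := hc.2 _ hc'
  rw [l1_eq_add, l1_eq_add, sum_inliers_eq_zero hin hc'U, add_zero] at hopt
  have h1 : ∑ k, |⟪D (Sum.inl k), c - v + τ • w⟫| ≤ ∑ k, |⟪D (Sum.inl k), c⟫|
      + ∑ k, |⟪D (Sum.inl k), v⟫| + |τ| * ∑ k, |⟪D (Sum.inl k), w⟫| := by
    rw [Finset.mul_sum, ← Finset.sum_add_distrib, ← Finset.sum_add_distrib]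
    refine Finset.sum_le_sum fun k _ => ?_
    rw [inner_add_right, inner_sub_right, inner_smul_right, ← abs_mul]
    exact (abs_add_le _ _).trans (add_le_add_left (abs_sub _ _) _)
  have h2 : ∑ k, |⟪D (Sum.inl k), v⟫| ≤ s * (crossNorm U Uo * ‖v‖) :=
    (sum_outliers_le hB hout v).trans
      (mul_le_mul_of_nonneg_left (norm_starProjection_le_crossNorm_mul' hvU) hs)
  have h3 := sum_outliers_residualDirection_le hs hB hout hj hx
  have h30 : 0 ≤ ∑ k, |⟪D (Sum.inl k), residualDirection U b⟫| :=
    Finset.sum_nonneg fun _ _ => abs_nonneg _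
  have h4 := mul_le_mul hτ1 h3 h30 (mul_nonneg crossNorm_nonneg (norm_nonneg _))
  have h5 := le_sum_inliers hA hin c
  have h6 : a * ‖v‖ ≤ crossNorm U Uo * (s + x * crossNorm Uo Uᗮ * s) * ‖v‖ := by linarith
  have h7 : ‖v‖ = 0 := by
    by_contra h
    have hpos : 0 < ‖v‖ := lt_of_le_of_ne (norm_nonneg _) (Ne.symm h)
    exact absurd (le_of_mul_le_mul_right h6 hpos) (not_le.2 ha)
  rw [norm_eq_zero] at h7
  rwa [h7, sub_zero] at hcv

lemma inv_norm_starProjection_le_norm {b c : Vec M} (hb : b ∉ U) (hc : c ∈ Uᗮ)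
    (hbc : ⟪b, c⟫ = 1) : ‖Uᗮ.starProjection b‖⁻¹ ≤ ‖c‖ := by
  have h0 := norm_starProjection_orthogonal_pos hb
  have h1 : ⟪Uᗮ.starProjection b, c⟫ = 1 := by
    rw [real_inner_comm, inner_starProjection_of_mem hc, real_inner_comm, hbc]
  have h2 := real_inner_le_norm (Uᗮ.starProjection b) c
  rw [h1] at h2
  rw [inv_le_iff_one_le_mul₀ h0]
  linarith

lemma span_inliers_eq (ha : 0 < a) (hA : ∀ u ∈ U, a * ‖u‖ ≤ ∑ i, |⟪D (Sum.inr i), u⟫|)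
    (hin : ∀ i, D (Sum.inr i) ∈ U) :
    Submodule.span ℝ (D '' Set.range Sum.inr) = U := by
  have hle : Submodule.span ℝ (D '' Set.range Sum.inr) ≤ U := by
    rw [Submodule.span_le]
    rintro _ ⟨_, ⟨i, rfl⟩, rfl⟩
    exact hin i
  have h1 := Submodule.sup_orthogonal_inf_of_hasOrthogonalProjection hle
  have h2 : (Submodule.span ℝ (D '' Set.range Sum.inr))ᗮ ⊓ U = ⊥ := by
    rw [eq_bot_iff]
    rintro u ⟨hu, huU⟩
    have h3 := hA u huU
    rw [Finset.sum_eq_zero fun i _ => by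
      rw [hu _ (Submodule.subset_span ⟨_, ⟨i, rfl⟩, rfl⟩), abs_zero]] at h3
    have h4 : ‖u‖ ≤ 0 := by
      by_contra! h
      nlinarith
    simpa using h4
  rwa [h2, sup_bot_eq] at h1

lemma recoversExactly_of_lt {c : Fin no ⊕ Fin ni → Vec M} {r : ℕ}
    (hU : Module.finrank ℝ U = r)
    (hspan : Submodule.span ℝ (D '' Set.range Sum.inr) = U)
    (hj : ∀ j, D (Sum.inl j) ∉ U)
    (hlt : ∀ (i : Fin ni) (j : Fin no),
      innovationValue D (c (Sum.inr i)) < innovationValue D (c (Sum.inl j))) :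
    RecoversExactly D c r U := by
  refine ⟨⟨U, Set.range Sum.inr, ?_, hspan.symm, hU⟩, ?_⟩
  · rintro _ ⟨i, rfl⟩ (j | j) hjS
    · exact (hlt i j).le
    · exact absurd ⟨j, rfl⟩ hjS
  · rintro W ⟨S, hS, rfl, hW⟩
    -- A selection containing an outlier contains all inliers, so its span contains U and the
    -- outlier; dimension r would put the outlier in U. A selection of inliers alone has its span
    -- inside U, and the dimensions agree.
    by_cases hout : ∃ j, Sum.inl j ∈ S
    · obtain ⟨j, hjS⟩ := hout
      have hle : U ≤ Submodule.span ℝ (D '' S) := by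
        rw [← hspan]
        refine Submodule.span_mono (Set.image_mono ?_)
        rintro _ ⟨i, rfl⟩
        by_contra hi
        exact absurd (hS _ hjS _ hi) (not_le.2 (hlt i j))
      have heq := Submodule.eq_of_le_of_finrank_eq hle (hU.trans hW.symm)
      refine absurd ?_ (hj j)
      rw [heq]
      exact Submodule.subset_span ⟨_, hjS, rfl⟩
    · refine Submodule.eq_of_le_of_finrank_eq ?_ (hW.trans hU.symm)
      rw [← hspan]
      refine Submodule.span_mono (Set.image_mono ?_)
      rintro (j | i) hi
      · exact absurd ⟨j, hi⟩ hout
      · exact ⟨i, rfl⟩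

end Deterministic

/-! ### Matching the concentration levels with 𝒜. -/

section Levels

lemma forall_le_of_not_exists_tail {M : ℕ} {V : Submodule ℝ (Vec M)} {N : Type*} [Fintype N]
    {x : N → Vec M} {σ m T : ℝ}
    (h : ¬ ∃ u ∈ V, ‖u‖ = 1 ∧ T < σ * (m * ∑ i, |⟪u, x i⟫|)) (u : Vec M) (hu : u ∈ V) :
    σ * (m * ∑ i, |⟪x i, u⟫|) ≤ T * ‖u‖ := by
  rcases (norm_nonneg u).eq_or_lt with h0 | h0
  · have hu0 : u = 0 := norm_eq_zero.1 h0.symm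
    simp [hu0]
  · push Not at h
    have h1 := h (‖u‖⁻¹ • u) (V.smul_mem _ hu) (by
      rw [norm_smul, norm_inv, norm_norm, inv_mul_cancel₀ h0.ne'])
    have h2 : ∀ i, |⟪‖u‖⁻¹ • u, x i⟫| = ‖u‖⁻¹ * |⟪x i, u⟫| := fun i => by
      rw [real_inner_smul_left, abs_mul, abs_of_pos (inv_pos.2 h0), real_inner_comm]
    simp_rw [h2] at h1
    rw [← Finset.mul_sum] at h1
    have h3 := mul_le_mul_of_nonneg_right h1 h0.le
    refine le_of_eq_of_le ?_ h3
    field_simp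

/-- The lower level for the inliers dominates `calA`. -/
lemma calA_mul_gaussMean_le {ni r : ℕ} (hr : 2 ≤ r) (δ : ℝ) (hδ0 : 0 < δ) (hδ1 : δ < 1) :
    calA ni r δ * gaussMean r ≤ -tailLevel ni r (-1) (Real.log (1 / δ)) := by
  have hr2 : (2 : ℝ) ≤ r := by exact_mod_cast hr
  have hm0 := gaussMean_pos (show 1 ≤ r by omega)
  have hm1 := gaussMean_sq_le (show 1 ≤ r by omega)
  have hm2 := sub_one_le_gaussMean_sq (show 1 ≤ r by omega)
  set m := gaussMean r with hm
  have hR0 : 0 < √(r : ℝ) := Real.sqrt_pos.2 (by linarith)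
  have hT0 : 0 < √((r : ℝ) - 1) := Real.sqrt_pos.2 (by linarith)
  -- The three terms of 𝒜 are converted by √(r - 1) ≤ m ≤ √r ≤ 2m; the last comparison needs r ≥ 2.
  have hmR : m ≤ √r := Real.le_sqrt_of_sq_le hm1
  have hTm : √((r : ℝ) - 1) ≤ m := (Real.sqrt_le_left hm0.le).2 hm2
  have hRm : √(r : ℝ) ≤ 2 * m := (Real.sqrt_le_left (by positivity)).2 (by nlinarith)
  have hL : 0 ≤ Real.log (1 / δ) := Real.log_nonneg (by rw [le_div_iff₀ hδ0]; linarith)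
  have h1 : √(2 / Real.pi) * (ni / √(r : ℝ)) * m ≤ √(2 / Real.pi) * ni := by
    rw [mul_assoc]
    refine mul_le_mul_of_nonneg_left ?_ (Real.sqrt_nonneg _)
    rw [div_mul_eq_mul_div, div_le_iff₀ hR0]
    exact mul_le_mul_of_nonneg_left hmR (Nat.cast_nonneg _)
  have h2 : √(ni : ℝ) * √r ≤ √(ni : ℝ) * (2 * m) :=
    mul_le_mul_of_nonneg_left hRm (Real.sqrt_nonneg _)
  have h3 : √(2 * ni * Real.log (1 / δ)) ≤
      √(2 * ni * Real.log (1 / δ) / ((r : ℝ) - 1)) * m := by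
    rw [Real.sqrt_div (by positivity), div_mul_eq_mul_div, le_div_iff₀ hT0]
    exact mul_le_mul_of_nonneg_left hTm (Real.sqrt_nonneg _)
  rw [calA, tailLevel]
  linarith

end Levels

/-! ### The deterministic conclusion and the good event. -/

section Main

variable {M no ni r ro : ℕ} {U Uo : Submodule ℝ (Vec M)} {δ : ℝ}
  {D c : Fin no ⊕ Fin ni → Vec M}

lemma exists_min_norm_starProjection {U : Submodule ℝ (Vec M)} (hno : 1 ≤ no)
    (D : Fin no ⊕ Fin ni → Vec M) :
    ∃ j : Fin no, (∀ k, ‖Uᗮ.starProjection (D (Sum.inl j))‖ ≤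
      ‖Uᗮ.starProjection (D (Sum.inl k))‖) ∧
      (⨅ k : Fin no, ‖Uᗮ.starProjection (D (Sum.inl k))‖) =
        ‖Uᗮ.starProjection (D (Sum.inl j))‖ := by
  have : Nonempty (Fin no) := ⟨⟨0, hno⟩⟩
  obtain ⟨j, hj⟩ := exists_eq_ciInf_of_finite
    (f := fun k : Fin no => ‖Uᗮ.starProjection (D (Sum.inl k))‖)
  refine ⟨j, fun k => ?_, hj.symm⟩
  rw [hj]
  exact ciInf_le (Set.finite_range _).bddBelow k

lemma norm_le_chi (j : Fin no) : ‖c (Sum.inl j)‖ ≤ chi c :=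
  le_ciSup (f := fun j : Fin no => ‖c (Sum.inl j)‖) (Set.finite_range _).bddAbove j

/-- The deterministic part: on the two concentration events the conditions imply recovery. -/
lemma recovery_of_concentration (hro : 2 ≤ ro) (hno : 1 ≤ no)
    (hU : Module.finrank ℝ U = r) (hδ0 : 0 < δ) (hδ1 : δ < 1)
    (hout : ∀ j, D (Sum.inl j) ∈ Uo) (hout1 : ∀ j, ‖D (Sum.inl j)‖ = 1)
    (houtU : ∀ j, D (Sum.inl j) ∉ U)
    (hin : ∀ i, D (Sum.inr i) ∈ U) (hin1 : ∀ i, ‖D (Sum.inr i)‖ = 1)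
    (hA : ∀ u ∈ U, calA ni r δ * ‖u‖ ≤ ∑ i, |⟪D (Sum.inr i), u⟫|)
    (hB : ∀ w ∈ Uo, ∑ k, |⟪D (Sum.inl k), w⟫| ≤
      tailLevel no ro 1 (Real.log (1 / δ)) / gaussMean ro * ‖w‖)
    (hopt : ∀ k, IsOptimalDirection D (D k) (c k))
    (hcond : Conditions r ro U Uo δ D c) :
    (∀ (i : Fin ni) (j : Fin no),
      innovationValue D (c (Sum.inr i)) < innovationValue D (c (Sum.inl j))) ∧
      RecoversExactly D c r U := by
  obtain ⟨j₀, hj₀, hinf⟩ := exists_min_norm_starProjection (U := U) hno D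
  set L := Real.log (1 / δ) with hL
  set m := gaussMean ro with hm
  set κ := crossNorm U Uo with hκ
  set κ' := crossNorm Uo Uᗮ with hκ'
  set μ := ‖Uᗮ.starProjection (D (Sum.inl j₀))‖ with hμ
  set A := calA ni r δ with hAdef
  obtain ⟨h1, h2, h3⟩ := hcond
  have hro2 : (2 : ℝ) ≤ ro := by exact_mod_cast hro
  have hno1 : (1 : ℝ) ≤ no := by exact_mod_cast hno
  have hL0 : 0 ≤ L := Real.log_nonneg (by rw [le_div_iff₀ hδ0]; linarith)
  have hLn : L ≤ Real.log (no / δ) :=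
    Real.log_le_log (by positivity) (div_le_div_of_nonneg_right hno1 hδ0.le)
  have hm0 : 0 < m := gaussMean_pos (by omega)
  have hm2 : (ro : ℝ) - 1 / 2 ≤ m ^ 2 := sub_half_le_gaussMean_sq (by omega)
  have hμ0 : 0 < μ := norm_starProjection_orthogonal_pos (houtU j₀)
  have hμκ' : μ ≤ κ' := by
    have h := norm_starProjection_le_crossNorm_mul' (W := Uᗮ) (hout j₀)
    rwa [hout1, mul_one] at h
  have hκ0 : 0 ≤ κ := crossNorm_nonneg
  have hκ'0 : 0 ≤ κ' := crossNorm_nonneg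
  have hκ'1 : κ' ≤ 1 := crossNorm_le_one
  set x := μ⁻¹ with hx
  have hx0 : 0 < x := inv_pos.2 hμ0
  have hxμ : x * μ = 1 := inv_mul_cancel₀ hμ0.ne'
  have hx1 : 1 ≤ x := (one_le_inv₀ hμ0).2 (hμκ'.trans hκ'1)
  have hxκ' : 1 ≤ x * κ' := hxμ ▸ mul_le_mul_of_nonneg_left hμκ' hx0.le
  have hxκ : x ^ 2 * (1 - κ ^ 2) ≤ 1 := by
    have h := mul_le_mul_of_nonneg_left
      (one_sub_crossNorm_sq_le (V := U) (hout j₀) (hout1 j₀)) (sq_nonneg x)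
    rwa [← hμ, ← mul_pow, hxμ, one_pow] at h
  have hxj : ∀ j, ‖Uᗮ.starProjection (D (Sum.inl j))‖⁻¹ ≤ x := fun j =>
    inv_anti₀ hμ0 (hj₀ j)
  set q := √(no : ℝ) with hq
  set l := √(2 * no * L) with hl
  have hq0 : 0 ≤ q := Real.sqrt_nonneg _
  have hl0 : 0 ≤ l := Real.sqrt_nonneg _
  set s := tailLevel no ro 1 L / m with hs
  have hs' : s = (no * √(2 / Real.pi) + q * √ro + l) / m := by rw [hs, tailLevel, one_mul]
  have hs0 : 0 ≤ s := by rw [hs']; positivity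
  have hlT : √(2 * no * L / ((ro : ℝ) - 1)) = l / √((ro : ℝ) - 1) :=
    Real.sqrt_div (by positivity) _
  have hκl : κ * √2 * l = 2 * κ * √(no * L) := by
    rw [hl, mul_assoc, ← Real.sqrt_mul (by norm_num), show 2 * (2 * no * L) = 2 ^ 2 * (no * L) by
      ring, Real.sqrt_mul (by norm_num), Real.sqrt_sq (by norm_num)]
    ring
  have hc1 : κ * √2 * l ≤ A := by
    rw [hκl]
    have e1 : 2 * κ * √(no * L) ≤ 2 * κ * √(no * Real.log (no / δ)) := by gcongr
    have e2 : 0 ≤ 2 * (nz D c : ℝ) * κ := by positivity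
    linarith
  have hxi : 2 * κ / xi U Uo D = 2 * κ * (x * κ') := by
    rw [xi, hinf, ← hκ', div_div_eq_mul_div, div_eq_mul_inv, ← hx]
    ring
  -- The second inequality with 1/ξ = xκ', after dropping n_z' and η'_δ and lowering log(n_o/δ) to
  -- log(1/δ); then 2√((n_o/r_o) log(1/δ)) is √2 l/√r_o.
  have hc2 : 2 * κ * (x * κ') * (no / √ro + 2 * q + l / √((ro : ℝ) - 1) + √2 * l / √ro) < A := by
    rw [hxi, hlT] at h2
    refine lt_of_le_of_lt (mul_le_mul_of_nonneg_left ?_ (by positivity)) h2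
    have hη : 0 ≤ etaPrime no ro δ := (Real.sqrt_nonneg _).trans (le_max_right _ _)
    have e1 : √2 * l / √ro = 2 * √(no / ro * L) := by
      rw [hl, ← Real.sqrt_mul (by norm_num), ← Real.sqrt_div (by positivity),
        show 2 * (2 * no * L) / ro = 2 ^ 2 * (no / ro * L) by ring,
        Real.sqrt_mul (by norm_num), Real.sqrt_sq (by norm_num)]
    have e2 : √(no / ro * L) ≤ √(((no : ℝ) / ro + etaPrime no ro δ) * Real.log (no / δ)) := by
      gcongr
      linarith
    have e3 : (0 : ℝ) ≤ nz D c := Nat.cast_nonneg _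
    rw [e1]
    linarith
  have hA0 : 0 < A := lt_of_le_of_lt (by positivity) hc2
  have hsS := outlier_level_le hro2 hm0 hm2 (p := (no : ℝ)) (by positivity) hq0 hl0
  rw [← hs'] at hsS
  have hc3 : κ < 1 / 2 →
      (x * no / √ro + 2 * √x * q + √x * l / √((ro : ℝ) - 1)) * κ' < A := by
    intro hκ2
    have horth : c (Sum.inl j₀) ∈ Uᗮ := by
      refine mem_orthogonal_of_isOptimalDirection (j := j₀) hs0 hA hB hout hout1 hin (houtU j₀)
        (hxj j₀) (lt_of_le_of_lt ?_ hc2) (hopt _)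
      -- As xκ' ≥ 1, the domination condition for orthogonality follows from 2κxκ's < 𝒜.
      have e1 : s ≤ x * κ' * s := le_mul_of_one_le_left hs0 hxκ'
      have e2 : 0 ≤ √2 * l / √(ro : ℝ) := by positivity
      calc κ * (s + x * κ' * s) ≤ κ * (x * κ' * s + x * κ' * s) := by gcongr
        _ = 2 * κ * (x * κ') * s := by ring
        _ ≤ _ := mul_le_mul_of_nonneg_left (by linarith) (by positivity)
    have hχ : x ≤ chi c := (inv_norm_starProjection_le_norm (houtU j₀) horth
      (hopt (Sum.inl j₀)).1).trans (norm_le_chi j₀)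
    refine lt_of_le_of_lt (mul_le_mul_of_nonneg_right ?_ hκ'0) h3
    have e1 : √x * q ≤ √(chi c * no) := by
      rw [hq, ← Real.sqrt_mul hx0.le]
      gcongr
    have e2 : √x * l / √((ro : ℝ) - 1) ≤ √(chi c * (2 * no * L / ((ro : ℝ) - 1))) := by
      rw [mul_div_assoc, ← hlT, ← Real.sqrt_mul hx0.le]
      have : 0 ≤ 2 * no * L / ((ro : ℝ) - 1) := div_nonneg (by positivity) (by linarith)
      gcongr
    have e3 : x * no / √(ro : ℝ) ≤ chi c * no / √(ro : ℝ) := by gcongr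
    linarith
  have hfinal : x * κ' * s < A := by
    rw [hs']
    exact outlier_bound_of_conditions hro2 hm0 hm2 hκ0 hκ'0 hκ'1 hx1 hxκ (by positivity) hq0 hl0
      hc1 hc2 hc3
  have hlt : ∀ (i : Fin ni) (j : Fin no),
      innovationValue D (c (Sum.inr i)) < innovationValue D (c (Sum.inl j)) := by
    intro i j
    have e1 := l1_outlier_le hs0 hB hout hin (houtU j) (hxj j) (hopt (Sum.inl j))
    have e2 := le_l1_inlier hA0.le hA hin hin1 (hopt (Sum.inr i))
    -- Positivity of the outlier cost is needed to invert strictly, since 1/0 = 0.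
    have e3 := one_le_l1 (hopt (Sum.inl j))
    exact one_div_lt_one_div_of_lt (by linarith) (by linarith)
  exact ⟨hlt, recoversExactly_of_lt hU (span_inliers_eq hA0 hA hin) houtU hlt⟩

end Main

end ISearch

theorem theorem3 {Ω : Type*} [MeasurableSpace Ω] (P : Measure Ω) [IsProbabilityMeasure P]
    {M ni no r ro : ℕ} (hr : 2 ≤ r) (hro : 2 ≤ ro) (hno : 1 ≤ no)
    (U Uo : Submodule ℝ (ISearch.Vec M))
    (hU : Module.finrank ℝ U = r) (hUo : Module.finrank ℝ Uo = ro)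
    (hUoU : ¬ Uo ≤ U) (hUUo : ¬ U ≤ Uo)
    (δ : ℝ) (hδ0 : 0 < δ) (hδ1 : δ < 1)
    (D : Fin no ⊕ Fin ni → Ω → ISearch.Vec M)
    (hindep : iIndepFun D P)
    (hout : ∀ j : Fin no, HasLaw (D (Sum.inl j)) (ISearch.uniformSphere Uo) P)
    (hin : ∀ i : Fin ni, HasLaw (D (Sum.inr i)) (ISearch.uniformSphere U) P) :
    ∃ G : Set Ω, MeasurableSet G ∧ ENNReal.ofReal (1 - 5 * δ) ≤ P G ∧
      ∀ ω ∈ G, ∀ c : Fin no ⊕ Fin ni → ISearch.Vec M,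
        (∀ k, ISearch.IsOptimalDirection (fun l => D l ω) (D k ω) (c k)) →
        ISearch.Conditions r ro U Uo δ (fun l => D l ω) c →
          (∀ (i : Fin ni) (j : Fin no),
            ISearch.innovationValue (fun l => D l ω) (c (Sum.inr i)) <
              ISearch.innovationValue (fun l => D l ω) (c (Sum.inl j))) ∧
          ISearch.RecoversExactly (fun l => D l ω) c r U := by
  have hUn : Nontrivial U := Module.nontrivial_of_finrank_pos (R := ℝ) (by omega)
  have hUon : Nontrivial Uo := Module.nontrivial_of_finrank_pos (R := ℝ) (by omega)
  set L := Real.log (1 / δ) with hLdef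
  have hL0 : 0 ≤ L := Real.log_nonneg (by rw [le_div_iff₀ hδ0]; linarith)
  have hexpL : Real.exp (-L) = δ := by
    rw [hLdef, one_div, Real.log_inv, neg_neg, Real.exp_log hδ0]
  have hBA := ISearch.measure_exists_tail_le (X := fun i => D (Sum.inr i))
    (hindep.precomp Sum.inr_injective) hin
    (s := -1) (Or.inr rfl) hL0
  have hBB := ISearch.measure_exists_tail_le (X := fun i => D (Sum.inl i))
    (hindep.precomp Sum.inl_injective) hout
    (s := 1) (Or.inl rfl) hL0
  rw [hexpL, Fintype.card_fin, hU] at hBA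
  rw [hexpL, Fintype.card_fin, hUo] at hBB
  set EA : Set Ω := {ω | ∃ u ∈ U, ‖u‖ = 1 ∧ ISearch.tailLevel ni r (-1) L <
    -1 * (ISearch.gaussMean r * ∑ i, |⟪u, D (Sum.inr i) ω⟫|)} with hEA
  set EB : Set Ω := {ω | ∃ u ∈ Uo, ‖u‖ = 1 ∧ ISearch.tailLevel no ro 1 L <
    1 * (ISearch.gaussMean ro * ∑ i, |⟪u, D (Sum.inl i) ω⟫|)} with hEB
  set EN : Set Ω := {ω | ¬ ((∀ j : Fin no, (D (Sum.inl j) ω ∈ Uo ∧ ‖D (Sum.inl j) ω‖ = 1) ∧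
    D (Sum.inl j) ω ∉ U) ∧ ∀ i : Fin ni, D (Sum.inr i) ω ∈ U ∧ ‖D (Sum.inr i) ω‖ = 1)} with hEN
  have hN : P EN = 0 := by
    rw [hEN, ← ae_iff, Filter.eventually_and, ae_all_iff, ae_all_iff]
    exact ⟨fun j => (ISearch.ae_mem_sphere_of_hasLaw (hout j)).and
      (ISearch.ae_notMem_of_hasLaw (hout j) hUoU),
      fun i => ISearch.ae_mem_sphere_of_hasLaw (hin i)⟩
  -- Only the two concentration events cost probability, δ each.
  have hbad : P (EA ∪ EB ∪ EN) ≤ ENNReal.ofReal (2 * δ) := by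
    calc P (EA ∪ EB ∪ EN) ≤ P EA + P EB + P EN :=
          (measure_union_le _ _).trans (add_le_add_left (measure_union_le _ _) _)
      _ ≤ ENNReal.ofReal δ + ENNReal.ofReal δ + 0 :=
          add_le_add (add_le_add hBA hBB) hN.le
      _ = ENNReal.ofReal (2 * δ) := by
          rw [add_zero, ← ENNReal.ofReal_add hδ0.le hδ0.le, two_mul]
  -- The bad events need not be measurable, since the data are only almost everywhere measurable; a
  -- measurable hull has the same measure.
  refine ⟨(toMeasurable P (EA ∪ EB ∪ EN))ᶜ, (measurableSet_toMeasurable _ _).compl, ?_, ?_⟩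
  · rw [prob_compl_eq_one_sub (measurableSet_toMeasurable _ _), measure_toMeasurable]
    calc ENNReal.ofReal (1 - 5 * δ) ≤ ENNReal.ofReal (1 - 2 * δ) :=
          ENNReal.ofReal_le_ofReal (by linarith)
      _ = 1 - ENNReal.ofReal (2 * δ) := by
          rw [ENNReal.ofReal_sub _ (by positivity), ENNReal.ofReal_one]
      _ ≤ _ := tsub_le_tsub_left hbad _
  · intro ω hω c hopt hcond
    have hω' : ω ∉ EA ∪ EB ∪ EN := fun h => hω (subset_toMeasurable _ _ h)
    simp only [Set.mem_union, not_or] at hω'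
    obtain ⟨⟨hωA, hωB⟩, hωN⟩ := hω'
    obtain ⟨hO, hI⟩ := not_not.1 hωN
    have hmr : 0 < ISearch.gaussMean r := ISearch.gaussMean_pos (by omega)
    have hmo : 0 < ISearch.gaussMean ro := ISearch.gaussMean_pos (by omega)
    refine ISearch.recovery_of_concentration hro hno hU hδ0 hδ1 (fun j => (hO j).1.1)
      (fun j => (hO j).1.2) (fun j => (hO j).2) (fun i => (hI i).1) (fun i => (hI i).2)
      (fun u hu => ?_) (fun w hw => ?_) hopt hcond
    · have h1 := ISearch.forall_le_of_not_exists_tail hωA u hu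
      have h2 := mul_le_mul_of_nonneg_right
        (ISearch.calA_mul_gaussMean_le (ni := ni) hr δ hδ0 hδ1) (norm_nonneg u)
      refine le_of_mul_le_mul_left ?_ hmr
      linarith
    · have h1 := ISearch.forall_le_of_not_exists_tail hωB w hw
      rw [div_mul_eq_mul_div, le_div_iff₀ hmo]
      linarith
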